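/- \textbf{Setting.} Let $x=(q,v)\in\mathbb{R}^{n}\times\mathbb{R}^{n}$, $u\in\mathbb{R}^{m}$. Let $f_{\mathrm v}(q,v,u)\in\mathbb{R}^n$, $M(q)\in\mathbb{R}^{n\times n}$ (symmetric positive definite), $f_c(q)\in\mathbb{R}$ and $b(q)\in\mathbb{R}^n$ be twice continuously differentiable, $n(q)=\nabla f_c(q)$, $\mu>0$. Whenever $f_c(q)=0$, assume $n(q)\neq 0$ and $b(q)^\top M(q)^{-1}n(q)=0$. A state is called \emph{impacting} if $f_c(q)=0$ and $n(q)^\top v<0$. Let $T>0$, $\bar x_0=(q_0,v_0)$ with $f_c(q_0)\ge 0$, and let $\Psi(x)\in\mathbb{R}$, $g(x,u)\in\mathbb{R}^{n_g}$, $r(x)\in\mathbb{R}^{n_r}$ be arbitrary functions. Controls are Lebesgue measurable, ``optimal'' means globally optimal, and an optimal control is the control of an optimal solution. \textbf{CLS problem.} Minimize $\Psi(x(T))$ over trajectories $x=(q,v)$, contact forces $(\lambda_{\mathrm n},\lambda_{\mathrm t})$ and controls $u$ on $[0,T]$ such that $x(0)=\bar x_0$, $0\le r(x(T))$, $0\le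 g(x(t),u(t))$ for a.e. $t$, and the planar complementarity Lagrangian system with friction and inelastic impacts holds: \[ \dot q=v,\quad \dot v=f_{\mathrm v}(q,v,u)+M(q)^{-1}\bigl(n(q)\lambda_{\mathrm n}+b(q)\lambda_{\mathrm t}\bigr),\quad 0\le\lambda_{\mathrm n}\perp f_c(q)\ge 0,\quad \lambda_{\mathrm t}\in\operatorname*{arg\,min}_{|\tilde\lambda|\le\mu\lambda_{\mathrm n}} v^\top b(q)\tilde\lambda . \] There are finitely many impact times, namely the times $t_{\mathrm s}$ at which $(q(t_{\mathrm s}),v(t_{\mathrm s}^-))$ is impacting. Away from them the forces are integrable and the equations hold in the sense of Carathéodory. At them $v$ jumps by $M(q)^{-1}(n(q)\Lambda_{\mathrm n}+b(q)\Lambda_{\mathrm t})$ with impulses such that $\Lambda_{\mathrm n}\ge0$, $n(q)^\top v(t_{\mathrm s}^+)=0$, and $\Lambda_{\mathrm t}$ minimizes $v(t_{\mathrm s}^+)^\top b(q)\tilde\Lambda$ over $|\tilde\Lambda|\le\mu\Lambda_{\mathrm n}$. The value $\bar x_0$ is the state before, and $x(T)$ the state after, a possible impact at time $0$, respectively $T$.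 \textbf{Time-freezing problem.} Fix $a_{\mathrm n}>0$, $\tilde T>0$. With $y=(q,v,t)$ put $c(y)=(f_c(q),\,n(q)^\top v,\,b(q)^\top v)$, \[ f_1=(v,f_{\mathrm v}(q,v,u),1),\qquad f_{2}=\bigl(0,\,a_{\mathrm n}M(q)^{-1}(n(q)-\mu b(q)),\,0\bigr),\qquad f_3=\bigl(0,\,a_{\mathrm n}M(q)^{-1}(n(q)+\mu b(q)),\,0\bigr), \] $F=[f_1,f_2,f_3]$. Minimize $\Psi(x(\tilde T))$ over absolutely continuous $y=(x,t)$, measurable $\theta,\alpha$ and functions $\lambda^{\mathrm p},\lambda^{\mathrm n}$ (all with values in $\mathbb{R}^3$), controls $u$, and integrable speeds of time $s>0$ on $[0,\tilde T]$, subject to $y(0)=(\bar x_0,0)$, $t(\tilde T)=T$, $0\le r(x(\tilde T))$ and, for a.e. $\tau$, $0\le g(x(\tau),u(\tau))$ and \[ y'=s\,F(y,u)\,\theta,\quad \theta=\bigl(\alpha_1+(1-\alpha_1)\alpha_2,\ (1-\alpha_1)(1-\alpha_2)\alpha_3,\ (1-\alpha_1)(1-\alpha_2)(1-\alpha_3)\bigr),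 \] \[ 0=c(y)-\lambda^{\mathrm p}+\lambda^{\mathrm n},\qquad 0\le\alpha\perp\lambda^{\mathrm n}\ge 0,\qquad 0\le e-\alpha\perp\lambda^{\mathrm p}\ge 0 . \] It is part of the problem that $t(\tau)$ takes only finitely many values on $\{\tau: x(\tau)\text{ is impacting}\}$ (finitely many impacts) and that $x(\tilde T)$ is not impacting (a last impact is completed). A \emph{time-freezing trajectory} is a tuple satisfying all of these conditions except possibly those on $g$ and $r$. A CLS trajectory and a time-freezing trajectory \emph{describe the same motion} if the CLS state at physical time $t(\tau)$ equals $x(\tau)$ for every $\tau\in[0,\tilde T]$ for which $t(\tau)$ is not an impact time of the CLS trajectory. For a control $u$ in physical time and a measurable function $\hat u$ on $[0,\tilde T]$ put \[ \tilde u(\tau)=\begin{cases}u(t(\tau)),& t'(\tau)>0,\\ \hat u(\tau),&\text{otherwise,}\end{cases} \] where $\hat u$ is called \emph{admissible} if $g(x(\tau),\hat u(\tau))\ge 0$ for a.e. $\tau$ with $t'(\tau)=0$. Assume that admissible $\hat u$ exist along every time-freezing trajectory that describes the same motion as some feasible solution of the CLS problem. \textbf{Theorem (optimal controls).} \begin{enumerate}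 \item Let $\tilde u^*$ be an optimal control of the time-freezing problem, with optimal trajectory $y^*=(x^*,t^*)$. Then $u^*(t^*(\tau))=\tilde u^*(\tau)$ defines an optimal control of the CLS problem: for each $t\in[0,T]$ there is $\tau$ with $t^*(\tau)=t$, and for every choice $\psi(t)$ of such $\tau$, the control $u^*=\tilde u^*\circ\psi$ is optimal for the CLS problem, with an optimal trajectory that describes the same motion as $y^*$. \item Conversely, let $u^*$ be an optimal control of the CLS problem, with a corresponding optimal trajectory. Then there is a time-freezing trajectory that describes the same motion and whose control is $\tilde u^*$, constructed as above from $u=u^*$, its own clock $t(\cdot)$ and some admissible $\hat u$. For every such trajectory, with any admissible $\hat u$, the control $\tilde u^*$ is optimal for the time-freezing problem, and the trajectory is an optimal one. \end{enumerate} -/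

import Mathlib

open MeasureTheory Set

namespace TimeFreezing

/-- Column vectors with the Euclidean inner product. -/
abbrev Vec (n : ℕ) := EuclideanSpace ℝ (Fin n)

/-- Data of a planar rigid-body system with one unilateral constraint `fc q ≥ 0` and Coulomb
friction along one tangent direction `b q`, with the standing assumptions on these data. The
constraint normal is `∇ fc q`. -/
structure CLS (n m : ℕ) where
  /-- total acceleration except contact forces, `(q, v, u) ↦ f_v(q, v, u)` -/
  fv : Vec n → Vec n → Vec m → Vec n
  /-- inertia matrix -/
  M : Vec n → Matrix (Fin n) (Fin n) ℝ
  /-- signed distance function -/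
  fc : Vec n → ℝ
  /-- tangent direction at contact -/
  b : Vec n → Vec n
  /-- coefficient of friction -/
  μ : ℝ
  fv_smooth : ContDiff ℝ 2 (fun p : Vec n × Vec n × Vec m => fv p.1 p.2.1 p.2.2)
  M_smooth : ∀ i j, ContDiff ℝ 2 (fun q => M q i j)
  M_posDef : ∀ q, (M q).PosDef
  fc_smooth : ContDiff ℝ 2 fc
  b_smooth : ContDiff ℝ 2 b
  μ_pos : 0 < μ
  /-- the normal does not vanish at contact; as `M` is positive definite, this says `D(q) > 0` -/
  normal_ne_zero : ∀ q, fc q = 0 → gradient fc q ≠ 0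
  /-- tangent and normal are orthogonal in the kinetic metric at contact -/
  orthogonal : ∀ q, fc q = 0 →
    inner ℝ (b q) (Matrix.toEuclideanLin (M q)⁻¹ (gradient fc q)) = 0

namespace CLS

variable {n m : ℕ} (S : CLS n m)

/-- The constraint normal `n(q) = ∇ fc(q)`. -/
noncomputable def normal (q : Vec n) : Vec n := gradient S.fc q

/-- `M(q)⁻¹ w`. -/
noncomputable def Minv (q w : Vec n) : Vec n := Matrix.toEuclideanLin (S.M q)⁻¹ w

/-- Normal velocity `n(q)ᵀ v`. -/
noncomputable def normalVel (q v : Vec n) : ℝ := inner ℝ (S.normal q) v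

/-- Tangential velocity `b(q)ᵀ v`. -/
noncomputable def tangentVel (q v : Vec n) : ℝ := inner ℝ (S.b q) v

/-- Generalized acceleration `M(q)⁻¹ (n(q) lN + b(q) lT)` due to a contact force (or velocity jump
due to a contact impulse) with normal part `lN` and tangential part `lT`. -/
noncomputable def contact (q : Vec n) (lN lT : ℝ) : Vec n :=
  S.Minv q (lN • S.normal q + lT • S.b q)

/-- Maximum dissipation principle: among all `l` with `|l| ≤ μ lN`, the friction force (impulse)
`lT` minimizes the power `(b(q)ᵀ v) l`. -/
def MaxDissipation (q v : Vec n) (lN lT : ℝ) : Prop :=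
  |lT| ≤ S.μ * lN ∧ ∀ l : ℝ, |l| ≤ S.μ * lN → S.tangentVel q v * lT ≤ S.tangentVel q v * l

/-- States at which an impact takes place: contact with approaching normal velocity. -/
def Impacting (q v : Vec n) : Prop := S.fc q = 0 ∧ S.normalVel q v < 0

end CLS

/-- Data of the optimal control problem: system, horizon, initial state, terminal cost, path
constraint `0 ≤ g(x, u)` and terminal constraint `0 ≤ r(x)`, where `x = (q, v)`. -/
structure OCP (n m ng nr : ℕ) where
  sys : CLS n m
  T : ℝ
  T_pos : 0 < T
  q₀ : Vec n
  v₀ : Vec n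
  initial_admissible : 0 ≤ sys.fc q₀
  Ψ : Vec n × Vec n → ℝ
  g : Vec n × Vec n → Vec m → Fin ng → ℝ
  r : Vec n × Vec n → Fin nr → ℝ

/-! ### The problem with the complementarity Lagrangian system -/

/-- Decision variables of the problem with the complementarity system. The contact forces consist
of densities `lamN`, `lamT` and of impulses `impN t`, `impT t` at the finitely many impact times.
The velocity `v` is the right-continuous (post-impact) one. -/
structure CLSProcess (n m : ℕ) where
  q : ℝ → Vec n
  v : ℝ → Vec n
  lamN : ℝ → ℝ
  lamT : ℝ → ℝ
  impacts : Finset ℝ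
  impN : ℝ → ℝ
  impT : ℝ → ℝ
  u : ℝ → Vec m

namespace OCP

variable {n m ng nr : ℕ} (O : OCP n m ng nr)

/-- Velocity jump `v(t⁺) - v(t⁻)`. -/
noncomputable def jump (P : CLSProcess n m) (t : ℝ) : Vec n :=
  if t ∈ P.impacts then O.sys.contact (P.q t) (P.impN t) (P.impT t) else 0

/-- Pre-impact velocity `v(t⁻)`. -/
noncomputable def preVel (P : CLSProcess n m) (t : ℝ) : Vec n := P.v t - O.jump P t

/-- Right-hand side of the velocity equation between impacts. -/
noncomputable def accel (P : CLSProcess n m) (t : ℝ) : Vec n :=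
  O.sys.fv (P.q t) (P.v t) (P.u t) + O.sys.contact (P.q t) (P.lamN t) (P.lamT t)

/-- The complementarity Lagrangian system with friction and inelastic impacts on `[0, T]`, started
at `(q₀, v₀)`; the differential equations are in integrated form, with the velocity jumps. An
initial state that is impacting is the pre-impact state of an impact at time `0`. -/
structure IsCLSSolution (P : CLSProcess n m) : Prop where
  u_meas : AEMeasurable P.u (volume.restrict (Icc 0 O.T))
  lamN_int : IntegrableOn P.lamN (Icc 0 O.T)
  lamT_int : IntegrableOn P.lamT (Icc 0 O.T)
  accel_int : IntegrableOn (O.accel P) (Icc 0 O.T)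
  q_eq : ∀ t ∈ Icc 0 O.T, P.q t = O.q₀ + ∫ w in (0 : ℝ)..t, P.v w
  v_eq : ∀ t ∈ Icc 0 O.T, P.v t = O.v₀ + (∫ w in (0 : ℝ)..t, O.accel P w)
    + ∑ w ∈ P.impacts with w ≤ t, O.jump P w
  gap_nonneg : ∀ t ∈ Icc 0 O.T, 0 ≤ O.sys.fc (P.q t)
  complementarity : ∀ᵐ t ∂(volume.restrict (Icc 0 O.T)),
    0 ≤ P.lamN t ∧ P.lamN t * O.sys.fc (P.q t) = 0
  friction : ∀ᵐ t ∂(volume.restrict (Icc 0 O.T)),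
    O.sys.MaxDissipation (P.q t) (P.v t) (P.lamN t) (P.lamT t)
  /-- impacts take place exactly at contact with approaching pre-impact velocity -/
  impact_iff : ∀ t, t ∈ P.impacts ↔ t ∈ Icc 0 O.T ∧ O.sys.Impacting (P.q t) (O.preVel P t)
  /-- inelastic state jump law -/
  impact_law : ∀ t ∈ P.impacts, O.sys.normalVel (P.q t) (P.v t) = 0
  impN_nonneg : ∀ t ∈ P.impacts, 0 ≤ P.impN t
  /-- maximum dissipation for the impulses, with the post-impact velocity -/
  impact_friction : ∀ t ∈ P.impacts,
    O.sys.MaxDissipation (P.q t) (P.v t) (P.impN t) (P.impT t)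

/-- Feasibility: dynamics, path constraint (at almost all times) and terminal constraint. -/
structure IsCLSFeasible (P : CLSProcess n m) : Prop where
  solution : O.IsCLSSolution P
  path : ∀ᵐ t ∂(volume.restrict (Icc 0 O.T)), 0 ≤ O.g (P.q t, P.v t) (P.u t)
  terminal : 0 ≤ O.r (P.q O.T, P.v O.T)

/-- Global minimizers; their controls `P.u` are the optimal controls. -/
def IsCLSOptimal (P : CLSProcess n m) : Prop :=
  O.IsCLSFeasible P ∧
    ∀ P' : CLSProcess n m, O.IsCLSFeasible P' →
      O.Ψ (P.q O.T, P.v O.T) ≤ O.Ψ (P'.q O.T, P'.v O.T)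

end OCP

/-! ### The problem with the time-freezing system -/

/-- Extended states `y = (q, v, t)`, with the clock state `t`. -/
abbrev ExtState (n : ℕ) := Vec n × Vec n × ℝ

namespace CLS

variable {n m : ℕ} (S : CLS n m)

/-- Switching functions `c(y)`; the index `0, 1, 2` stands for `c₁, c₂, c₃`. -/
noncomputable def switching (y : ExtState n) : Fin 3 → ℝ :=
  ![S.fc y.1, S.normalVel y.1 y.2.1, S.tangentVel y.1 y.2.1]

/-- Unconstrained dynamics with running clock. -/
def freeMode (y : ExtState n) (u : Vec m) : ExtState n := (y.2.1, S.fv y.1 y.2.1 u, 1)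

/-- Normal auxiliary dynamics. -/
noncomputable def auxN (aN : ℝ) (y : ExtState n) : ExtState n :=
  (0, aN • S.Minv y.1 (S.normal y.1), 0)

/-- Tangential auxiliary dynamics for negative tangential velocity, with `a_t = μ a_n`; those for
positive tangential velocity are the negative of this. -/
noncomputable def auxTMinus (aN : ℝ) (y : ExtState n) : ExtState n :=
  (0, (S.μ * aN) • S.Minv y.1 (S.b y.1), 0)

/-- The modes `f₁, f₂, f₃` (indices `0, 1, 2`) of the time-freezing system, for the regions
`R₁ = {c₁ > 0} ∪ {c₁ < 0, c₂ > 0}`, `R₂ = {c₁ < 0, c₂ < 0, c₃ > 0}` and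
`R₃ = {c₁ < 0, c₂ < 0, c₃ < 0}`. -/
noncomputable def modes (aN : ℝ) (y : ExtState n) (u : Vec m) : Fin 3 → ExtState n :=
  ![S.freeMode y u, S.auxN aN y + -S.auxTMinus aN y, S.auxN aN y + S.auxTMinus aN y]

end CLS

/-- Residual of the relation between the Filippov multipliers `θ` and the step functions `α`. -/
def gF (θ α : Fin 3 → ℝ) : Fin 3 → ℝ :=
  ![θ 0 - (α 0 + (1 - α 0) * α 1),
    θ 1 - (1 - α 0) * (1 - α 1) * α 2,
    θ 2 - (1 - α 0) * (1 - α 1) * (1 - α 2)]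

/-- `0 ≤ a ⟂ b ≥ 0`. -/
def Compl (a b : Fin 3 → ℝ) : Prop := 0 ≤ a ∧ 0 ≤ b ∧ a ⬝ᵥ b = 0

/-- Decision variables of the time-freezing problem, functions of the numerical time: extended
state, algebraic variables `z = (θ, α, λᵖ, λⁿ)`, control, and speed of time. -/
structure TFProcess (n m : ℕ) where
  y : ℝ → ExtState n
  θ : ℝ → Fin 3 → ℝ
  α : ℝ → Fin 3 → ℝ
  lamP : ℝ → Fin 3 → ℝ
  lamM : ℝ → Fin 3 → ℝ
  u : ℝ → Vec m
  s : ℝ → ℝ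

namespace TFProcess

variable {n m : ℕ} (Y : TFProcess n m)

/-- Position in numerical time. -/
def q (τ : ℝ) : Vec n := (Y.y τ).1

/-- Velocity in numerical time. -/
def v (τ : ℝ) : Vec n := (Y.y τ).2.1

/-- Clock state `t(τ)`. -/
def clock (τ : ℝ) : ℝ := (Y.y τ).2.2

end TFProcess

/-- `P` and `Y` describe the same motion: `x(t(τ))` is the `x`-part of `y(τ)` whenever `t(τ)` is
not an impact time. -/
def SameMotion {n m : ℕ} (Tt : ℝ) (P : CLSProcess n m) (Y : TFProcess n m) : Prop :=
  ∀ τ ∈ Icc 0 Tt, Y.clock τ ∉ P.impacts →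
    P.q (Y.clock τ) = Y.q τ ∧ P.v (Y.clock τ) = Y.v τ

namespace OCP

variable {n m ng nr : ℕ} (O : OCP n m ng nr)

/-- Right-hand side `s F(y, u) θ`. -/
noncomputable def tfRhs (aN : ℝ) (Y : TFProcess n m) (τ : ℝ) : ExtState n :=
  Y.s τ • ∑ i, Y.θ τ i • O.sys.modes aN (Y.y τ) (Y.u τ) i

/-- The time-freezing system on `[0, T̃]` as a dynamic complementarity system with speed of time
`s > 0`, with its initial condition and with terminal clock value `T`; the differential equation
is in integrated form. The last two fields are the standing assumptions on trajectories: there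
are finitely many impacts, and a possible last impact is completed at the final time. -/
structure IsTFTrajectory (aN Tt : ℝ) (Y : TFProcess n m) : Prop where
  u_meas : AEMeasurable Y.u (volume.restrict (Icc 0 Tt))
  θ_meas : AEMeasurable Y.θ (volume.restrict (Icc 0 Tt))
  α_meas : AEMeasurable Y.α (volume.restrict (Icc 0 Tt))
  s_int : IntegrableOn Y.s (Icc 0 Tt)
  s_pos : ∀ τ ∈ Icc 0 Tt, 0 < Y.s τ
  rhs_int : IntegrableOn (O.tfRhs aN Y) (Icc 0 Tt)
  y_eq : ∀ τ ∈ Icc 0 Tt, Y.y τ = (O.q₀, O.v₀, 0) + ∫ w in (0 : ℝ)..τ, O.tfRhs aN Y w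
  multipliers : ∀ᵐ τ ∂(volume.restrict (Icc 0 Tt)), gF (Y.θ τ) (Y.α τ) = 0
  switching_eq : ∀ᵐ τ ∂(volume.restrict (Icc 0 Tt)),
    O.sys.switching (Y.y τ) - Y.lamP τ + Y.lamM τ = 0
  compl_lower : ∀ᵐ τ ∂(volume.restrict (Icc 0 Tt)), Compl (Y.α τ) (Y.lamM τ)
  compl_upper : ∀ᵐ τ ∂(volume.restrict (Icc 0 Tt)), Compl (1 - Y.α τ) (Y.lamP τ)
  clock_end : Y.clock Tt = O.T
  finite_impacts : (Y.clock '' {τ ∈ Icc 0 Tt | O.sys.Impacting (Y.q τ) (Y.v τ)}).Finite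
  impact_completed : ¬ O.sys.Impacting (Y.q Tt) (Y.v Tt)

/-- Feasibility: dynamics, path constraint (at almost all numerical times, also when the time is
frozen) and terminal constraint. -/
structure IsTFFeasible (aN Tt : ℝ) (Y : TFProcess n m) : Prop where
  trajectory : O.IsTFTrajectory aN Tt Y
  path : ∀ᵐ τ ∂(volume.restrict (Icc 0 Tt)), 0 ≤ O.g (Y.q τ, Y.v τ) (Y.u τ)
  terminal : 0 ≤ O.r (Y.q Tt, Y.v Tt)

/-- Global minimizers; their controls `Y.u` are the optimal controls. -/
def IsTFOptimal (aN Tt : ℝ) (Y : TFProcess n m) : Prop :=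
  O.IsTFFeasible aN Tt Y ∧
    ∀ Y' : TFProcess n m, O.IsTFFeasible aN Tt Y' →
      O.Ψ (Y.q Tt, Y.v Tt) ≤ O.Ψ (Y'.q Tt, Y'.v Tt)

/-- `ψ` selects for every physical time `t ∈ [0, T]` a numerical time with clock value `t`. -/
def IsNumericalTime (Tt : ℝ) (Y : TFProcess n m) (ψ : ℝ → ℝ) : Prop :=
  ∀ t ∈ Icc 0 O.T, ψ t ∈ Icc 0 Tt ∧ Y.clock (ψ t) = t

/-- `û` satisfies the path constraint along `Y` whenever the time is frozen. -/
def IsFrozenControl (Tt : ℝ) (Y : TFProcess n m) (uhat : ℝ → Vec m) : Prop :=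
  AEMeasurable uhat (volume.restrict (Icc 0 Tt)) ∧
    ∀ᵐ τ ∂(volume.restrict (Icc 0 Tt)),
      deriv Y.clock τ = 0 → 0 ≤ O.g (Y.q τ, Y.v τ) (uhat τ)

end OCP

open Classical in
/-- The control in numerical time built from `u`: `u(t(τ))` if `t'(τ) > 0`, and `û(τ)` when the
time is frozen. -/
noncomputable def extendControl {m : ℕ} (u : ℝ → Vec m) (clock : ℝ → ℝ) (uhat : ℝ → Vec m)
    (τ : ℝ) : Vec m :=
  if 0 < deriv clock τ then u (clock τ) else uhat τ

end TimeFreezing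

/-! Optimality passes between the two problems because each feasible point of one yields a feasible
point of the other with the same terminal state, and both objectives see only that state. The work
lies in the two translations of trajectories and in the comparison of terminal states.

From time-freezing to physical time: the clock runs with speed `s * θ 0`. The gap never becomes
negative (`gap_nonneg`), and up to a null set the clock rests exactly at impacting states. At
contact the gap has derivative zero almost everywhere, so the clock cannot run while the normal
velocity is negative (`ae_frozen`). Conversely, a resting clock at a state that is not impacting
would force gap and normal velocity to vanish while the auxiliary dynamics increase the normal
velocity strictly; this is possible only on a null set (`ae_running`). Hence a level set of the
clock is a point or an interval. On an interval `q` is constant and `v` receives an impulse that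
obeys the inelastic impact law and maximum dissipation (`frozen_v`, `fiber_impact`,
`frozen_maxDissipation`). Off these intervals, division by the clock speed turns the multipliers
into the forces `aN * (1 - θ 0) / θ 0` and `μ * aN * (θ 2 - θ 1) / θ 0`. Equations and
almost-everywhere statements move along the clock because it pushes the measure with density `s * θ
0` forward to Lebesgue measure (`IsClock.map_eq`).

From physical time to time-freezing: the clock is made to run at constant speed `κ` and to rest for
a period `ℓ` at each impact, with `κ` and `ℓ` fitted to the given numerical horizon. While it runs,
step functions and speed of time are chosen so that the multipliers reproduce the contact forces
(`contactStep`). During a rest the normal impulse is delivered at a constant rate; the tangential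
impulse comes first, at the full friction rate, followed by sticking (`isStep_resting`).

A trajectory in the second part of the theorem need not be the constructed one, and sharing the
motion says nothing at impact times, among which may be the final time. The terminal states agree
nevertheless: left limits determine the pre-impact state, and the impact law has a unique outcome
(`contact_unique`, `terminal_eq`). -/

namespace TimeFreezing

open Filter Topology
open scoped NNReal ENNReal

/-! ### Absolutely continuous functions given as integrals -/

section Analysis

variable {E : Type*} [NormedAddCommGroup E] [NormedSpace ℝ E]

/-- The zeros that are isolated from the right in the zero set are countable, hence negligible; at
any other zero, further zeros accumulate and rule out a nonzero derivative. Applied to the gap and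
to the normal velocity, this replaces an analysis of contact phases. -/
theorem ae_hasDerivAt_eq_zero_of_eq_zero {f f' : ℝ → ℝ} {s : Set ℝ}
    (h : ∀ᵐ τ ∂(volume.restrict s), HasDerivAt f (f' τ) τ) :
    ∀ᵐ τ ∂(volume.restrict s), f τ = 0 → f' τ = 0 := by
  have hc : {x ∈ {x | f x = 0} | 𝓝[{x | f x = 0} ∩ Ioi x] x = ⊥}.Countable :=
    countable_setOfPred_isolated_right_within
  have h0 : ∀ᵐ τ ∂(volume.restrict s), τ ∉ {x ∈ {x | f x = 0} | 𝓝[{x | f x = 0} ∩ Ioi x] x = ⊥} :=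
    ae_restrict_of_ae (hc.ae_notMem _)
  filter_upwards [h, h0] with τ h1 h2 h3
  by_contra h4
  refine h2 ⟨h3, ?_⟩
  have h5 := h1.eventually_ne (c := 0) h4
  rw [← empty_mem_iff_bot]
  have h6 : ∀ᶠ z in 𝓝[{x | f x = 0} ∩ Ioi τ] τ, f z ≠ 0 :=
    h5.filter_mono (nhdsWithin_mono _ (fun z hz => (ne_of_gt hz.2 : z ≠ τ)))
  filter_upwards [h6, self_mem_nhdsWithin] with z hz hz'
  exact (hz hz'.1).elim

omit [NormedSpace ℝ E] in
theorem intervalIntegrable_of_integrableOn_Icc {f : ℝ → E} {L a b : ℝ}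
    (hf : IntegrableOn f (Icc 0 L)) (ha : a ∈ Icc 0 L) (hb : b ∈ Icc 0 L) :
    IntervalIntegrable f volume a b := by
  rw [intervalIntegrable_iff]
  refine hf.mono_set fun x hx => ?_
  rw [uIoc, mem_Ioc] at hx
  exact ⟨(le_min ha.1 hb.1).trans hx.1.le, hx.2.trans (max_le ha.2 hb.2)⟩

theorem eq_add_integral_of_mem_Icc {Y f : ℝ → E} {y₀ : E} {L : ℝ}
    (hf : IntegrableOn f (Icc 0 L)) (hY : ∀ τ ∈ Icc 0 L, Y τ = y₀ + ∫ w in (0 : ℝ)..τ, f w)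
    {a b : ℝ} (ha : a ∈ Icc 0 L) (hb : b ∈ Icc 0 L) : Y b = Y a + ∫ w in a..b, f w := by
  have h0 : (0 : ℝ) ∈ Icc 0 L := ⟨le_rfl, ha.1.trans ha.2⟩
  rw [hY a ha, hY b hb, add_assoc, intervalIntegral.integral_add_adjacent_intervals
    (intervalIntegrable_of_integrableOn_Icc hf h0 ha)
    (intervalIntegrable_of_integrableOn_Icc hf ha hb)]

theorem continuousOn_of_eq_integral {Y f : ℝ → E} {y₀ : E} {L : ℝ}
    (hf : IntegrableOn f (Icc 0 L)) (hY : ∀ τ ∈ Icc 0 L, Y τ = y₀ + ∫ w in (0 : ℝ)..τ, f w) :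
    ContinuousOn Y (Icc 0 L) := by
  rcases le_or_gt 0 L with hL | hL
  · refine ContinuousOn.congr ?_ hY
    refine continuousOn_const.add ?_
    have := intervalIntegral.continuousOn_primitive_interval (a := (0 : ℝ)) (b := L) (f := f)
      (μ := volume) (by rwa [uIcc_of_le hL])
    rwa [uIcc_of_le hL] at this
  · rw [Icc_eq_empty (not_le.2 hL)]
    exact continuousOn_empty _

theorem ae_mem_Ioo_restrict_Icc (a b : ℝ) :
    ∀ᵐ τ ∂(volume.restrict (Icc a b)), τ ∈ Ioo a b := by
  rw [restrict_Ioo_eq_restrict_Icc.symm]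
  exact ae_restrict_mem measurableSet_Ioo

theorem ae_hasDerivAt_of_eq_integral [CompleteSpace E] {Y f : ℝ → E} {y₀ : E} {L : ℝ}
    (hf : IntegrableOn f (Icc 0 L)) (hY : ∀ τ ∈ Icc 0 L, Y τ = y₀ + ∫ w in (0 : ℝ)..τ, f w) :
    ∀ᵐ τ ∂(volume.restrict (Icc 0 L)), HasDerivAt Y (f τ) τ := by
  rcases le_or_gt 0 L with hL | hL
  swap
  · rw [Icc_eq_empty (not_le.2 hL)]; simp
  have h0 : (0 : ℝ) ∈ Icc 0 L := ⟨le_rfl, hL⟩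
  have h1 := (intervalIntegrable_of_integrableOn_Icc hf h0 ⟨hL, le_rfl⟩).ae_hasDerivAt_integral
  rw [uIcc_of_le hL] at h1
  filter_upwards [ae_restrict_of_ae h1, ae_mem_Ioo_restrict_Icc 0 L] with τ h2 h3
  have h4 := (h2 (Ioo_subset_Icc_self h3) 0 h0).const_add y₀
  refine h4.congr_of_eventuallyEq ?_
  filter_upwards [Ioo_mem_nhds h3.1 h3.2] with z hz
  exact hY z (Ioo_subset_Icc_self hz)

theorem AbsolutelyContinuousOnInterval.of_dist_le {X : Type*} [PseudoMetricSpace X] {f : ℝ → X}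
    {g : ℝ → ℝ} {a b K : ℝ} (hg : AbsolutelyContinuousOnInterval g a b)
    (h : ∀ x ∈ uIcc a b, ∀ y ∈ uIcc a b, dist (f x) (f y) ≤ K * dist (g x) (g y)) :
    AbsolutelyContinuousOnInterval f a b := by
  have h1 := Tendsto.const_mul K hg
  rw [mul_zero] at h1
  refine squeeze_zero' (Eventually.of_forall fun E => Finset.sum_nonneg fun _ _ => dist_nonneg)
    ?_ h1
  have h2 : AbsolutelyContinuousOnInterval.disjWithin a b ∈
      (AbsolutelyContinuousOnInterval.totalLengthFilter (X := ℝ) ⊓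
        𝓟 (AbsolutelyContinuousOnInterval.disjWithin a b)) :=
    mem_inf_of_right (mem_principal_self _)
  filter_upwards [h2] with E hE
  rw [Finset.mul_sum]
  exact Finset.sum_le_sum fun i hi => h _ (hE.1 i hi).1 _ (hE.1 i hi).2

/-- The trajectory stays in a ball, on which `φ` is Lipschitz; so the increments of `φ ∘ Y` are
controlled by those of the primitive of `‖f‖`. -/
theorem absolutelyContinuousOnInterval_comp_of_eq_integral [FiniteDimensional ℝ E]
    {Y f : ℝ → E} {y₀ : E} {L : ℝ} (hf : IntegrableOn f (Icc 0 L))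
    (hY : ∀ τ ∈ Icc 0 L, Y τ = y₀ + ∫ w in (0 : ℝ)..τ, f w) {φ : E → ℝ} (hφ : ContDiff ℝ 1 φ)
    {a b : ℝ} (ha : a ∈ Icc 0 L) (hb : b ∈ Icc 0 L) :
    AbsolutelyContinuousOnInterval (fun τ => φ (Y τ)) a b := by
  have hsub : uIcc a b ⊆ Icc 0 L := uIcc_subset_Icc ha hb
  have hcont := continuousOn_of_eq_integral hf hY
  have hcomp : IsCompact (Y '' Icc 0 L) := isCompact_Icc.image_of_continuousOn hcont
  obtain ⟨R, hR⟩ := hcomp.isBounded.subset_closedBall 0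
  have : ProperSpace E := FiniteDimensional.proper ℝ E
  obtain ⟨K, hK⟩ := (hφ.contDiffOn (s := Metric.closedBall (0 : E) R)).exists_lipschitzOnWith
    one_ne_zero (convex_closedBall _ _) (isCompact_closedBall _ _)
  have hn : IntervalIntegrable (fun τ => ‖f τ‖) volume a b :=
    intervalIntegrable_of_integrableOn_Icc hf.norm ha hb
  refine AbsolutelyContinuousOnInterval.of_dist_le (K := K)
    (hn.absolutelyContinuousOnInterval_intervalIntegral left_mem_uIcc) ?_
  intro x hx y hy
  refine (hK.dist_le_mul _ (hR ⟨x, hsub hx, rfl⟩) _ (hR ⟨y, hsub hy, rfl⟩)).trans ?_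
  gcongr
  rw [eq_add_integral_of_mem_Icc hf hY (hsub hy) (hsub hx), dist_eq_norm, dist_eq_norm,
    add_sub_cancel_left, intervalIntegral.integral_interval_sub_left
      (intervalIntegrable_of_integrableOn_Icc hf.norm ha (hsub hx))
      (intervalIntegrable_of_integrableOn_Icc hf.norm ha (hsub hy))]
  exact intervalIntegral.norm_integral_le_abs_integral_norm

theorem le_of_ae_hasDerivAt_nonneg {f f' : ℝ → ℝ} {a b : ℝ} (hab : a ≤ b)
    (hf : AbsolutelyContinuousOnInterval f a b)
    (h : ∀ᵐ τ ∂(volume.restrict (Icc a b)), HasDerivAt f (f' τ) τ ∧ 0 ≤ f' τ) : f a ≤ f b := by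
  have h1 := hf.integral_deriv_eq_sub
  have h2 : 0 ≤ ∫ x in a..b, deriv f x :=
    intervalIntegral.integral_nonneg_of_ae_restrict hab (by
      filter_upwards [h] with τ hτ
      rw [hτ.1.deriv]; exact hτ.2)
  linarith

end Analysis

/-! ### Clocks with nonnegative speed and change of variables -/

section Clock

variable {E : Type*} [NormedAddCommGroup E] [NormedSpace ℝ E]

/-- Lebesgue measure on `[0, L]` with density `ρ`. -/
noncomputable def speedMeasure (ρ : ℝ → ℝ) (L : ℝ) : Measure ℝ :=
  (volume.restrict (Icc 0 L)).withDensity fun τ => ((ρ τ).toNNReal : ℝ≥0∞)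

/-- A clock on `[0, L]`, started at `0`, with integrable speed `ρ ≥ 0`. -/
structure IsClock (ρ c : ℝ → ℝ) (L : ℝ) : Prop where
  length_nonneg : 0 ≤ L
  integrable : IntegrableOn ρ (Icc 0 L)
  nonneg : ∀ᵐ τ ∂(volume.restrict (Icc 0 L)), 0 ≤ ρ τ
  eq_integral : ∀ τ ∈ Icc 0 L, c τ = ∫ w in (0 : ℝ)..τ, ρ w

namespace IsClock

variable {ρ c : ℝ → ℝ} {L : ℝ} (h : IsClock ρ c L)
include h

theorem eq_integral' : ∀ τ ∈ Icc 0 L, c τ = 0 + ∫ w in (0 : ℝ)..τ, ρ w := by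
  simpa using h.eq_integral

theorem sub_eq {a b : ℝ} (ha : a ∈ Icc 0 L) (hb : b ∈ Icc 0 L) : c b = c a + ∫ w in a..b, ρ w :=
  eq_add_integral_of_mem_Icc h.integrable h.eq_integral' ha hb

theorem zero_mem : (0 : ℝ) ∈ Icc 0 L := ⟨le_rfl, h.length_nonneg⟩

theorem length_mem : L ∈ Icc 0 L := ⟨h.length_nonneg, le_rfl⟩

theorem zero : c 0 = 0 := by rw [h.eq_integral 0 h.zero_mem, intervalIntegral.integral_same]

theorem continuousOn : ContinuousOn c (Icc 0 L) :=
  continuousOn_of_eq_integral h.integrable h.eq_integral'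

theorem monotoneOn : MonotoneOn c (Icc 0 L) := by
  intro a ha b hb hab
  rw [h.sub_eq ha hb]
  have : 0 ≤ ∫ w in a..b, ρ w := intervalIntegral.integral_nonneg_of_ae_restrict hab
    (ae_restrict_of_ae_restrict_of_subset (Icc_subset_Icc ha.1 hb.2) h.nonneg)
  linarith

theorem mapsTo : MapsTo c (Icc 0 L) (Icc 0 (c L)) := fun _ hτ =>
  ⟨h.zero ▸ h.monotoneOn h.zero_mem hτ hτ.1, h.monotoneOn hτ h.length_mem hτ.2⟩

theorem restrict {τ : ℝ} (hτ : τ ∈ Icc 0 L) : IsClock ρ c τ where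
  length_nonneg := hτ.1
  integrable := h.integrable.mono_set (Icc_subset_Icc_right hτ.2)
  nonneg := ae_restrict_of_ae_restrict_of_subset (Icc_subset_Icc_right hτ.2) h.nonneg
  eq_integral := fun σ hσ => h.eq_integral σ ⟨hσ.1, hσ.2.trans hτ.2⟩

theorem surjOn : SurjOn c (Icc 0 L) (Icc 0 (c L)) := by
  have := intermediate_value_Icc h.length_nonneg h.continuousOn
  rwa [h.zero] at this

theorem aemeasurable_toNNReal :
    AEMeasurable (fun τ => (ρ τ).toNNReal) (volume.restrict (Icc 0 L)) :=
  h.integrable.aestronglyMeasurable.aemeasurable.real_toNNReal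

theorem ae_speedMeasure_iff {p : ℝ → Prop} :
    (∀ᵐ τ ∂(speedMeasure ρ L), p τ) ↔ ∀ᵐ τ ∂(volume.restrict (Icc 0 L)), 0 < ρ τ → p τ := by
  rw [speedMeasure, ae_withDensity_iff' h.aemeasurable_toNNReal.coe_nnreal_ennreal]
  simp

theorem aemeasurable : AEMeasurable c (volume.restrict (Icc 0 L)) :=
  h.continuousOn.aemeasurable measurableSet_Icc

omit h in
theorem speedMeasure_absolutelyContinuous :
    speedMeasure ρ L ≪ volume.restrict (Icc 0 L) := withDensity_absolutelyContinuous _ _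

/-- It suffices to compare half-lines. By monotonicity the preimage of `Iic t` in `[0, L]` is empty
or an interval `[0, τ₀]`, and its mass is the integral of the speed up to `τ₀`, that is `c τ₀`. -/
theorem map_eq : (speedMeasure ρ L).map c = volume.restrict (Icc 0 (c L)) := by
  have hfin : ∀ τ ∈ Icc 0 L, speedMeasure ρ L (Icc 0 τ) = ENNReal.ofReal (c τ) := by
    intro τ hτ
    have hsub : Icc 0 τ ⊆ Icc 0 L := Icc_subset_Icc_right hτ.2
    rw [speedMeasure, withDensity_apply _ measurableSet_Icc,
      Measure.restrict_restrict measurableSet_Icc, inter_eq_left.2 hsub]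
    change ∫⁻ a in Icc 0 τ, ENNReal.ofReal (ρ a) = _
    rw [← ofReal_integral_eq_lintegral_ofReal (h.integrable.mono_set hsub)
      (ae_restrict_of_ae_restrict_of_subset hsub h.nonneg), h.eq_integral τ hτ,
      intervalIntegral.integral_of_le hτ.1, integral_Icc_eq_integral_Ioc]
  have hfm : IsFiniteMeasure (speedMeasure ρ L) := by
    constructor
    have h1 : speedMeasure ρ L univ = speedMeasure ρ L (Icc 0 L) := by
      have : speedMeasure ρ L (Icc 0 L)ᶜ = 0 :=
        speedMeasure_absolutelyContinuous (by simp [Measure.restrict_apply])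
      exact (measure_univ_le_add_compl (Icc 0 L)).trans (by rw [this, add_zero]) |>.antisymm
        (measure_mono (subset_univ _))
    rw [h1, hfin L h.length_mem]
    exact ENNReal.ofReal_lt_top
  have hcm : AEMeasurable c (speedMeasure ρ L) :=
    h.aemeasurable.mono_ac speedMeasure_absolutelyContinuous
  refine Measure.ext_of_Iic _ _ fun t => ?_
  rw [Measure.map_apply_of_aemeasurable hcm measurableSet_Iic,
    Measure.restrict_apply measurableSet_Iic]
  have hsupp : ∀ s : Set ℝ, speedMeasure ρ L s = speedMeasure ρ L (s ∩ Icc 0 L) := fun s => by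
    refine measure_congr ?_
    have : ∀ᵐ τ ∂(speedMeasure ρ L), τ ∈ Icc 0 L :=
      speedMeasure_absolutelyContinuous.ae_le (ae_restrict_mem measurableSet_Icc)
    filter_upwards [this] with τ hτ
    exact propext ⟨fun hs => ⟨hs, hτ⟩, fun hs => hs.1⟩
  rw [hsupp]
  rcases lt_or_ge t 0 with ht | ht
  · have h1 : c ⁻¹' Iic t ∩ Icc 0 L = ∅ := by
      ext τ
      simp only [mem_inter_iff, mem_preimage, mem_Iic, mem_empty_iff_false, iff_false, not_and]
      intro h1 h2
      exact absurd ((h.mapsTo h2).1.trans h1) (not_le.2 ht)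
    have h2 : Iic t ∩ Icc 0 (c L) = ∅ := by
      ext τ
      simp only [mem_inter_iff, mem_Iic, mem_empty_iff_false, iff_false, not_and]
      intro h1 h2
      exact absurd (h2.1.trans h1) (not_le.2 ht)
    rw [h1, h2, measure_empty, measure_empty]
  · have hcl : IsClosed (Icc 0 L ∩ c ⁻¹' Iic t) :=
      h.continuousOn.preimage_isClosed_of_isClosed isClosed_Icc isClosed_Iic
    have hK : IsCompact (Icc 0 L ∩ c ⁻¹' Iic t) :=
      isCompact_Icc.of_isClosed_subset hcl inter_subset_left
    obtain ⟨τ₀, hτ₀, hmax⟩ := hK.exists_isGreatest ⟨0, h.zero_mem, by simpa [h.zero] using ht⟩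
    have hcL : 0 ≤ c L := (h.mapsTo h.length_mem).1
    obtain ⟨τ₁, hτ₁, hcτ₁⟩ := h.surjOn (show min t (c L) ∈ Icc 0 (c L) from
      ⟨le_min ht hcL, min_le_right _ _⟩)
    have h1 : c τ₀ = min t (c L) := by
      refine le_antisymm (le_min hτ₀.2 (h.mapsTo hτ₀.1).2) ?_
      rw [← hcτ₁]
      refine h.monotoneOn hτ₁ hτ₀.1 (hmax ⟨hτ₁, ?_⟩)
      rw [mem_preimage, hcτ₁, mem_Iic]; exact min_le_left _ _
    have h2 : c ⁻¹' Iic t ∩ Icc 0 L = Icc 0 τ₀ := by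
      rw [inter_comm]
      refine subset_antisymm (fun σ hσ => ⟨hσ.1.1, hmax hσ⟩) fun σ hσ => ?_
      have hσL : σ ∈ Icc 0 L := ⟨hσ.1, hσ.2.trans hτ₀.1.2⟩
      exact ⟨hσL, (h.monotoneOn hσL hτ₀.1 hσ.2).trans hτ₀.2⟩
    have h3 : Iic t ∩ Icc 0 (c L) = Icc 0 (min t (c L)) := by
      ext σ; simp only [mem_inter_iff, mem_Iic, mem_Icc, le_min_iff]; tauto
    rw [h2, h3, hfin τ₀ hτ₀.1, h1, Real.volume_Icc, sub_zero]

/-- The restriction to `0 < ρ τ` cannot be dropped: while the clock rests, a whole interval is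
mapped to a single physical time, which may be exceptional. -/
theorem ae_comp {p : ℝ → Prop} (hp : ∀ᵐ t ∂(volume.restrict (Icc 0 (c L))), p t) :
    ∀ᵐ τ ∂(volume.restrict (Icc 0 L)), 0 < ρ τ → p (c τ) := by
  rw [← h.ae_speedMeasure_iff]
  rw [← h.map_eq] at hp
  exact ae_of_ae_map (h.aemeasurable.mono_ac speedMeasure_absolutelyContinuous) hp

theorem integrableOn_comp {f : ℝ → E} (hf : IntegrableOn f (Icc 0 (c L))) :
    IntegrableOn (fun τ => ρ τ • f (c τ)) (Icc 0 L) := by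
  rw [IntegrableOn, ← h.map_eq] at hf
  have h1 := hf.comp_aemeasurable (h.aemeasurable.mono_ac speedMeasure_absolutelyContinuous)
  rw [speedMeasure, integrable_withDensity_iff_integrable_smul₀ h.aemeasurable_toNNReal] at h1
  refine h1.congr ?_
  filter_upwards [h.nonneg] with τ hτ
  simp [NNReal.smul_def, hτ]

theorem integral_comp {f : ℝ → E} (hf : IntegrableOn f (Icc 0 (c L))) {τ : ℝ}
    (hτ : τ ∈ Icc 0 L) :
    ∫ σ in (0 : ℝ)..τ, ρ σ • f (c σ) = ∫ t in (0 : ℝ)..(c τ), f t := by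
  have h' := h.restrict hτ
  have hf' : IntegrableOn f (Icc 0 (c τ)) := hf.mono_set (Icc_subset_Icc_right (h.mapsTo hτ).2)
  rw [intervalIntegral.integral_of_le hτ.1, intervalIntegral.integral_of_le (h.mapsTo hτ).1,
    ← integral_Icc_eq_integral_Ioc, ← integral_Icc_eq_integral_Ioc, ← h'.map_eq, integral_map
      (h'.aemeasurable.mono_ac speedMeasure_absolutelyContinuous)
      (by rw [h'.map_eq]; exact hf'.aestronglyMeasurable),
    speedMeasure, integral_withDensity_eq_integral_smul₀ h'.aemeasurable_toNNReal]
  refine integral_congr_ae ?_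
  filter_upwards [h'.nonneg] with τ hτ
  simp [NNReal.smul_def, hτ]

/-- Since `f` is measurable only up to a null set, `f ∘ c` is under control only where the clock
runs; hence the condition on `A`. -/
theorem aemeasurable_ite {β : Type*} [MeasurableSpace β] {f k : ℝ → β} {A : Set ℝ}
    [DecidablePred (· ∈ A)]
    (hf : AEMeasurable f (volume.restrict (Icc 0 (c L))))
    (hk : AEMeasurable k (volume.restrict (Icc 0 L))) (hA : MeasurableSet A)
    (hAρ : ∀ᵐ τ ∂(volume.restrict (Icc 0 L)), τ ∈ A → 0 < ρ τ) :
    AEMeasurable (fun τ => if τ ∈ A then f (c τ) else k τ) (volume.restrict (Icc 0 L)) := by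
  have h1 : AEMeasurable (fun τ => if τ ∈ A then hf.mk f (c τ) else k τ)
      (volume.restrict (Icc 0 L)) := by
    have h2 : AEMeasurable (fun τ => hf.mk f (c τ)) (volume.restrict (Icc 0 L)) :=
      hf.measurable_mk.comp_aemeasurable h.aemeasurable
    refine ⟨fun τ => if τ ∈ A then h2.mk _ τ else hk.mk k τ,
      Measurable.ite hA h2.measurable_mk hk.measurable_mk, ?_⟩
    filter_upwards [h2.ae_eq_mk, hk.ae_eq_mk] with τ h3 h4
    rw [← h3, ← h4]
  refine h1.congr ?_
  filter_upwards [h.ae_comp hf.ae_eq_mk, hAρ] with τ h3 h4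
  by_cases hτ : τ ∈ A
  · simp only [hτ, if_true]; exact (h3 (h4 hτ)).symm
  · simp only [hτ, if_false]

section Section

variable {ψ : ℝ → ℝ} (hψ : ∀ t ∈ Icc 0 (c L), ψ t ∈ Icc 0 L ∧ c (ψ t) = t)
include hψ

/-- Monotonicity is what makes an arbitrary choice of numerical times measurable, so that no
measurable selection is needed. -/
theorem strictMonoOn_section : StrictMonoOn ψ (Icc 0 (c L)) := by
  intro s hs t ht hst
  by_contra hcon
  have := h.monotoneOn (hψ t ht).1 (hψ s hs).1 (not_lt.1 hcon)
  rw [(hψ s hs).2, (hψ t ht).2] at this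
  exact absurd hst (not_lt.2 this)

theorem aemeasurable_section : AEMeasurable ψ (volume.restrict (Icc 0 (c L))) :=
  aemeasurable_restrict_of_monotoneOn measurableSet_Icc
    (h.strictMonoOn_section hψ).monotoneOn

/-- By `hid`, `ψ ∘ c` is the identity almost everywhere for the speed measure, so `map_eq` can be
inverted. The lemmas after it carry properties from numerical to physical time. -/
theorem map_section (hid : ∀ᵐ τ ∂(volume.restrict (Icc 0 L)), 0 < ρ τ → ψ (c τ) = τ) :
    (volume.restrict (Icc 0 (c L))).map ψ = speedMeasure ρ L := by
  have hm := h.aemeasurable_section hψ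
  rw [← h.map_eq] at hm ⊢
  rw [AEMeasurable.map_map_of_aemeasurable hm
    (h.aemeasurable.mono_ac speedMeasure_absolutelyContinuous)]
  rw [← h.ae_speedMeasure_iff] at hid
  rw [Measure.map_congr (f := ψ ∘ c) (g := id) hid, Measure.map_id]

theorem ae_section (hid : ∀ᵐ τ ∂(volume.restrict (Icc 0 L)), 0 < ρ τ → ψ (c τ) = τ)
    {p : ℝ → Prop} (hp : ∀ᵐ τ ∂(volume.restrict (Icc 0 L)), 0 < ρ τ → p τ) :
    ∀ᵐ t ∂(volume.restrict (Icc 0 (c L))), p (ψ t) := by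
  rw [← h.ae_speedMeasure_iff, ← h.map_section hψ hid] at hp
  exact ae_of_ae_map (h.aemeasurable_section hψ) hp

theorem aemeasurable_comp_section
    (hid : ∀ᵐ τ ∂(volume.restrict (Icc 0 L)), 0 < ρ τ → ψ (c τ) = τ)
    {β : Type*} [MeasurableSpace β] {f : ℝ → β} (hf : AEMeasurable f (volume.restrict (Icc 0 L))) :
    AEMeasurable (fun t => f (ψ t)) (volume.restrict (Icc 0 (c L))) := by
  have h1 := hf.mono_ac (speedMeasure_absolutelyContinuous (ρ := ρ))
  rw [← h.map_section hψ hid] at h1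
  exact h1.comp_aemeasurable (h.aemeasurable_section hψ)

theorem integrableOn_comp_section
    (hid : ∀ᵐ τ ∂(volume.restrict (Icc 0 L)), 0 < ρ τ → ψ (c τ) = τ)
    {f : ℝ → E} (hf : IntegrableOn (fun τ => ρ τ • f τ) (Icc 0 L)) :
    IntegrableOn (fun t => f (ψ t)) (Icc 0 (c L)) := by
  have h1 : Integrable f (speedMeasure ρ L) := by
    rw [speedMeasure, integrable_withDensity_iff_integrable_smul₀ h.aemeasurable_toNNReal]
    refine hf.congr ?_
    filter_upwards [h.nonneg] with τ hτ
    simp [NNReal.smul_def, hτ]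
  rw [← h.map_section hψ hid] at h1
  exact h1.comp_aemeasurable (h.aemeasurable_section hψ)

theorem integral_comp_section
    (hid : ∀ᵐ τ ∂(volume.restrict (Icc 0 L)), 0 < ρ τ → ψ (c τ) = τ)
    {f : ℝ → E} (hf : IntegrableOn (fun τ => ρ τ • f τ) (Icc 0 L)) {τ : ℝ} (hτ : τ ∈ Icc 0 L) :
    ∫ t in (0 : ℝ)..(c τ), f (ψ t) = ∫ σ in (0 : ℝ)..τ, ρ σ • f σ := by
  rw [← h.integral_comp (h.integrableOn_comp_section hψ hid hf) hτ,
    intervalIntegral.integral_of_le hτ.1, intervalIntegral.integral_of_le hτ.1,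
    ← integral_Icc_eq_integral_Ioc, ← integral_Icc_eq_integral_Ioc]
  refine integral_congr_ae ?_
  filter_upwards [ae_restrict_of_ae_restrict_of_subset (Icc_subset_Icc_right hτ.2) hid,
    ae_restrict_of_ae_restrict_of_subset (Icc_subset_Icc_right hτ.2) h.nonneg] with σ h1 h2
  rcases h2.eq_or_lt with h3 | h3
  · simp [← h3]
  · rw [h1 h3]

end Section

end IsClock

end Clock

/-! ### Contact impulses in the kinetic metric -/

namespace CLS

variable {n m : ℕ} (S : CLS n m)

theorem Minv_add (q x y : Vec n) : S.Minv q (x + y) = S.Minv q x + S.Minv q y := map_add _ _ _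

theorem Minv_smul (q : Vec n) (a : ℝ) (x : Vec n) : S.Minv q (a • x) = a • S.Minv q x :=
  map_smul _ _ _

theorem contact_eq (q : Vec n) (lN lT : ℝ) :
    S.contact q lN lT = lN • S.Minv q (S.normal q) + lT • S.Minv q (S.b q) := by
  rw [contact, Minv_add, Minv_smul, Minv_smul]

theorem contact_zero (q : Vec n) : S.contact q 0 0 = 0 := by simp [contact_eq]

theorem smul_contact (q : Vec n) (c a b : ℝ) :
    c • S.contact q a b = S.contact q (c * a) (c * b) := by
  simp only [contact_eq, smul_add, smul_smul]

theorem contact_sub (q : Vec n) (a b a' b' : ℝ) :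
    S.contact q (a - a') (b - b') = S.contact q a b - S.contact q a' b' := by
  simp only [contact_eq, sub_smul]; abel

theorem normalVel_add (q v w : Vec n) :
    S.normalVel q (v + w) = S.normalVel q v + S.normalVel q w := inner_add_right _ _ _

theorem tangentVel_add (q v w : Vec n) :
    S.tangentVel q (v + w) = S.tangentVel q v + S.tangentVel q w := inner_add_right _ _ _

theorem inner_Minv_comm (q x y : Vec n) : inner ℝ x (S.Minv q y) = inner ℝ y (S.Minv q x) := by
  have hH : ((S.M q)⁻¹).IsHermitian := (S.M_posDef q).isHermitian.inv
  have hs := Matrix.isSymmetric_toEuclideanLin_iff.2 hH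
  have := hs x y
  rw [Minv, Minv, ← this, real_inner_comm]

theorem inner_Minv_pos (q : Vec n) {x : Vec n} (hx : x ≠ 0) : 0 < inner ℝ x (S.Minv q x) := by
  have hP := (S.M_posDef q).inv
  have h := hP.dotProduct_mulVec_pos (x := x.ofLp) (by
    intro h0; exact hx (by ext i; exact congrFun h0 i))
  rw [Minv, Matrix.toLpLin_apply, EuclideanSpace.inner_eq_star_dotProduct, dotProduct_comm]
  exact h

theorem inner_Minv_nonneg (q x : Vec n) : 0 ≤ inner ℝ x (S.Minv q x) := by
  rcases eq_or_ne x 0 with rfl | hx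
  · simp
  · exact (S.inner_Minv_pos q hx).le

/-- Inverse inertia along the normal. -/
noncomputable def normalInertia (q : Vec n) : ℝ := inner ℝ (S.normal q) (S.Minv q (S.normal q))

/-- Inverse inertia along the tangent. -/
noncomputable def tangentInertia (q : Vec n) : ℝ := inner ℝ (S.b q) (S.Minv q (S.b q))

theorem normalInertia_pos {q : Vec n} (hq : S.fc q = 0) : 0 < S.normalInertia q :=
  S.inner_Minv_pos q (S.normal_ne_zero q hq)

theorem tangentInertia_nonneg (q : Vec n) : 0 ≤ S.tangentInertia q := S.inner_Minv_nonneg q _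

/-- Orthogonality of normal and tangent in the kinetic metric removes the friction term, so that
normal and tangential impulses act independently. -/
theorem normalVel_contact {q : Vec n} (hq : S.fc q = 0) (a b : ℝ) :
    S.normalVel q (S.contact q a b) = a * S.normalInertia q := by
  have h := S.orthogonal q hq
  have h' : inner ℝ (S.normal q) (S.Minv q (S.b q)) = 0 := by
    rw [inner_Minv_comm]; exact h
  rw [normalVel, contact_eq, inner_add_right, inner_smul_right, inner_smul_right, h', mul_zero,
    add_zero, normalInertia]

theorem tangentVel_contact {q : Vec n} (hq : S.fc q = 0) (a b : ℝ) :
    S.tangentVel q (S.contact q a b) = b * S.tangentInertia q := by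
  have h : inner ℝ (S.b q) (S.Minv q (S.normal q)) = 0 := S.orthogonal q hq
  rw [tangentVel, contact_eq, inner_add_right, inner_smul_right, inner_smul_right, h, mul_zero,
    zero_add, tangentInertia]

/-- The normal impulse is determined because the inverse inertia along the normal is positive.
Adding the two dissipation inequalities, each tested with the other's impulse, gives `(b - b') ^ 2 *
tangentInertia ≤ 0`. If the tangential inertia vanishes, so does the vector `b q`, and the
tangential impulse has no effect. -/
theorem contact_unique {q v : Vec n} (hq : S.fc q = 0) {a b a' b' : ℝ}
    (h : S.normalVel q (v + S.contact q a b) = 0)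
    (h' : S.normalVel q (v + S.contact q a' b') = 0)
    (hd : S.MaxDissipation q (v + S.contact q a b) a b)
    (hd' : S.MaxDissipation q (v + S.contact q a' b') a' b') :
    S.contact q a b = S.contact q a' b' := by
  rw [normalVel_add, S.normalVel_contact hq] at h h'
  have hD := S.normalInertia_pos hq
  obtain rfl : a = a' := by
    have : (a - a') * S.normalInertia q = 0 := by linarith
    rcases mul_eq_zero.1 this with h0 | h0
    · linarith
    · exact absurd h0 hD.ne'
  have h1 := hd.2 b' hd'.1
  have h2 := hd'.2 b hd.1
  rw [tangentVel_add, S.tangentVel_contact hq] at h1 h2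
  have h3 : (b - b') ^ 2 * S.tangentInertia q = 0 := by
    refine le_antisymm ?_ (mul_nonneg (sq_nonneg _) (S.tangentInertia_nonneg q))
    nlinarith
  rcases mul_eq_zero.1 h3 with h4 | h4
  · rw [show b = b' by nlinarith [pow_eq_zero_iff two_ne_zero |>.1 h4]]
  · have h5 : S.b q = 0 := by
      by_contra h5
      exact (S.inner_Minv_pos q h5).ne' h4
    have h6 : S.Minv q (0 : Vec n) = 0 := map_zero _
    rw [contact_eq, contact_eq, h5, h6, smul_zero, smul_zero]

/-- A convex combination of the modes is a contact problem in disguise: `θ 0` scales free motion and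
clock, `θ 1 + θ 2` is the normal force and `θ 2 - θ 1` the friction, up to constants. -/
theorem sum_modes (aN : ℝ) (y : ExtState n) (u : Vec m) (θ : Fin 3 → ℝ) :
    ∑ i, θ i • S.modes aN y u i =
      (θ 0 • y.2.1, θ 0 • S.fv y.1 y.2.1 u +
        S.contact y.1 (aN * (θ 1 + θ 2)) (S.μ * aN * (θ 2 - θ 1)), θ 0) := by
  rw [Fin.sum_univ_three]
  simp only [modes, freeMode, auxN, auxTMinus, contact_eq]
  ext1
  · simp
  · ext1
    · simp only [Matrix.cons_val_zero, Matrix.cons_val_one, Matrix.cons_val, Prod.snd_add,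
        Prod.fst_add, Prod.smul_snd, Prod.smul_fst, Prod.snd_neg, Prod.fst_neg]
      module
    · simp

end CLS

/-! ### Step functions and Filippov multipliers -/

/-- `α` are values of the (set-valued) unit step functions at the switching values `c`. -/
structure IsStep (c α : Fin 3 → ℝ) : Prop where
  nonneg : ∀ i, 0 ≤ α i
  le_one : ∀ i, α i ≤ 1
  eq_one : ∀ i, 0 < c i → α i = 1
  eq_zero : ∀ i, c i < 0 → α i = 0

theorem dotProduct_eq_zero_iff_of_nonneg {a b : Fin 3 → ℝ} (ha : 0 ≤ a) (hb : 0 ≤ b) :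
    a ⬝ᵥ b = 0 ↔ ∀ i, a i * b i = 0 := by
  rw [dotProduct, Finset.sum_eq_zero_iff_of_nonneg fun i _ => mul_nonneg (ha i) (hb i)]
  simp

theorem isStep_of_compl {c α p r : Fin 3 → ℝ} (h : c - p + r = 0) (hl : Compl α r)
    (hu : Compl (1 - α) p) : IsStep c α := by
  have hc : ∀ i, c i = p i - r i := fun i => by
    have := congrFun h i
    simp only [Pi.add_apply, Pi.sub_apply, Pi.zero_apply] at this
    linarith
  have h1 := (dotProduct_eq_zero_iff_of_nonneg hl.1 hl.2.1).1 hl.2.2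
  have h2 := (dotProduct_eq_zero_iff_of_nonneg hu.1 hu.2.1).1 hu.2.2
  have hle : ∀ i, 0 ≤ 1 - α i := fun i => hu.1 i
  refine ⟨hl.1, fun i => sub_nonneg.1 (hle i), fun i hi => ?_, fun i hi => ?_⟩
  · have h3 : 0 < p i := by have := hl.2.1 i; have := hc i; simp only [Pi.zero_apply] at *; linarith
    have h4 : (1 - α i) * p i = 0 := h2 i
    rcases mul_eq_zero.1 h4 with h5 | h5
    · linarith
    · exact absurd h5 h3.ne'
  · have h3 : 0 < r i := by have := hu.2.1 i; have := hc i; simp only [Pi.zero_apply] at *; linarith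
    rcases mul_eq_zero.1 (h1 i) with h5 | h5
    · exact h5
    · exact absurd h5 h3.ne'

namespace IsStep

variable {c α θ : Fin 3 → ℝ}

theorem compl_lower (h : IsStep c α) : Compl α (fun i => max (-c i) 0) := by
  have h0 : (0 : Fin 3 → ℝ) ≤ fun i => max (-c i) 0 := fun i => le_max_right _ _
  refine ⟨h.nonneg, h0, (dotProduct_eq_zero_iff_of_nonneg h.nonneg h0).2 fun i => ?_⟩
  rcases lt_or_ge (c i) 0 with hi | hi
  · rw [h.eq_zero i hi, zero_mul]
  · simp [hi]

theorem compl_upper (h : IsStep c α) : Compl (1 - α) (fun i => max (c i) 0) := by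
  have h0 : (0 : Fin 3 → ℝ) ≤ fun i => max (c i) 0 := fun i => le_max_right _ _
  have h1 : (0 : Fin 3 → ℝ) ≤ 1 - α := fun i => sub_nonneg.2 (h.le_one i)
  refine ⟨h1, h0, (dotProduct_eq_zero_iff_of_nonneg h1 h0).2 fun i => ?_⟩
  rcases lt_or_ge 0 (c i) with hi | hi
  · simp [h.eq_one i hi]
  · simp [hi]

theorem theta_sum (hg : gF θ α = 0) : θ 1 + θ 2 = 1 - θ 0 := by
  have h0 := congrFun hg 0
  have h1 := congrFun hg 1
  have h2 := congrFun hg 2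
  simp only [gF, Matrix.cons_val_zero, Matrix.cons_val_one, Matrix.cons_val, Pi.zero_apply]
    at h0 h1 h2
  linear_combination h0 + h1 + h2

theorem theta_eq (hg : gF θ α = 0) : θ 0 = α 0 + (1 - α 0) * α 1 ∧
    θ 1 = (1 - α 0) * (1 - α 1) * α 2 ∧ θ 2 = (1 - α 0) * (1 - α 1) * (1 - α 2) := by
  have h0 := congrFun hg 0
  have h1 := congrFun hg 1
  have h2 := congrFun hg 2
  simp only [gF, Matrix.cons_val_zero, Matrix.cons_val_one, Matrix.cons_val, Pi.zero_apply]
    at h0 h1 h2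
  exact ⟨by linarith, by linarith, by linarith⟩

theorem theta_nonneg (h : IsStep c α) (hg : gF θ α = 0) (i : Fin 3) : 0 ≤ θ i := by
  obtain ⟨h0, h1, h2⟩ := theta_eq hg
  have a0 := h.nonneg 0
  have a1 := h.nonneg 1
  have a2 := h.nonneg 2
  have b0 := sub_nonneg.2 (h.le_one 0)
  have b1 := sub_nonneg.2 (h.le_one 1)
  have b2 := sub_nonneg.2 (h.le_one 2)
  fin_cases i
  · change 0 ≤ θ 0; rw [h0]; positivity
  · change 0 ≤ θ 1; rw [h1]; positivity
  · change 0 ≤ θ 2; rw [h2]; positivity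

theorem theta_le_one (h : IsStep c α) (hg : gF θ α = 0) (i : Fin 3) : θ i ≤ 1 := by
  have h0 := h.theta_nonneg hg 0
  have h1 := h.theta_nonneg hg 1
  have h2 := h.theta_nonneg hg 2
  have h3 := theta_sum hg
  fin_cases i
  · change θ 0 ≤ 1; linarith
  · change θ 1 ≤ 1; linarith
  · change θ 2 ≤ 1; linarith

theorem theta_zero_eq_one (h : IsStep c α) (hg : gF θ α = 0) (hc : 0 < c 0 ∨ 0 < c 1) :
    θ 0 = 1 := by
  rw [(theta_eq hg).1]
  rcases hc with hc | hc
  · rw [h.eq_one 0 hc]; ring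
  · rw [h.eq_one 1 hc]; ring

theorem theta_zero_eq_zero (h : IsStep c α) (hg : gF θ α = 0) (hc : c 0 < 0) (hc' : c 1 < 0) :
    θ 0 = 0 := by
  rw [(theta_eq hg).1, h.eq_zero 0 hc, h.eq_zero 1 hc']; ring

theorem theta_two_eq_zero (h : IsStep c α) (hg : gF θ α = 0) (hc : 0 < c 2) : θ 2 = 0 := by
  rw [(theta_eq hg).2.2, h.eq_one 2 hc]; ring

theorem theta_one_eq_zero (h : IsStep c α) (hg : gF θ α = 0) (hc : c 2 < 0) : θ 1 = 0 := by
  rw [(theta_eq hg).2.1, h.eq_zero 2 hc]; ring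

/-- This is the friction cone: the right-hand side is proportional to the normal force. -/
theorem abs_theta_sub_le (h : IsStep c α) (hg : gF θ α = 0) : |θ 2 - θ 1| ≤ 1 - θ 0 := by
  have h1 := h.theta_nonneg hg 1
  have h2 := h.theta_nonneg hg 2
  have h3 := theta_sum hg
  rw [abs_le]; constructor <;> linarith

end IsStep

/-! ### Level sets of the clock, and sign arguments -/

namespace IsClock

variable {ρ c : ℝ → ℝ} {L : ℝ} (h : IsClock ρ c L)
include h

theorem exists_fiber {t : ℝ} (ht : t ∈ Icc 0 (c L)) :
    ∃ a b, a ∈ Icc 0 L ∧ b ∈ Icc 0 L ∧ a ≤ b ∧ c a = t ∧ c b = t ∧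
      ∀ τ ∈ Icc 0 L, c τ = t → τ ∈ Icc a b := by
  have hcl : IsClosed (Icc 0 L ∩ c ⁻¹' {t}) :=
    h.continuousOn.preimage_isClosed_of_isClosed isClosed_Icc isClosed_singleton
  have hK : IsCompact (Icc 0 L ∩ c ⁻¹' {t}) := isCompact_Icc.of_isClosed_subset hcl inter_subset_left
  have hne : (Icc 0 L ∩ c ⁻¹' {t}).Nonempty := by
    obtain ⟨τ, hτ, hc⟩ := h.surjOn ht
    exact ⟨τ, hτ, hc⟩
  obtain ⟨a, ha, hamin⟩ := hK.exists_isLeast hne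
  obtain ⟨b, hb, hbmax⟩ := hK.exists_isGreatest hne
  exact ⟨a, b, ha.1, hb.1, hamin hb, ha.2, hb.2, fun τ hτ hc => ⟨hamin ⟨hτ, hc⟩, hbmax ⟨hτ, hc⟩⟩⟩

theorem eq_of_mem_Icc {a b τ : ℝ} (ha : a ∈ Icc 0 L) (hb : b ∈ Icc 0 L) (hab : c a = c b)
    (hτ : τ ∈ Icc a b) : c τ = c a :=
  have hτL : τ ∈ Icc 0 L := ⟨ha.1.trans hτ.1, hτ.2.trans hb.2⟩
  le_antisymm ((h.monotoneOn hτL hb hτ.2).trans_eq hab.symm) (h.monotoneOn ha hτL hτ.1)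

theorem ae_speed_eq_zero {a b : ℝ} (ha : a ∈ Icc 0 L) (hb : b ∈ Icc 0 L) (hle : a ≤ b)
    (hab : c a = c b) : ∀ᵐ τ ∂(volume.restrict (Icc a b)), ρ τ = 0 := by
  have h1 := h.sub_eq ha hb
  rw [hab, left_eq_add, intervalIntegral.integral_of_le hle, ← integral_Icc_eq_integral_Ioc] at h1
  have hsub : Icc a b ⊆ Icc 0 L := Icc_subset_Icc ha.1 hb.2
  exact (setIntegral_eq_zero_iff_of_nonneg_ae
    (ae_restrict_of_ae_restrict_of_subset hsub h.nonneg) (h.integrable.mono_set hsub)).1 h1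

end IsClock

/-- After its last nonpositive time `f` would have to rise to `f b > 0`, although it does not
increase while positive. It serves to show that friction during a rest cannot create or reverse
slip: the slip direction at the end was present throughout. -/
theorem pos_of_pos_right {f g : ℝ → ℝ} {a b : ℝ} (hf : ContinuousOn f (Icc a b))
    (hfg : ∀ x ∈ Icc a b, f b = f x + ∫ w in x..b, g w)
    (hg : ∀ᵐ τ ∂(volume.restrict (Icc a b)), 0 < f τ → g τ ≤ 0) (hb : 0 < f b)
    {τ : ℝ} (hτ : τ ∈ Icc a b) : 0 < f τ := by
  by_contra hcon
  have hcl : IsClosed (Icc a b ∩ f ⁻¹' Iic 0) :=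
    hf.preimage_isClosed_of_isClosed isClosed_Icc isClosed_Iic
  have hK : IsCompact (Icc a b ∩ f ⁻¹' Iic 0) := isCompact_Icc.of_isClosed_subset hcl
    inter_subset_left
  obtain ⟨x, hx, hmax⟩ := hK.exists_isGreatest ⟨τ, hτ, not_lt.1 hcon⟩
  have h1 := hfg x hx.1
  have h2 : 0 ≤ ∫ w in x..b, -g w := by
    refine intervalIntegral.integral_nonneg_of_ae_restrict hx.1.2 ?_
    filter_upwards [ae_restrict_of_ae_restrict_of_subset (Icc_subset_Icc_left hx.1.1) hg,
      ae_mem_Ioo_restrict_Icc x b] with w h3 h4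
    have : 0 < f w := by
      by_contra h5
      have h6 : w ≤ x := hmax ⟨⟨hx.1.1.trans h4.1.le, h4.2.le⟩, not_lt.1 h5⟩
      exact absurd h4.1 (not_lt.2 h6)
    simpa using h3 this
  rw [intervalIntegral.integral_neg] at h2
  have h3 : f x ≤ 0 := hx.2
  linarith

namespace CLS

variable {n m : ℕ} (S : CLS n m)

theorem MaxDissipation.of_sign {q v : Vec n} {lN lT : ℝ} (h : |lT| ≤ S.μ * lN)
    (hp : 0 < S.tangentVel q v → lT = -(S.μ * lN)) (hn : S.tangentVel q v < 0 → lT = S.μ * lN) :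
    S.MaxDissipation q v lN lT := by
  refine ⟨h, fun l hl => ?_⟩
  have h1 := abs_le.1 hl
  rcases lt_trichotomy (S.tangentVel q v) 0 with h0 | h0 | h0
  · rw [hn h0]; nlinarith
  · rw [h0]; simp
  · rw [hp h0]; nlinarith

variable {S} in
theorem MaxDissipation.eq_neg {q v : Vec n} {lN lT : ℝ} (h : S.MaxDissipation q v lN lT)
    (hp : 0 < S.tangentVel q v) : lT = -(S.μ * lN) := by
  have h0 := (abs_nonneg _).trans h.1
  have h1 := h.2 (-(S.μ * lN)) (by rw [abs_neg, abs_of_nonneg h0])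
  have h2 := (abs_le.1 h.1).1
  exact le_antisymm (le_of_mul_le_mul_left h1 hp) h2

variable {S} in
theorem MaxDissipation.eq_pos {q v : Vec n} {lN lT : ℝ} (h : S.MaxDissipation q v lN lT)
    (hp : S.tangentVel q v < 0) : lT = S.μ * lN := by
  have h0 := (abs_nonneg _).trans h.1
  have h1 := h.2 (S.μ * lN) (by rw [abs_of_nonneg h0])
  have h2 := (abs_le.1 h.1).2
  nlinarith

theorem contDiff_normal : ContDiff ℝ 1 S.normal := by
  have h1 : ContDiff ℝ 1 (fderiv ℝ S.fc) := S.fc_smooth.fderiv_right le_rfl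
  exact (InnerProductSpace.toDual ℝ (Vec n)).symm.contDiff.comp h1

theorem hasDerivAt_fc_comp {q : ℝ → Vec n} {q' : Vec n} {τ : ℝ} (h : HasDerivAt q q' τ) :
    HasDerivAt (fun τ => S.fc (q τ)) (inner ℝ (S.normal (q τ)) q') τ := by
  have h1 : HasFDerivAt S.fc (fderiv ℝ S.fc (q τ)) (q τ) :=
    ((S.fc_smooth.differentiable two_ne_zero) (q τ)).hasFDerivAt
  have h2 := h1.comp_hasDerivAt τ h
  have h3 : inner ℝ (S.normal (q τ)) q' = fderiv ℝ S.fc (q τ) q' :=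
    InnerProductSpace.toDual_symm_apply
  rw [h3]
  exact h2

theorem continuous_normal : Continuous S.normal := S.contDiff_normal.continuous

theorem continuousOn_switching {y : ℝ → ExtState n} {s : Set ℝ} (hy : ContinuousOn y s) :
    ContinuousOn (fun τ => S.switching (y τ)) s := by
  have hq : ContinuousOn (fun τ => (y τ).1) s := hy.fst
  have hv : ContinuousOn (fun τ => (y τ).2.1) s := hy.snd.fst
  refine continuousOn_pi.2 fun i => ?_
  fin_cases i
  · exact S.fc_smooth.continuous.comp_continuousOn hq
  · exact (S.continuous_normal.comp_continuousOn hq).inner hv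
  · exact (S.b_smooth.continuous.comp_continuousOn hq).inner hv

end CLS

theorem fst_intervalIntegral {F G : Type*} [NormedAddCommGroup F] [NormedSpace ℝ F]
    [NormedAddCommGroup G] [NormedSpace ℝ G] [CompleteSpace G] {f : ℝ → F × G} {a b : ℝ}
    (hf : IntervalIntegrable f volume a b) :
    (∫ w in a..b, f w).1 = ∫ w in a..b, (f w).1 := by
  simp only [intervalIntegral, Prod.fst_sub, fst_integral hf.1, fst_integral hf.2]

theorem snd_intervalIntegral {F G : Type*} [NormedAddCommGroup F] [NormedSpace ℝ F]
    [NormedAddCommGroup G] [NormedSpace ℝ G] [CompleteSpace F] {f : ℝ → F × G} {a b : ℝ}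
    (hf : IntervalIntegrable f volume a b) :
    (∫ w in a..b, f w).2 = ∫ w in a..b, (f w).2 := by
  simp only [intervalIntegral, Prod.snd_sub, snd_integral hf.1, snd_integral hf.2]

/-! ### Time-freezing dynamics: the clock rests exactly at impacts -/

/-- Speed `s θ₁` of the clock in numerical time. -/
noncomputable def TFProcess.clockSpeed {n m : ℕ} (Y : TFProcess n m) (τ : ℝ) : ℝ :=
  Y.s τ * Y.θ τ 0

namespace OCP

variable {n m ng nr : ℕ} (O : OCP n m ng nr)

theorem tfRhs_eq (aN : ℝ) (Y : TFProcess n m) (τ : ℝ) :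
    O.tfRhs aN Y τ = (Y.clockSpeed τ • Y.v τ,
      Y.clockSpeed τ • O.sys.fv (Y.q τ) (Y.v τ) (Y.u τ) +
        O.sys.contact (Y.q τ) (aN * (Y.s τ * (Y.θ τ 1 + Y.θ τ 2)))
          (O.sys.μ * aN * (Y.s τ * (Y.θ τ 2 - Y.θ τ 1))), Y.clockSpeed τ) := by
  rw [tfRhs, CLS.sum_modes]
  ext1
  · simp only [Prod.smul_fst, smul_smul, TFProcess.clockSpeed, TFProcess.v]
  · ext1
    · simp only [Prod.smul_fst, Prod.smul_snd, smul_add, smul_smul, TFProcess.clockSpeed,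
        TFProcess.v, TFProcess.q, CLS.smul_contact]
      congr 2 <;> ring
    · simp only [Prod.smul_snd, TFProcess.clockSpeed, smul_eq_mul]

namespace IsTFTrajectory

variable {O} {aN Tt : ℝ} {Y : TFProcess n m} (h : O.IsTFTrajectory aN Tt Y)
include h

theorem ae_isStep : ∀ᵐ τ ∂(volume.restrict (Icc 0 Tt)),
    IsStep (O.sys.switching (Y.y τ)) (Y.α τ) ∧ gF (Y.θ τ) (Y.α τ) = 0 := by
  filter_upwards [h.switching_eq, h.compl_lower, h.compl_upper, h.multipliers] with τ h1 h2 h3 h4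
  exact ⟨isStep_of_compl h1 h2 h3, h4⟩

theorem rhsV_int : IntegrableOn (fun τ => (O.tfRhs aN Y τ).2.1) (Icc 0 Tt) := h.rhs_int.snd.fst

theorem q_speed_int : IntegrableOn (fun τ => Y.clockSpeed τ • Y.v τ) (Icc 0 Tt) := by
  have := h.rhs_int.fst
  simp only [tfRhs_eq] at this
  exact this

theorem clockSpeed_int : IntegrableOn Y.clockSpeed (Icc 0 Tt) := by
  have := h.rhs_int.snd.snd
  simp only [tfRhs_eq] at this
  exact this

theorem intervalIntegrable_rhs {τ : ℝ} (hτ : τ ∈ Icc 0 Tt) :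
    IntervalIntegrable (O.tfRhs aN Y) volume 0 τ :=
  intervalIntegrable_of_integrableOn_Icc h.rhs_int ⟨le_rfl, hτ.1.trans hτ.2⟩ hτ

theorem q_eq : ∀ τ ∈ Icc 0 Tt, Y.q τ = O.q₀ + ∫ w in (0 : ℝ)..τ, Y.clockSpeed w • Y.v w := by
  intro τ hτ
  rw [TFProcess.q, h.y_eq τ hτ, Prod.fst_add, fst_intervalIntegral (h.intervalIntegrable_rhs hτ)]
  simp only [tfRhs_eq]

theorem v_eq : ∀ τ ∈ Icc 0 Tt, Y.v τ = O.v₀ + ∫ w in (0 : ℝ)..τ, (O.tfRhs aN Y w).2.1 := by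
  intro τ hτ
  have h1 := h.intervalIntegrable_rhs hτ
  rw [TFProcess.v, h.y_eq τ hτ, Prod.snd_add, Prod.fst_add, snd_intervalIntegral h1,
    fst_intervalIntegral ⟨h1.1.snd, h1.2.snd⟩]

theorem clock_eq : ∀ τ ∈ Icc 0 Tt, Y.clock τ = ∫ w in (0 : ℝ)..τ, Y.clockSpeed w := by
  intro τ hτ
  have h1 := h.intervalIntegrable_rhs hτ
  rw [TFProcess.clock, h.y_eq τ hτ, Prod.snd_add, Prod.snd_add, snd_intervalIntegral h1,
    snd_intervalIntegral ⟨h1.1.snd, h1.2.snd⟩]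
  simp only [tfRhs_eq, zero_add]

theorem continuousOn_y : ContinuousOn Y.y (Icc 0 Tt) :=
  continuousOn_of_eq_integral h.rhs_int h.y_eq

theorem continuousOn_v : ContinuousOn Y.v (Icc 0 Tt) := h.continuousOn_y.snd.fst

theorem continuousOn_q : ContinuousOn Y.q (Icc 0 Tt) := h.continuousOn_y.fst

theorem clockSpeed_nonneg_ae : ∀ᵐ τ ∂(volume.restrict (Icc 0 Tt)), 0 ≤ Y.clockSpeed τ := by
  filter_upwards [h.ae_isStep, ae_restrict_mem measurableSet_Icc] with τ h1 h2
  exact mul_nonneg (h.s_pos τ h2).le (h1.1.theta_nonneg h1.2 0)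

theorem isClock (hTt : 0 ≤ Tt) : IsClock Y.clockSpeed Y.clock Tt where
  length_nonneg := hTt
  integrable := h.clockSpeed_int
  nonneg := h.clockSpeed_nonneg_ae
  eq_integral := h.clock_eq

theorem ae_hasDerivAt_q :
    ∀ᵐ τ ∂(volume.restrict (Icc 0 Tt)), HasDerivAt Y.q (Y.clockSpeed τ • Y.v τ) τ :=
  ae_hasDerivAt_of_eq_integral h.q_speed_int h.q_eq

theorem ae_hasDerivAt_v :
    ∀ᵐ τ ∂(volume.restrict (Icc 0 Tt)), HasDerivAt Y.v (O.tfRhs aN Y τ).2.1 τ :=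
  ae_hasDerivAt_of_eq_integral h.rhsV_int h.v_eq

theorem ae_hasDerivAt_fc : ∀ᵐ τ ∂(volume.restrict (Icc 0 Tt)),
    HasDerivAt (fun τ => O.sys.fc (Y.q τ))
      (Y.clockSpeed τ * O.sys.normalVel (Y.q τ) (Y.v τ)) τ := by
  filter_upwards [h.ae_hasDerivAt_q] with τ hτ
  have := O.sys.hasDerivAt_fc_comp hτ
  rwa [inner_smul_right] at this

theorem absolutelyContinuous_fc {a b : ℝ} (ha : a ∈ Icc 0 Tt) (hb : b ∈ Icc 0 Tt) :
    AbsolutelyContinuousOnInterval (fun τ => O.sys.fc (Y.q τ)) a b :=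
  absolutelyContinuousOnInterval_comp_of_eq_integral h.q_speed_int h.q_eq
    (O.sys.fc_smooth.of_le one_le_two) ha hb

theorem continuousOn_fc : ContinuousOn (fun τ => O.sys.fc (Y.q τ)) (Icc 0 Tt) :=
  O.sys.fc_smooth.continuous.comp_continuousOn h.continuousOn_q

theorem continuousOn_normalVel :
    ContinuousOn (fun τ => O.sys.normalVel (Y.q τ) (Y.v τ)) (Icc 0 Tt) :=
  (O.sys.continuous_normal.comp_continuousOn h.continuousOn_q).inner h.continuousOn_v

/-- Penetration never occurs. -/
theorem gap_nonneg {τ : ℝ} (hτ : τ ∈ Icc 0 Tt) : 0 ≤ O.sys.fc (Y.q τ) := by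
  by_contra hcon
  have h0 : (0 : ℝ) ∈ Icc 0 Tt := ⟨le_rfl, hτ.1.trans hτ.2⟩
  have hsub : Icc 0 τ ⊆ Icc 0 Tt := Icc_subset_Icc_right hτ.2
  have hcl : IsClosed (Icc 0 τ ∩ (fun τ => O.sys.fc (Y.q τ)) ⁻¹' Ici 0) :=
    (h.continuousOn_fc.mono hsub).preimage_isClosed_of_isClosed isClosed_Icc isClosed_Ici
  have hK := isCompact_Icc.of_isClosed_subset hcl inter_subset_left
  have hq0 : Y.q 0 = O.q₀ := by rw [h.q_eq 0 h0]; simp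
  obtain ⟨x, hx, hmax⟩ := hK.exists_isGreatest ⟨0, ⟨le_rfl, hτ.1⟩, by
    change 0 ≤ O.sys.fc (Y.q 0)
    rw [hq0]; exact O.initial_admissible⟩
  have hxT := hsub hx.1
  -- Beyond the last time `x` with nonnegative gap the state has penetrated. With negative normal
  -- velocity only auxiliary modes are active and `q` rests; otherwise the gap does not shrink.
  -- Either way the gap cannot fall below its value at `x`.
  have h1 := le_of_ae_hasDerivAt_nonneg hx.1.2 (h.absolutelyContinuous_fc hxT hτ)
    (f' := fun τ => Y.clockSpeed τ * O.sys.normalVel (Y.q τ) (Y.v τ)) (by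
      have hs : Icc x τ ⊆ Icc 0 Tt := Icc_subset_Icc hx.1.1 hτ.2
      filter_upwards [ae_restrict_of_ae_restrict_of_subset hs h.ae_hasDerivAt_fc,
        ae_restrict_of_ae_restrict_of_subset hs h.ae_isStep,
        ae_restrict_of_ae_restrict_of_subset hs h.clockSpeed_nonneg_ae,
        ae_mem_Ioo_restrict_Icc x τ] with w h1 h2 h3 h4
      refine ⟨h1, ?_⟩
      have hneg : O.sys.fc (Y.q w) < 0 := by
        by_contra h5
        have h6 : w ≤ x := hmax ⟨⟨hx.1.1.trans h4.1.le, h4.2.le⟩, not_lt.1 h5⟩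
        exact absurd h4.1 (not_lt.2 h6)
      rcases lt_or_ge (O.sys.normalVel (Y.q w) (Y.v w)) 0 with h5 | h5
      · have h6 : Y.θ w 0 = 0 := h2.1.theta_zero_eq_zero h2.2 hneg h5
        simp [TFProcess.clockSpeed, h6]
      · exact mul_nonneg h3 h5)
  have h2 : 0 ≤ O.sys.fc (Y.q x) := hx.2
  exact hcon (h2.trans h1)

/-- At almost every time of contact the derivative of the gap, clock speed times normal velocity, is
zero. -/
theorem ae_frozen : ∀ᵐ τ ∂(volume.restrict (Icc 0 Tt)),
    O.sys.Impacting (Y.q τ) (Y.v τ) → Y.clockSpeed τ = 0 := by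
  filter_upwards [ae_hasDerivAt_eq_zero_of_eq_zero h.ae_hasDerivAt_fc] with τ h1 h2
  exact (mul_eq_zero.1 (h1 h2.1)).resolve_right h2.2.ne

/-- If the clock rests then `θ 0 = 0`, which excludes a positive gap and a positive normal velocity;
a state that is not impacting then has both equal to zero. At almost every zero of the normal
velocity its derivative vanishes too, but with `q` at rest this derivative is `aN * s *
normalInertia > 0`. -/
theorem ae_running (haN : 0 < aN) : ∀ᵐ τ ∂(volume.restrict (Icc 0 Tt)),
    ¬ O.sys.Impacting (Y.q τ) (Y.v τ) → 0 < Y.clockSpeed τ := by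
  have h1 : ∀ᵐ τ ∂(volume.restrict (Icc 0 Tt)),
      HasDerivAt (fun τ => O.sys.normalVel (Y.q τ) (Y.v τ))
        (inner ℝ (O.sys.normal (Y.q τ)) (O.tfRhs aN Y τ).2.1 +
          inner ℝ (fderiv ℝ O.sys.normal (Y.q τ) (Y.clockSpeed τ • Y.v τ)) (Y.v τ)) τ := by
    filter_upwards [h.ae_hasDerivAt_q, h.ae_hasDerivAt_v] with τ hq hv
    have h2 : HasFDerivAt O.sys.normal (fderiv ℝ O.sys.normal (Y.q τ)) (Y.q τ) :=
      ((O.sys.contDiff_normal.differentiable one_ne_zero) (Y.q τ)).hasFDerivAt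
    exact (h2.comp_hasDerivAt τ hq).inner ℝ hv
  filter_upwards [ae_hasDerivAt_eq_zero_of_eq_zero h1, h.ae_isStep,
    ae_restrict_mem measurableSet_Icc, h.clockSpeed_nonneg_ae] with τ h2 h3 h4 h5 h6
  by_contra h7
  have h8 : Y.clockSpeed τ = 0 := le_antisymm (not_lt.1 h7) h5
  have hs := h.s_pos τ h4
  have hθ : Y.θ τ 0 = 0 := by
    rcases mul_eq_zero.1 h8 with h9 | h9
    · exact absurd h9 hs.ne'
    · exact h9
  have hfc : O.sys.fc (Y.q τ) = 0 := by
    refine le_antisymm ?_ (h.gap_nonneg h4)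
    by_contra h9
    have := h3.1.theta_zero_eq_one h3.2 (Or.inl (not_le.1 h9))
    rw [hθ] at this; exact zero_ne_one this
  have hnv : O.sys.normalVel (Y.q τ) (Y.v τ) = 0 := by
    refine le_antisymm ?_ ?_
    · by_contra h9
      have := h3.1.theta_zero_eq_one h3.2 (Or.inr (not_le.1 h9))
      rw [hθ] at this; exact zero_ne_one this
    · by_contra h9
      exact h6 ⟨hfc, not_le.1 h9⟩
  have h9 := h2 hnv
  rw [tfRhs_eq, h8] at h9
  simp only [zero_smul, zero_add, map_zero, inner_zero_left, add_zero] at h9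
  have h10 := O.sys.normalVel_contact hfc (aN * (Y.s τ * (Y.θ τ 1 + Y.θ τ 2)))
    (O.sys.μ * aN * (Y.s τ * (Y.θ τ 2 - Y.θ τ 1)))
  rw [CLS.normalVel, h9, IsStep.theta_sum h3.2, hθ] at h10
  have h11 := O.sys.normalInertia_pos hfc
  have : 0 < aN * (Y.s τ * (1 - 0)) * O.sys.normalInertia (Y.q τ) := by
    rw [sub_zero, mul_one]; positivity
  linarith

/-- At an impact, time stays frozen for a while. -/
theorem exists_frozen_after (hTt : 0 ≤ Tt) {τ : ℝ} (hτ : τ ∈ Ico 0 Tt)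
    (hI : O.sys.Impacting (Y.q τ) (Y.v τ)) :
    ∃ τ' ∈ Ioc τ Tt, Y.clock τ' = Y.clock τ := by
  have hτT : τ ∈ Icc 0 Tt := ⟨hτ.1, hτ.2.le⟩
  have h1 := h.continuousOn_normalVel τ hτT
  have h2 : ∀ᶠ x in 𝓝[Icc 0 Tt] τ, O.sys.normalVel (Y.q x) (Y.v x) < 0 :=
    h1.eventually_lt continuousWithinAt_const hI.2
  have h3 : ∀ᶠ x in 𝓝[≥] τ, O.sys.normalVel (Y.q x) (Y.v x) < 0 := by
    have h4 : 𝓝[Icc τ Tt] τ = 𝓝[≥] τ := nhdsWithin_Icc_eq_nhdsGE hτ.2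
    rw [← h4]
    exact h2.filter_mono (nhdsWithin_mono _ (Icc_subset_Icc_left hτ.1))
  obtain ⟨x, hx, hx'⟩ := mem_nhdsGE_iff_exists_Icc_subset.1 h3
  have hxT : min x Tt ∈ Icc 0 Tt := ⟨le_min (hτ.1.trans hx.le) hTt, min_le_right _ _⟩
  have hlt : τ < min x Tt := lt_min hx hτ.2
  refine ⟨min x Tt, ⟨hlt, min_le_right _ _⟩, ?_⟩
  have hneg : ∀ y ∈ Icc τ (min x Tt), O.sys.normalVel (Y.q y) (Y.v y) < 0 := fun y hy =>
    hx' ⟨hy.1, hy.2.trans (min_le_left _ _)⟩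
  -- While the normal velocity is negative the gap cannot grow, and it is nonnegative; so contact
  -- persists and the states remain impacting.
  have hfc : ∀ y ∈ Icc τ (min x Tt), O.sys.fc (Y.q y) = 0 := by
    intro y hy
    have hyT : y ∈ Icc 0 Tt := ⟨hτ.1.trans hy.1, hy.2.trans (min_le_right _ _)⟩
    refine le_antisymm ?_ (h.gap_nonneg hyT)
    have hs : Icc τ y ⊆ Icc 0 Tt := Icc_subset_Icc hτ.1 hyT.2
    have hac := (h.absolutelyContinuous_fc hτT hyT).neg
    have := le_of_ae_hasDerivAt_nonneg hy.1 hac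
      (f' := fun τ => -(Y.clockSpeed τ * O.sys.normalVel (Y.q τ) (Y.v τ))) (by
        filter_upwards [ae_restrict_of_ae_restrict_of_subset hs h.ae_hasDerivAt_fc,
          ae_restrict_of_ae_restrict_of_subset hs h.clockSpeed_nonneg_ae,
          ae_restrict_mem measurableSet_Icc] with w h5 h6 h7
        refine ⟨h5.neg, ?_⟩
        have := hneg w ⟨h7.1, h7.2.trans hy.2⟩
        rw [neg_nonneg]
        exact mul_nonpos_of_nonneg_of_nonpos h6 this.le)
    simp only [Pi.neg_apply, hI.1] at this
    linarith
  rw [(h.isClock hTt).sub_eq hτT hxT, intervalIntegral.integral_zero_ae, add_zero]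
  rw [uIoc_of_le hlt.le]
  have h5 : ∀ᵐ w ∂(volume.restrict (Icc τ (min x Tt))), Y.clockSpeed w = 0 := by
    have hs : Icc τ (min x Tt) ⊆ Icc 0 Tt := Icc_subset_Icc hτ.1 (min_le_right _ _)
    filter_upwards [ae_restrict_of_ae_restrict_of_subset hs h.ae_frozen,
      ae_restrict_mem measurableSet_Icc] with w h6 h7
    exact h6 ⟨hfc w h7, hneg w h7⟩
  filter_upwards [(ae_restrict_iff' measurableSet_Icc).1 h5] with w h6 h7
  exact h6 ⟨h7.1.le, h7.2⟩

end IsTFTrajectory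

end OCP

/-! ### From time-freezing trajectories to solutions of the complementarity system -/

/-- The process of the complementarity system obtained from a time-freezing process by skipping the
intervals `[a t, b t]` on which the clock shows `t`. -/
noncomputable def TFProcess.toCLS {n m : ℕ} (Y : TFProcess n m) (aN μ : ℝ) (ψ a b : ℝ → ℝ)
    (W : Finset ℝ) : CLSProcess n m where
  q t := Y.q (b t)
  v t := Y.v (b t)
  lamN t := aN * (1 - Y.θ (ψ t) 0) / Y.θ (ψ t) 0
  lamT t := μ * aN * (Y.θ (ψ t) 2 - Y.θ (ψ t) 1) / Y.θ (ψ t) 0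
  impacts := W
  impN t := aN * ∫ w in a t..b t, Y.s w
  impT t := μ * aN * ∫ w in a t..b t, Y.s w * (Y.θ w 2 - Y.θ w 1)
  u t := Y.u (ψ t)

namespace OCP

variable {n m ng nr : ℕ} (O : OCP n m ng nr)

namespace IsTFTrajectory

variable {O} {aN Tt : ℝ} {Y : TFProcess n m} (h : O.IsTFTrajectory aN Tt Y)
include h

theorem s_mul_int {f : ℝ → ℝ} (hf : AEMeasurable f (volume.restrict (Icc 0 Tt)))
    (hb : ∀ᵐ τ ∂(volume.restrict (Icc 0 Tt)), |f τ| ≤ 1) :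
    IntegrableOn (fun τ => Y.s τ * f τ) (Icc 0 Tt) :=
  Integrable.mul_bdd (c := 1) h.s_int hf.aestronglyMeasurable hb

theorem theta_aemeasurable (i : Fin 3) :
    AEMeasurable (fun τ => Y.θ τ i) (volume.restrict (Icc 0 Tt)) :=
  (measurable_pi_apply i).comp_aemeasurable h.θ_meas

theorem s_mul_friction_int : IntegrableOn (fun τ => Y.s τ * (Y.θ τ 2 - Y.θ τ 1)) (Icc 0 Tt) := by
  refine h.s_mul_int ((h.theta_aemeasurable 2).sub (h.theta_aemeasurable 1)) ?_
  filter_upwards [h.ae_isStep] with τ h1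
  exact (h1.1.abs_theta_sub_le h1.2).trans (by linarith [h1.1.theta_nonneg h1.2 0])

theorem integral_s_pos {a b : ℝ} (ha : 0 ≤ a) (hab : a < b) (hb : b ≤ Tt) :
    0 < ∫ w in a..b, Y.s w :=
  intervalIntegral.intervalIntegral_pos_of_pos_on
    (intervalIntegrable_of_integrableOn_Icc h.s_int ⟨ha, hab.le.trans hb⟩ ⟨ha.trans hab.le, hb⟩)
    (fun x hx => h.s_pos x ⟨ha.trans hx.1.le, hx.2.le.trans hb⟩) hab

section Frozen

variable (haN : 0 < aN) {a b : ℝ} (ha : 0 ≤ a) (hab : a < b) (hb : b ≤ Tt)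
  (hc : Y.clock a = Y.clock b)
include haN ha hab hb hc

omit haN in
theorem frozen_ae_speed : ∀ᵐ τ ∂(volume.restrict (Icc a b)), Y.clockSpeed τ = 0 :=
  (h.isClock (ha.trans (hab.le.trans hb))).ae_speed_eq_zero ⟨ha, hab.le.trans hb⟩
    ⟨ha.trans hab.le, hb⟩ hab.le hc

theorem frozen_ae_impacting :
    ∀ᵐ τ ∂(volume.restrict (Icc a b)), O.sys.Impacting (Y.q τ) (Y.v τ) := by
  filter_upwards [h.frozen_ae_speed ha hab hb hc,
    ae_restrict_of_ae_restrict_of_subset (Icc_subset_Icc ha hb) (h.ae_running haN)] with τ h1 h2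
  by_contra h3
  exact (h2 h3).ne' h1

theorem frozen_exists_impacting {x y : ℝ} (hx : a ≤ x) (hxy : x < y) (hy : y ≤ b) :
    ∃ τ ∈ Ioo x y, O.sys.Impacting (Y.q τ) (Y.v τ) := by
  have h1 := ae_restrict_of_ae_restrict_of_subset (Icc_subset_Icc hx hy)
    (h.frozen_ae_impacting haN ha hab hb hc)
  have h2 := h1.and (ae_mem_Ioo_restrict_Icc x y)
  have hne : (ae (volume.restrict (Icc x y))).NeBot := by
    rw [ae_neBot, Ne, Measure.restrict_eq_zero, Real.volume_Icc]
    simpa using hxy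
  obtain ⟨τ, h3, h4⟩ := h2.exists
  exact ⟨τ, h4, h3⟩

omit haN in
theorem frozen_q {τ : ℝ} (hτ : τ ∈ Icc a b) : Y.q τ = Y.q a := by
  have haT : a ∈ Icc 0 Tt := ⟨ha, hab.le.trans hb⟩
  rw [eq_add_integral_of_mem_Icc h.q_speed_int h.q_eq haT ⟨ha.trans hτ.1, hτ.2.trans hb⟩,
    intervalIntegral.integral_zero_ae, add_zero]
  rw [uIoc_of_le hτ.1]
  filter_upwards [(ae_restrict_iff' measurableSet_Icc).1
    (h.frozen_ae_speed ha hab hb hc)] with w h1 h2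
  rw [h1 ⟨h2.1.le, h2.2.trans hτ.2⟩, zero_smul]

theorem frozen_fc : O.sys.fc (Y.q a) = 0 := by
  obtain ⟨τ, hτ, hI⟩ := h.frozen_exists_impacting haN ha hab hb hc le_rfl hab le_rfl
  rw [← h.frozen_q ha hab hb hc (Ioo_subset_Icc_self hτ)]
  exact hI.1

-- As `q` is constant, so are the contact directions, and the multipliers integrate to impulses.
omit haN in
theorem frozen_v {x y : ℝ} (hx : x ∈ Icc a b) (hy : y ∈ Icc x b) :
    Y.v y = Y.v x + O.sys.contact (Y.q a) (aN * ∫ w in x..y, Y.s w)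
      (O.sys.μ * aN * ∫ w in x..y, Y.s w * (Y.θ w 2 - Y.θ w 1)) := by
  have hxT : x ∈ Icc 0 Tt := ⟨ha.trans hx.1, hx.2.trans hb⟩
  have hyT : y ∈ Icc 0 Tt := ⟨hxT.1.trans hy.1, hy.2.trans hb⟩
  rw [eq_add_integral_of_mem_Icc h.rhsV_int h.v_eq hxT hyT, CLS.contact_eq,
    ← intervalIntegral.integral_const_mul, ← intervalIntegral.integral_const_mul,
    ← intervalIntegral.integral_smul_const, ← intervalIntegral.integral_smul_const,
    ← intervalIntegral.integral_add]
  · congr 1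
    refine intervalIntegral.integral_congr_ae ?_
    rw [uIoc_of_le hy.1]
    have hsub : Icc x y ⊆ Icc a b := Icc_subset_Icc hx.1 hy.2
    have h0 : ∀ᵐ w ∂(volume.restrict (Icc x y)), (O.tfRhs aN Y w).2.1 =
        (aN * Y.s w) • O.sys.Minv (Y.q a) (O.sys.normal (Y.q a)) +
        (O.sys.μ * aN * (Y.s w * (Y.θ w 2 - Y.θ w 1))) •
          O.sys.Minv (Y.q a) (O.sys.b (Y.q a)) := by
      filter_upwards [ae_restrict_of_ae_restrict_of_subset hsub
          (h.frozen_ae_speed ha hab hb hc),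
        ae_restrict_of_ae_restrict_of_subset (hsub.trans (Icc_subset_Icc ha hb)) h.ae_isStep,
        ae_restrict_mem measurableSet_Icc] with w h1 h2 h3
      have hθ : Y.θ w 0 = 0 := by
        rcases mul_eq_zero.1 h1 with h4 | h4
        · exact absurd h4 (h.s_pos w ⟨hxT.1.trans h3.1, h3.2.trans hyT.2⟩).ne'
        · exact h4
      rw [tfRhs_eq, h1, IsStep.theta_sum h2.2, hθ, h.frozen_q ha hab hb hc (hsub h3)]
      simp only [zero_smul, zero_add, sub_zero, mul_one, CLS.contact_eq]
    filter_upwards [(ae_restrict_iff' measurableSet_Icc).1 h0] with w h1 h2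
    exact h1 ⟨h2.1.le, h2.2⟩
  · exact intervalIntegrable_of_integrableOn_Icc (Integrable.smul_const (h.s_int.const_mul aN) _) hxT hyT
  · exact intervalIntegrable_of_integrableOn_Icc
      (Integrable.smul_const (h.s_mul_friction_int.const_mul (O.sys.μ * aN)) _) hxT hyT

/-- Impacting times have full measure in the rest, hence are dense, and the inequality extends by
continuity. The end point `b` is the case that matters. -/
theorem frozen_normalVel_nonpos {τ : ℝ} (hτ : τ ∈ Icc a b) :
    O.sys.normalVel (Y.q a) (Y.v τ) ≤ 0 := by
  have hcont : ContinuousOn (fun τ => O.sys.normalVel (Y.q a) (Y.v τ)) (Icc a b) :=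
    continuousOn_const.inner (h.continuousOn_v.mono (Icc_subset_Icc ha hb))
  have hcl : IsClosed (Icc a b ∩ (fun τ => O.sys.normalVel (Y.q a) (Y.v τ)) ⁻¹' Iic 0) :=
    hcont.preimage_isClosed_of_isClosed isClosed_Icc isClosed_Iic
  by_contra hcon
  obtain ⟨ε, hε, hball⟩ := Metric.mem_nhds_iff.1 (hcl.isOpen_compl.mem_nhds fun hx => hcon hx.2)
  have hsub : max a (τ - ε) < min b (τ + ε) := by
    rw [max_lt_iff, lt_min_iff, lt_min_iff]
    have := hτ.1; have := hτ.2
    refine ⟨⟨hab, by linarith⟩, by linarith, by linarith⟩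
  obtain ⟨w, hw, hI⟩ := h.frozen_exists_impacting haN ha hab hb hc (le_max_left _ _) hsub
    (min_le_left _ _)
  have hwab : w ∈ Icc a b :=
    ⟨(le_max_left _ _).trans hw.1.le, hw.2.le.trans (min_le_left _ _)⟩
  have hmem : w ∈ Metric.ball τ ε := by
    rw [Real.ball_eq_Ioo]
    exact ⟨(le_max_right _ _).trans_lt hw.1, hw.2.trans_le (min_le_right _ _)⟩
  refine hball hmem ⟨hwab, ?_⟩
  · change O.sys.normalVel (Y.q a) (Y.v w) ≤ 0
    rw [← h.frozen_q ha hab hb hc hwab]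
    exact hI.2.le

/-- Dissipation holds pointwise with the current velocity, whereas the impulse law refers to the
final one. The gap is closed by `pos_of_pos_right`: a nonzero final slip velocity had the same sign
during the whole rest, so friction was extremal throughout. For zero final slip only the bound on
the impulse is needed. -/
theorem frozen_maxDissipation :
    O.sys.MaxDissipation (Y.q a) (Y.v b) (aN * ∫ w in a..b, Y.s w)
      (O.sys.μ * aN * ∫ w in a..b, Y.s w * (Y.θ w 2 - Y.θ w 1)) := by
  have hsubT : Icc a b ⊆ Icc 0 Tt := Icc_subset_Icc ha hb
  have haT : a ∈ Icc 0 Tt := ⟨ha, hab.le.trans hb⟩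
  have hbT : b ∈ Icc 0 Tt := ⟨ha.trans hab.le, hb⟩
  have hμ := O.sys.μ_pos
  have hfc := h.frozen_fc haN ha hab hb hc
  have hB := O.sys.tangentInertia_nonneg (Y.q a)
  have hint := intervalIntegrable_of_integrableOn_Icc h.s_mul_friction_int haT hbT
  have hints := intervalIntegrable_of_integrableOn_Icc h.s_int haT hbT
  have hstep := ae_restrict_of_ae_restrict_of_subset hsubT h.ae_isStep
  have hcont : ContinuousOn (fun τ => O.sys.tangentVel (Y.q a) (Y.v τ)) (Icc a b) :=
    continuousOn_const.inner (h.continuousOn_v.mono hsubT)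
  have hdiff : ∀ x ∈ Icc a b, O.sys.tangentVel (Y.q a) (Y.v b) =
      O.sys.tangentVel (Y.q a) (Y.v x) + ∫ w in x..b,
        (O.sys.μ * aN * O.sys.tangentInertia (Y.q a)) * (Y.s w * (Y.θ w 2 - Y.θ w 1)) := by
    intro x hx
    rw [h.frozen_v ha hab hb hc hx ⟨hx.2, le_rfl⟩, CLS.tangentVel_add,
      O.sys.tangentVel_contact hfc, intervalIntegral.integral_const_mul]
    ring
  have hsw : ∀ w ∈ Icc a b, O.sys.tangentVel (Y.q a) (Y.v w) = O.sys.switching (Y.y w) 2 := by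
    intro w hw
    rw [← h.frozen_q ha hab hb hc hw]; rfl
  have hθ0 : ∀ᵐ w ∂(volume.restrict (Icc a b)), Y.θ w 1 + Y.θ w 2 = 1 := by
    filter_upwards [h.frozen_ae_speed ha hab hb hc, hstep,
      ae_restrict_mem measurableSet_Icc] with w h1 h2 h3
    have hθ : Y.θ w 0 = 0 := by
      rcases mul_eq_zero.1 h1 with h4 | h4
      · exact absurd h4 (h.s_pos w (hsubT h3)).ne'
      · exact h4
    rw [IsStep.theta_sum h2.2, hθ, sub_zero]
  refine CLS.MaxDissipation.of_sign _ ?_ ?_ ?_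
  · rw [abs_mul, abs_of_pos (mul_pos hμ haN), mul_assoc]
    gcongr
    refine intervalIntegral.abs_integral_le_integral_abs hab.le |>.trans ?_
    refine intervalIntegral.integral_mono_ae_restrict hab.le hint.abs hints ?_
    filter_upwards [hstep, ae_restrict_mem measurableSet_Icc] with w h1 h2
    rw [abs_mul, abs_of_pos (h.s_pos w (hsubT h2))]
    have := (h1.1.abs_theta_sub_le h1.2).trans
      (by linarith [h1.1.theta_nonneg h1.2 0] : 1 - Y.θ w 0 ≤ 1)
    exact mul_le_of_le_one_right (h.s_pos w (hsubT h2)).le this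
  · intro hpos
    -- Where the slip velocity is positive, `θ 2 = 0` and friction decreases it; this is the
    -- monotonicity that the backward argument requires.
    have hall : ∀ τ ∈ Icc a b, 0 < O.sys.tangentVel (Y.q a) (Y.v τ) := fun τ hτ => by
      refine pos_of_pos_right hcont hdiff ?_ hpos hτ
      filter_upwards [hstep, ae_restrict_mem measurableSet_Icc] with w h1 h2 h3
      rw [hsw w h2] at h3
      have h4 := h1.1.theta_two_eq_zero h1.2 h3
      have h5 := h1.1.theta_nonneg h1.2 1
      have h6 := (h.s_pos w (hsubT h2)).le
      refine mul_nonpos_of_nonneg_of_nonpos (by positivity)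
        (mul_nonpos_of_nonneg_of_nonpos h6 (by linarith))
    rw [mul_assoc, ← mul_neg, ← mul_neg, ← intervalIntegral.integral_neg]
    congr 2
    refine intervalIntegral.integral_congr_ae_restrict ?_
    rw [uIoc_of_le hab.le, ← restrict_Ioo_eq_restrict_Ioc, restrict_Ioo_eq_restrict_Icc]
    filter_upwards [hstep, ae_restrict_mem measurableSet_Icc, hθ0] with w h1 h2 h3
    have h4 := h1.1.theta_two_eq_zero h1.2 (by rw [← hsw w h2]; exact hall w h2)
    rw [h4, add_zero] at h3
    rw [h4, h3]; ring
  · intro hneg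
    have hall : ∀ τ ∈ Icc a b, 0 < -O.sys.tangentVel (Y.q a) (Y.v τ) := fun τ hτ => by
      refine pos_of_pos_right (f := fun τ => -O.sys.tangentVel (Y.q a) (Y.v τ)) (g := fun w =>
        -((O.sys.μ * aN * O.sys.tangentInertia (Y.q a)) * (Y.s w * (Y.θ w 2 - Y.θ w 1))))
        hcont.neg ?_ ?_ (neg_pos.2 hneg) hτ
      · intro x hx
        rw [hdiff x hx, intervalIntegral.integral_neg, neg_add]
      filter_upwards [hstep, ae_restrict_mem measurableSet_Icc] with w h1 h2 h3
      rw [neg_pos, hsw w h2] at h3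
      have h4 := h1.1.theta_one_eq_zero h1.2 h3
      have h5 := h1.1.theta_nonneg h1.2 2
      have h6 := (h.s_pos w (hsubT h2)).le
      rw [h4, sub_zero, neg_nonpos]
      positivity
    rw [mul_assoc]
    congr 2
    refine intervalIntegral.integral_congr_ae_restrict ?_
    rw [uIoc_of_le hab.le, ← restrict_Ioo_eq_restrict_Ioc, restrict_Ioo_eq_restrict_Icc]
    filter_upwards [hstep, ae_restrict_mem measurableSet_Icc, hθ0] with w h1 h2 h3
    have h4 := h1.1.theta_one_eq_zero h1.2 (by rw [← hsw w h2]; exact neg_pos.1 (hall w h2))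
    rw [h4, zero_add] at h3
    rw [h4, h3]; ring

end Frozen

end IsTFTrajectory

end OCP

/-- For `t ∈ [0, T]`, the clock shows `t` exactly on `[a t, b t]`, and `ψ t` is one such time. -/
structure IsFiberSelection (c : ℝ → ℝ) (L : ℝ) (ψ a b : ℝ → ℝ) : Prop where
  a_mem : ∀ t ∈ Icc 0 (c L), a t ∈ Icc 0 L
  b_mem : ∀ t ∈ Icc 0 (c L), b t ∈ Icc 0 L
  le : ∀ t ∈ Icc 0 (c L), a t ≤ b t
  clock_a : ∀ t ∈ Icc 0 (c L), c (a t) = t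
  clock_b : ∀ t ∈ Icc 0 (c L), c (b t) = t
  mem : ∀ τ ∈ Icc 0 L, τ ∈ Icc (a (c τ)) (b (c τ))
  section_mem : ∀ t ∈ Icc 0 (c L), ψ t ∈ Icc 0 L ∧ c (ψ t) = t

theorem IsClock.exists_isFiberSelection {ρ c : ℝ → ℝ} {L : ℝ} (h : IsClock ρ c L) {ψ : ℝ → ℝ}
    (hψ : ∀ t ∈ Icc 0 (c L), ψ t ∈ Icc 0 L ∧ c (ψ t) = t) :
    ∃ a b, IsFiberSelection c L ψ a b := by
  choose! a b ha hb hab hca hcb hm using fun t ht => h.exists_fiber (t := t) ht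
  exact ⟨a, b, ha, hb, hab, hca, hcb, fun τ hτ => hm _ (h.mapsTo hτ) τ hτ rfl, hψ⟩

namespace IsFiberSelection

variable {c : ℝ → ℝ} {L : ℝ} {ψ a b : ℝ → ℝ} (F : IsFiberSelection c L ψ a b)
include F

theorem section_mem_fiber {t : ℝ} (ht : t ∈ Icc 0 (c L)) : ψ t ∈ Icc (a t) (b t) := by
  have := F.mem (ψ t) (F.section_mem t ht).1
  rwa [(F.section_mem t ht).2] at this

theorem section_eq {t : ℝ} (ht : t ∈ Icc 0 (c L)) (hab : ¬ a t < b t) : ψ t = b t := by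
  have h1 := F.section_mem_fiber ht
  have h2 := le_antisymm (F.le t ht) (not_lt.1 hab)
  exact le_antisymm h1.2 (h2 ▸ h1.1)

theorem eq_of_not_lt {τ : ℝ} (hτ : τ ∈ Icc 0 L) (hab : ¬ a (c τ) < b (c τ)) : b (c τ) = τ := by
  have h1 := F.mem τ hτ
  exact le_antisymm ((not_lt.1 hab).trans h1.1) h1.2

end IsFiberSelection

namespace OCP

variable {n m ng nr : ℕ} (O : OCP n m ng nr)

namespace IsTFTrajectory

variable {O} {aN Tt : ℝ} {Y : TFProcess n m} (h : O.IsTFTrajectory aN Tt Y)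

/-- The physical times of the impacts. -/
noncomputable def impactTimes : Finset ℝ := h.finite_impacts.toFinset

include h

theorem mem_impactTimes {t : ℝ} : t ∈ h.impactTimes ↔
    ∃ τ ∈ Icc 0 Tt, O.sys.Impacting (Y.q τ) (Y.v τ) ∧ Y.clock τ = t := by
  simp only [impactTimes, Finite.mem_toFinset, mem_image, mem_ofPred_eq, and_assoc]

section Fibers

variable (haN : 0 < aN) (hTt : 0 ≤ Tt) {ψ a b : ℝ → ℝ}
  (F : IsFiberSelection Y.clock Tt ψ a b)
include haN hTt F

-- An impacting state would hold the clock beyond the last time of its level set; at the final time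
-- this is excluded because the last impact is completed.
omit haN in
theorem not_impacting_fiber_end {t : ℝ} (ht : t ∈ Icc 0 (Y.clock Tt)) :
    ¬ O.sys.Impacting (Y.q (b t)) (Y.v (b t)) := by
  intro hI
  rcases (F.b_mem t ht).2.eq_or_lt with h1 | h1
  · rw [h1] at hI; exact h.impact_completed hI
  · obtain ⟨τ, hτ, hc⟩ := h.exists_frozen_after hTt ⟨(F.b_mem t ht).1, h1⟩ hI
    have h2 := F.mem τ ⟨(F.b_mem t ht).1.trans hτ.1.le, hτ.2⟩
    rw [hc, F.clock_b t ht] at h2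
    exact absurd hτ.1 (not_lt.2 h2.2)

omit haN F in
theorem impactTimes_subset {t : ℝ} (ht : t ∈ h.impactTimes) : t ∈ Icc 0 (Y.clock Tt) := by
  obtain ⟨τ, hτ, -, rfl⟩ := h.mem_impactTimes.1 ht
  exact (h.isClock hTt).mapsTo hτ

/-- An impact holds the clock for a while, and a clock that rests passes through impacting states.
-/
theorem mem_impactTimes_iff {t : ℝ} (ht : t ∈ Icc 0 (Y.clock Tt)) :
    t ∈ h.impactTimes ↔ a t < b t := by
  constructor
  · intro hW
    obtain ⟨τ, hτ, hI, rfl⟩ := h.mem_impactTimes.1 hW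
    have h1 : τ < Tt := hτ.2.lt_of_ne (by rintro rfl; exact h.impact_completed hI)
    obtain ⟨τ', hτ', hc⟩ := h.exists_frozen_after hTt ⟨hτ.1, h1⟩ hI
    have h2 := F.mem τ' ⟨hτ.1.trans hτ'.1.le, hτ'.2⟩
    rw [hc] at h2
    exact ((F.mem τ hτ).1.trans_lt hτ'.1).trans_le h2.2
  · intro hab
    have hc : Y.clock (a t) = Y.clock (b t) := by rw [F.clock_a t ht, F.clock_b t ht]
    obtain ⟨τ, hτ, hI⟩ := h.frozen_exists_impacting haN (F.a_mem t ht).1 hab (F.b_mem t ht).2 hc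
      le_rfl hab le_rfl
    refine h.mem_impactTimes.2 ⟨τ, ⟨(F.a_mem t ht).1.trans hτ.1.le, hτ.2.le.trans (F.b_mem t ht).2⟩,
      hI, ?_⟩
    rw [(h.isClock hTt).eq_of_mem_Icc (F.a_mem t ht) (F.b_mem t ht) hc (Ioo_subset_Icc_self hτ),
      F.clock_a t ht]

/-- The final normal velocity is nonpositive throughout the rest and not negative at its end, so it
is zero there. The normal impulse is positive, so the normal velocity was negative at the start. -/
theorem fiber_impact {t : ℝ} (hW : t ∈ h.impactTimes) :
    Y.q (b t) = Y.q (a t) ∧ O.sys.fc (Y.q (a t)) = 0 ∧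
      O.sys.normalVel (Y.q (a t)) (Y.v (b t)) = 0 ∧
      O.sys.normalVel (Y.q (a t)) (Y.v (a t)) < 0 := by
  have ht := h.impactTimes_subset hTt hW
  have hab := (h.mem_impactTimes_iff haN hTt F ht).1 hW
  have ha := F.a_mem t ht
  have hb := F.b_mem t ht
  have hc : Y.clock (a t) = Y.clock (b t) := by rw [F.clock_a t ht, F.clock_b t ht]
  have hq := h.frozen_q ha.1 hab hb.2 hc (right_mem_Icc.2 hab.le)
  have hfc := h.frozen_fc haN ha.1 hab hb.2 hc
  have hz : O.sys.normalVel (Y.q (a t)) (Y.v (b t)) = 0 := by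
    refine le_antisymm (h.frozen_normalVel_nonpos haN ha.1 hab hb.2 hc (right_mem_Icc.2 hab.le)) ?_
    by_contra hcon
    exact h.not_impacting_fiber_end hTt F ht (by rw [hq]; exact ⟨hfc, not_le.1 hcon⟩)
  refine ⟨hq, hfc, hz, ?_⟩
  have hv := h.frozen_v ha.1 hab hb.2 hc (left_mem_Icc.2 hab.le) (right_mem_Icc.2 hab.le)
  rw [hv, CLS.normalVel_add, O.sys.normalVel_contact hfc] at hz
  have := mul_pos (mul_pos haN (h.integral_s_pos ha.1 hab hb.2)) (O.sys.normalInertia_pos hfc)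
  linarith

omit haN F in
theorem ae_clock_notMem : ∀ᵐ τ ∂(volume.restrict (Icc 0 Tt)),
    0 < Y.clockSpeed τ → Y.clock τ ∉ h.impactTimes :=
  (h.isClock hTt).ae_comp (p := fun t => t ∉ h.impactTimes)
    (ae_restrict_of_ae (h.impactTimes.countable_toSet.ae_notMem _))

/-- Almost every running time avoids the finitely many impact times, and every other level set of
the clock is a single point. This supplies the hypothesis `hid` of the change of variables. -/
theorem ae_section_clock : ∀ᵐ τ ∂(volume.restrict (Icc 0 Tt)),
    0 < Y.clockSpeed τ → ψ (Y.clock τ) = τ := by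
  filter_upwards [h.ae_clock_notMem hTt, ae_restrict_mem measurableSet_Icc] with τ h1 h2 h3
  have h4 := (h.isClock hTt).mapsTo h2
  have h5 := fun hlt => h1 h3 ((h.mem_impactTimes_iff haN hTt F h4).2 hlt)
  rw [F.section_eq h4 h5, F.eq_of_not_lt h2 h5]

/-- Almost every physical time is no impact time; then `ψ` selects the end of the fiber. -/
theorem ae_section_eq : ∀ᵐ t ∂(volume.restrict (Icc 0 (Y.clock Tt))), ψ t = b t := by
  filter_upwards [ae_restrict_of_ae (h.impactTimes.countable_toSet.ae_notMem volume),
    ae_restrict_mem measurableSet_Icc] with t h1 h2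
  exact F.section_eq h2 fun hlt => h1 ((h.mem_impactTimes_iff haN hTt F h2).2 hlt)

theorem jump_toCLS (t : ℝ) :
    O.jump (Y.toCLS aN O.sys.μ ψ a b h.impactTimes) t =
      if t ∈ h.impactTimes then Y.v (b t) - Y.v (a t) else 0 := by
  change (if t ∈ h.impactTimes then O.sys.contact (Y.q (b t)) (aN * ∫ w in a t..b t, Y.s w)
      (O.sys.μ * aN * ∫ w in a t..b t, Y.s w * (Y.θ w 2 - Y.θ w 1)) else 0) = _
  by_cases hW : t ∈ h.impactTimes
  · rw [if_pos hW, if_pos hW]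
    have ht := h.impactTimes_subset hTt hW
    have hab := (h.mem_impactTimes_iff haN hTt F ht).1 hW
    have hc : Y.clock (a t) = Y.clock (b t) := by rw [F.clock_a t ht, F.clock_b t ht]
    rw [(h.fiber_impact haN hTt F hW).1, h.frozen_v (F.a_mem t ht).1 hab (F.b_mem t ht).2 hc
      (left_mem_Icc.2 hab.le) (right_mem_Icc.2 hab.le), add_sub_cancel_left]
  · rw [if_neg hW, if_neg hW]

theorem preVel_toCLS {t : ℝ} (ht : t ∈ Icc 0 (Y.clock Tt)) :
    O.preVel (Y.toCLS aN O.sys.μ ψ a b h.impactTimes) t = Y.v (a t) := by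
  rw [preVel, h.jump_toCLS haN hTt F]
  change Y.v (b t) - _ = _
  by_cases hW : t ∈ h.impactTimes
  · rw [if_pos hW, sub_sub_cancel]
  · rw [if_neg hW, sub_zero]
    have := mt (h.mem_impactTimes_iff haN hTt F ht).2 hW
    rw [le_antisymm (F.le t ht) (not_lt.1 this)]

/-- The acceleration in physical time, read in numerical time. -/
theorem clockSpeed_smul_accel :
    ∀ᵐ τ ∂(volume.restrict (Icc 0 Tt)),
      Y.clockSpeed τ • (O.sys.fv (Y.q τ) (Y.v τ) (Y.u τ) +
        O.sys.contact (Y.q τ) (aN * (1 - Y.θ τ 0) / Y.θ τ 0)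
          (O.sys.μ * aN * (Y.θ τ 2 - Y.θ τ 1) / Y.θ τ 0)) =
      (O.tfRhs aN Y τ).2.1 - ∑ t ∈ h.impactTimes,
        (Icc (a t) (b t)).indicator (fun σ => (O.tfRhs aN Y σ).2.1) τ := by
  filter_upwards [h.ae_clock_notMem hTt, ae_restrict_mem measurableSet_Icc,
    h.ae_running haN, h.ae_frozen, h.ae_isStep] with τ h1 h2 h3 h4 h5
  have hcl : ∀ t ∈ h.impactTimes, τ ∈ Icc (a t) (b t) → Y.clock τ = t := fun t ht hτ => by
    have ht' := h.impactTimes_subset hTt ht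
    rw [(h.isClock hTt).eq_of_mem_Icc (F.a_mem t ht') (F.b_mem t ht')
      (by rw [F.clock_a t ht', F.clock_b t ht']) hτ, F.clock_a t ht']
  by_cases hI : O.sys.Impacting (Y.q τ) (Y.v τ)
  · have h6 := h4 hI
    have hW : Y.clock τ ∈ h.impactTimes := h.mem_impactTimes.2 ⟨τ, h2, hI, rfl⟩
    rw [Finset.sum_eq_single_of_mem _ hW, indicator_of_mem (F.mem τ h2), sub_self, h6, zero_smul]
    intro t ht hne
    exact indicator_of_notMem (fun hτ => hne (hcl t ht hτ).symm) _
  · have h6 := h3 hI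
    have h7 := h1 h6
    have hθ : Y.θ τ 0 ≠ 0 := fun h8 => h6.ne' (by rw [TFProcess.clockSpeed, h8, mul_zero])
    rw [Finset.sum_eq_zero, sub_zero, tfRhs_eq, IsStep.theta_sum h5.2, smul_add, CLS.smul_contact,
      TFProcess.clockSpeed]
    · congr 2 <;> field_simp
    · intro t ht
      exact indicator_of_notMem (fun hτ => h7 (hcl t ht hτ ▸ ht)) _

omit haN hTt F in
theorem integrableOn_frozen (a b : ℝ → ℝ) : IntegrableOn (fun τ => ∑ t ∈ h.impactTimes,
    (Icc (a t) (b t)).indicator (fun σ => (O.tfRhs aN Y σ).2.1) τ) (Icc 0 Tt) :=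
  integrable_finsetSum _ fun _ _ => Integrable.indicator h.rhsV_int measurableSet_Icc

theorem integrableOn_accel :
    IntegrableOn (fun τ => Y.clockSpeed τ • (O.sys.fv (Y.q τ) (Y.v τ) (Y.u τ) +
        O.sys.contact (Y.q τ) (aN * (1 - Y.θ τ 0) / Y.θ τ 0)
          (O.sys.μ * aN * (Y.θ τ 2 - Y.θ τ 1) / Y.θ τ 0))) (Icc 0 Tt) :=
  (h.rhsV_int.sub (h.integrableOn_frozen a b)).congr
    ((h.clockSpeed_smul_accel haN hTt F).mono fun _ h1 => h1.symm)

-- The rest at `w` lies entirely before `b t` if `w ≤ t` and is disjoint from `[0, b t]` otherwise;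
-- each complete rest contributes its velocity jump.
omit haN in
theorem integral_frozen {t : ℝ} (ht : t ∈ Icc 0 (Y.clock Tt)) :
    ∫ τ in (0 : ℝ)..b t, ∑ w ∈ h.impactTimes,
        (Icc (a w) (b w)).indicator (fun σ => (O.tfRhs aN Y σ).2.1) τ =
      ∑ w ∈ h.impactTimes with w ≤ t, (Y.v (b w) - Y.v (a w)) := by
  have hb := F.b_mem t ht
  rw [Finset.sum_filter, intervalIntegral.integral_finsetSum]
  · refine Finset.sum_congr rfl fun w hw => ?_
    have hw' := h.impactTimes_subset hTt hw
    rw [intervalIntegral.integral_of_le hb.1, ← integral_Icc_eq_integral_Ioc,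
      setIntegral_indicator measurableSet_Icc]
    by_cases hwt : w ≤ t
    · have hsub : Icc (a w) (b w) ⊆ Icc 0 (b t) := by
        refine Icc_subset_Icc (F.a_mem w hw').1 ?_
        rcases hwt.eq_or_lt with rfl | hlt
        · exact le_rfl
        · by_contra hcon
          have := (h.isClock hTt).monotoneOn hb (F.b_mem w hw') (not_le.1 hcon).le
          rw [F.clock_b t ht, F.clock_b w hw'] at this
          exact absurd hlt (not_lt.2 this)
      rw [if_pos hwt, inter_eq_right.2 hsub, integral_Icc_eq_integral_Ioc,
        ← intervalIntegral.integral_of_le (F.le w hw'),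
        eq_add_integral_of_mem_Icc h.rhsV_int h.v_eq (F.a_mem w hw') (F.b_mem w hw'),
        add_sub_cancel_left]
    · have hempty : Icc 0 (b t) ∩ Icc (a w) (b w) = ∅ := by
        refine eq_empty_of_forall_notMem fun x hx => ?_
        have := (h.isClock hTt).monotoneOn (F.a_mem w hw') hb (hx.2.1.trans hx.1.2)
        rw [F.clock_a w hw', F.clock_b t ht] at this
        exact hwt this
      rw [if_neg hwt, hempty, setIntegral_empty]
  · intro w _
    exact intervalIntegrable_of_integrableOn_Icc
      (Integrable.indicator h.rhsV_int measurableSet_Icc) ⟨le_rfl, hTt⟩ hb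

theorem accel_toCLS_ae : ∀ᵐ t ∂(volume.restrict (Icc 0 (Y.clock Tt))),
    O.accel (Y.toCLS aN O.sys.μ ψ a b h.impactTimes) t =
      O.sys.fv (Y.q (ψ t)) (Y.v (ψ t)) (Y.u (ψ t)) +
        O.sys.contact (Y.q (ψ t)) (aN * (1 - Y.θ (ψ t) 0) / Y.θ (ψ t) 0)
          (O.sys.μ * aN * (Y.θ (ψ t) 2 - Y.θ (ψ t) 1) / Y.θ (ψ t) 0) := by
  filter_upwards [h.ae_section_eq haN hTt F] with t ht
  simp only [accel, TFProcess.toCLS, ht]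

omit haN hTt F in
theorem clockSpeed_mul_force_int {f : ℝ → ℝ} (hf : AEMeasurable f (volume.restrict (Icc 0 Tt)))
    (hb : ∀ᵐ τ ∂(volume.restrict (Icc 0 Tt)), |f τ| ≤ 1) (k : ℝ) :
    IntegrableOn (fun τ => Y.clockSpeed τ • (k * f τ / Y.θ τ 0)) (Icc 0 Tt) := by
  have h1 := (h.s_mul_int hf hb).const_mul k
  refine Integrable.mono h1 ?_ ?_
  · exact (h.clockSpeed_int.aestronglyMeasurable.aemeasurable.smul
      ((hf.const_mul k).div (h.theta_aemeasurable 0))).aestronglyMeasurable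
  · refine Eventually.of_forall fun τ => ?_
    -- Division by `θ 0` is harmless: the clock speed contains the factor `θ 0`, and where `θ 0 = 0`
    -- the product is zero by convention.
    by_cases hθ : Y.θ τ 0 = 0
    · simp only [TFProcess.clockSpeed, hθ, mul_zero, zero_smul, norm_zero]
      exact norm_nonneg _
    · refine le_of_eq (congrArg norm ?_)
      rw [TFProcess.clockSpeed, smul_eq_mul]
      field_simp

theorem isCLSSolution_toCLS (hT : Y.clock Tt = O.T) :
    O.IsCLSSolution (Y.toCLS aN O.sys.μ ψ a b h.impactTimes) := by
  have hC := h.isClock hTt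
  have hid := h.ae_section_clock haN hTt F
  have hψ := F.section_mem
  refine
    { u_meas := ?_, lamN_int := ?_, lamT_int := ?_, accel_int := ?_, q_eq := ?_, v_eq := ?_,
      gap_nonneg := ?_, complementarity := ?_, friction := ?_, impact_iff := ?_,
      impact_law := ?_, impN_nonneg := ?_, impact_friction := ?_ } <;> rw [← hT] at *
  · exact hC.aemeasurable_comp_section hψ hid h.u_meas
  · refine hC.integrableOn_comp_section hψ hid
      (h.clockSpeed_mul_force_int ((h.theta_aemeasurable 0).const_sub 1) ?_ aN)
    filter_upwards [h.ae_isStep] with τ h1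
    rw [abs_le]
    constructor <;> linarith [h1.1.theta_nonneg h1.2 0, h1.1.theta_le_one h1.2 0]
  · refine hC.integrableOn_comp_section hψ hid
      (h.clockSpeed_mul_force_int ((h.theta_aemeasurable 2).sub (h.theta_aemeasurable 1))
        ?_ (O.sys.μ * aN))
    filter_upwards [h.ae_isStep] with τ h1
    exact (h1.1.abs_theta_sub_le h1.2).trans (by linarith [h1.1.theta_nonneg h1.2 0])
  · exact (hC.integrableOn_comp_section hψ hid (h.integrableOn_accel haN hTt F)).congr
      ((h.accel_toCLS_ae haN hTt F).mono fun _ h1 => h1.symm)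
  · intro t ht
    change Y.q (b t) = _ + ∫ w in (0 : ℝ)..t, Y.v (b w)
    have h1 := hC.integral_comp_section hψ hid h.q_speed_int (F.b_mem t ht)
    rw [F.clock_b t ht] at h1
    rw [h.q_eq _ (F.b_mem t ht), ← h1]
    congr 1
    refine intervalIntegral.integral_congr_ae_restrict ?_
    rw [uIoc_of_le ht.1]
    have h2 := ae_restrict_of_ae_restrict_of_subset
      (Ioc_subset_Icc_self.trans (Icc_subset_Icc_right ht.2)) (h.ae_section_eq haN hTt F)
    filter_upwards [h2] with w hw
    rw [hw]
  · intro t ht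
    change Y.v (b t) = _
    have h1 := hC.integral_comp_section hψ hid (h.integrableOn_accel haN hTt F) (F.b_mem t ht)
    have h2 : ∫ w in (0 : ℝ)..t, O.accel (Y.toCLS aN O.sys.μ ψ a b h.impactTimes) w =
        ∫ σ in (0 : ℝ)..b t, ((O.tfRhs aN Y σ).2.1 - ∑ t ∈ h.impactTimes,
          (Icc (a t) (b t)).indicator (fun σ => (O.tfRhs aN Y σ).2.1) σ) := by
      rw [F.clock_b t ht] at h1
      refine Eq.trans ?_ (h1.trans ?_)
      · refine intervalIntegral.integral_congr_ae_restrict ?_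
        rw [uIoc_of_le ht.1]
        exact ae_restrict_of_ae_restrict_of_subset
          (Ioc_subset_Icc_self.trans (Icc_subset_Icc_right ht.2)) (h.accel_toCLS_ae haN hTt F)
      · refine intervalIntegral.integral_congr_ae_restrict ?_
        rw [uIoc_of_le (F.b_mem t ht).1]
        exact ae_restrict_of_ae_restrict_of_subset
          (Ioc_subset_Icc_self.trans (Icc_subset_Icc_right (F.b_mem t ht).2))
          (h.clockSpeed_smul_accel haN hTt F)
    have h0 : (0 : ℝ) ∈ Icc 0 Tt := ⟨le_rfl, hTt⟩
    rw [h2, intervalIntegral.integral_sub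
      (intervalIntegrable_of_integrableOn_Icc h.rhsV_int h0 (F.b_mem t ht))
      (intervalIntegrable_of_integrableOn_Icc (h.integrableOn_frozen a b) h0 (F.b_mem t ht)),
      h.integral_frozen hTt F ht, h.v_eq _ (F.b_mem t ht)]
    have h3 : ∑ w ∈ h.impactTimes with w ≤ t, O.jump (Y.toCLS aN O.sys.μ ψ a b h.impactTimes) w =
        ∑ w ∈ h.impactTimes with w ≤ t, (Y.v (b w) - Y.v (a w)) := by
      refine Finset.sum_congr rfl fun w hw => ?_
      rw [h.jump_toCLS haN hTt F, if_pos (Finset.mem_filter.1 hw).1]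
    change _ = _ + _ + ∑ w ∈ h.impactTimes with w ≤ t, _
    rw [h3]
    abel
  · intro t ht
    exact h.gap_nonneg (F.b_mem t ht)
  · have h1 : ∀ᵐ τ ∂(volume.restrict (Icc 0 Tt)), 0 < Y.clockSpeed τ →
        0 ≤ aN * (1 - Y.θ τ 0) / Y.θ τ 0 ∧
          aN * (1 - Y.θ τ 0) / Y.θ τ 0 * O.sys.fc (Y.q τ) = 0 := by
      filter_upwards [h.ae_isStep, ae_restrict_mem measurableSet_Icc] with τ h1 h2 _
      refine ⟨div_nonneg (mul_nonneg haN.le (sub_nonneg.2 (h1.1.theta_le_one h1.2 0)))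
        (h1.1.theta_nonneg h1.2 0), ?_⟩
      rcases (h.gap_nonneg h2).eq_or_lt with h3 | h3
      · rw [← h3, mul_zero]
      · rw [h1.1.theta_zero_eq_one h1.2 (Or.inl h3)]; simp
    filter_upwards [hC.ae_section hψ hid h1, h.ae_section_eq haN hTt F] with t h2 h3
    simp only [TFProcess.toCLS, ← h3]
    exact h2
  · have h1 : ∀ᵐ τ ∂(volume.restrict (Icc 0 Tt)), 0 < Y.clockSpeed τ →
        O.sys.MaxDissipation (Y.q τ) (Y.v τ) (aN * (1 - Y.θ τ 0) / Y.θ τ 0)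
          (O.sys.μ * aN * (Y.θ τ 2 - Y.θ τ 1) / Y.θ τ 0) := by
      filter_upwards [h.ae_isStep, ae_restrict_mem measurableSet_Icc] with τ h1 h2 _
      have hμ := O.sys.μ_pos
      have hs := IsStep.theta_sum h1.2
      refine CLS.MaxDissipation.of_sign _ ?_ ?_ ?_
      · rw [abs_div, abs_of_nonneg (h1.1.theta_nonneg h1.2 0), abs_mul,
          abs_of_pos (mul_pos hμ haN), ← mul_div_assoc, ← mul_assoc]
        exact div_le_div_of_nonneg_right (mul_le_mul_of_nonneg_left (h1.1.abs_theta_sub_le h1.2)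
          (mul_pos hμ haN).le) (h1.1.theta_nonneg h1.2 0)
      · intro h3
        have h4 := h1.1.theta_two_eq_zero h1.2 h3
        rw [← hs, h4]; ring
      · intro h3
        have h4 := h1.1.theta_one_eq_zero h1.2 h3
        rw [← hs, h4]; ring
    filter_upwards [hC.ae_section hψ hid h1, h.ae_section_eq haN hTt F] with t h2 h3
    simp only [TFProcess.toCLS, ← h3]
    exact h2
  · intro t
    change t ∈ h.impactTimes ↔ _
    constructor
    · intro hW
      have ht := h.impactTimes_subset hTt hW
      refine ⟨ht, ?_⟩
      rw [h.preVel_toCLS haN hTt F ht]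
      obtain ⟨h1, h2, h3, h4⟩ := h.fiber_impact haN hTt F hW
      change O.sys.Impacting (Y.q (b t)) _
      rw [h1]
      exact ⟨h2, h4⟩
    · rintro ⟨ht, hI⟩
      rw [h.preVel_toCLS haN hTt F ht] at hI
      by_contra hW
      have h1 := mt (h.mem_impactTimes_iff haN hTt F ht).2 hW
      rw [le_antisymm (F.le t ht) (not_lt.1 h1)] at hI
      exact h.not_impacting_fiber_end hTt F ht hI
  · intro t hW
    obtain ⟨h1, h2, h3, h4⟩ := h.fiber_impact haN hTt F hW
    change O.sys.normalVel (Y.q (b t)) (Y.v (b t)) = 0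
    rw [h1]; exact h3
  · intro t hW
    have ht := h.impactTimes_subset hTt hW
    have hab := (h.mem_impactTimes_iff haN hTt F ht).1 hW
    exact mul_nonneg haN.le (h.integral_s_pos (F.a_mem t ht).1 hab (F.b_mem t ht).2).le
  · intro t hW
    have ht := h.impactTimes_subset hTt hW
    have hab := (h.mem_impactTimes_iff haN hTt F ht).1 hW
    change O.sys.MaxDissipation (Y.q (b t)) (Y.v (b t)) _ _
    rw [(h.fiber_impact haN hTt F hW).1]
    exact h.frozen_maxDissipation haN (F.a_mem t ht).1 hab (F.b_mem t ht).2
      (by rw [F.clock_a t ht, F.clock_b t ht])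

end Fibers

/-- A time-freezing trajectory describes the motion of a solution of the complementarity system. -/
theorem exists_isCLSSolution (haN : 0 < aN) (hTt : 0 ≤ Tt) {ψ : ℝ → ℝ}
    (hψ : O.IsNumericalTime Tt Y ψ) :
    ∃ P : CLSProcess n m, O.IsCLSSolution P ∧ SameMotion Tt P Y ∧ (P.u = fun t => Y.u (ψ t)) ∧
      P.q O.T = Y.q Tt ∧ P.v O.T = Y.v Tt ∧
      ((∀ᵐ τ ∂(volume.restrict (Icc 0 Tt)), 0 ≤ O.g (Y.q τ, Y.v τ) (Y.u τ)) →
        ∀ᵐ t ∂(volume.restrict (Icc 0 O.T)), 0 ≤ O.g (P.q t, P.v t) (P.u t)) := by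
  have hT := h.clock_end
  have hC := h.isClock hTt
  rw [IsNumericalTime, ← hT] at hψ
  obtain ⟨a, b, F⟩ := hC.exists_isFiberSelection hψ
  have hTm : Y.clock Tt ∈ Icc 0 (Y.clock Tt) := hC.mapsTo hC.length_mem
  -- The fiber of the final clock value ends at `Tt`, so the terminal states coincide even if the
  -- final time is an impact.
  have hbT : b (Y.clock Tt) = Tt := le_antisymm (F.b_mem _ hTm).2 (F.mem Tt hC.length_mem).2
  refine ⟨_, h.isCLSSolution_toCLS haN hTt F hT, ?_, rfl, ?_, ?_, ?_⟩
  · intro τ hτ hW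
    have h1 := mt (h.mem_impactTimes_iff haN hTt F (hC.mapsTo hτ)).2 hW
    simp only [TFProcess.toCLS, F.eq_of_not_lt hτ h1, and_self]
  · rw [← hT]; change Y.q (b _) = _; rw [hbT]
  · rw [← hT]; change Y.v (b _) = _; rw [hbT]
  · intro hg
    rw [← hT]
    filter_upwards [hC.ae_section F.section_mem (h.ae_section_clock haN hTt F)
      (p := fun τ => 0 ≤ O.g (Y.q τ, Y.v τ) (Y.u τ)) (hg.mono fun _ h1 _ => h1),
      h.ae_section_eq haN hTt F] with t h1 h2
    simp only [TFProcess.toCLS, ← h2]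
    exact h1

end IsTFTrajectory

end OCP

/-! ### A clock with prescribed rests -/

/-- The function that rises with slope one from `0` at time `a` to `l` at time `a + l`. -/
noncomputable def ramp (a l τ : ℝ) : ℝ := max 0 (min l (τ - a))

theorem ramp_of_le {a l τ : ℝ} (h : τ ≤ a) : ramp a l τ = 0 :=
  max_eq_left ((min_le_right _ _).trans (sub_nonpos.2 h))

theorem ramp_of_ge {a l τ : ℝ} (hl : 0 ≤ l) (h : a + l ≤ τ) : ramp a l τ = l := by
  rw [ramp, min_eq_left (by linarith), max_eq_right hl]

theorem ramp_of_mem {a l τ : ℝ} (h : τ ∈ Icc a (a + l)) : ramp a l τ = τ - a := by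
  have := h.1; have := h.2
  rw [ramp, min_eq_right (by linarith), max_eq_right (by linarith)]

theorem integrableOn_indicator_one {s : Set ℝ} (hs : MeasurableSet s) (L : ℝ) :
    IntegrableOn (s.indicator (1 : ℝ → ℝ)) (Icc 0 L) :=
  Integrable.indicator (f := (1 : ℝ → ℝ)) (integrableOn_const (by simp)) hs

theorem integral_indicator_Ico {a l τ : ℝ} (ha : 0 ≤ a) (hτ : 0 ≤ τ) :
    ∫ w in (0 : ℝ)..τ, (Ico a (a + l)).indicator (1 : ℝ → ℝ) w = ramp a l τ := by
  rw [intervalIntegral.integral_of_le hτ, ← restrict_Ioo_eq_restrict_Ioc,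
    restrict_Ioo_eq_restrict_Ico, integral_indicator_one measurableSet_Ico, measureReal_def,
    Measure.restrict_apply measurableSet_Ico, Ico_inter_Ico, Real.volume_Ico,
    ENNReal.toReal_ofReal', ramp, max_eq_left ha, max_comm]
  congr 1
  change min (a + l) τ - a = _
  rw [← min_sub_sub_right, add_sub_cancel_left]

section Schedule

variable (W : Finset ℝ) (κ ℓ : ℝ)

/-- Numerical time at which the clock reaches `t`, if it runs with speed `κ` and rests for a period
of length `ℓ` at each `w ∈ W`. -/
noncomputable def startTime (t : ℝ) : ℝ := t / κ + ℓ * (W.filter (· < t)).card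

/-- Speed of the clock that rests for a period of length `ℓ` at each `w ∈ W`. -/
noncomputable def schedSpeed (τ : ℝ) : ℝ :=
  κ * (1 - ∑ w ∈ W, (Ico (startTime W κ ℓ w) (startTime W κ ℓ w + ℓ)).indicator (1 : ℝ → ℝ) τ)

/-- The clock that rests for a period of length `ℓ` at each `w ∈ W`. -/
noncomputable def schedClock (τ : ℝ) : ℝ :=
  κ * (τ - ∑ w ∈ W, ramp (startTime W κ ℓ w) ℓ τ)

variable {W κ ℓ} (hκ : 0 < κ) (hℓ : 0 < ℓ)
include hκ hℓ

/-- The start at `t` counts the rest at `w` in full, and the clock still has to run from `w` to `t`.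
Hence the rests are disjoint and ordered. -/
theorem startTime_add_lt {w t : ℝ} (hw : w ∈ W) (hwt : w < t) :
    startTime W κ ℓ w + ℓ < startTime W κ ℓ t := by
  have h1 : (W.filter (· < w)).card + 1 ≤ (W.filter (· < t)).card := by
    rw [← Finset.card_insert_of_notMem (s := W.filter (· < w)) (a := w) (by simp)]
    refine Finset.card_le_card fun x hx => ?_
    rcases Finset.mem_insert.1 hx with rfl | hx
    · exact Finset.mem_filter.2 ⟨hw, hwt⟩
    · exact Finset.mem_filter.2 ⟨(Finset.mem_filter.1 hx).1, (Finset.mem_filter.1 hx).2.trans hwt⟩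
  have h2 : ((W.filter (· < w)).card : ℝ) + 1 ≤ (W.filter (· < t)).card := by exact_mod_cast h1
  have h3 : w / κ < t / κ := div_lt_div_of_pos_right hwt hκ
  have h4 := mul_le_mul_of_nonneg_left h2 hℓ.le
  rw [startTime, startTime]
  linarith

theorem startTime_le {t t' : ℝ} (h : t ≤ t') : startTime W κ ℓ t ≤ startTime W κ ℓ t' := by
  have h1 : (W.filter (· < t)).card ≤ (W.filter (· < t')).card :=
    Finset.card_le_card fun x hx => Finset.mem_filter.2
      ⟨(Finset.mem_filter.1 hx).1, (Finset.mem_filter.1 hx).2.trans_le h⟩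
  have h2 : ((W.filter (· < t)).card : ℝ) ≤ (W.filter (· < t')).card := by exact_mod_cast h1
  rw [startTime, startTime]
  gcongr

theorem sum_ramp_eq {t τ : ℝ} (hs : startTime W κ ℓ t ≤ τ) (he : ∀ w ∈ W, t < w →
    τ ≤ startTime W κ ℓ w) : ∑ w ∈ W, ramp (startTime W κ ℓ w) ℓ τ =
      ℓ * (W.filter (· < t)).card + if t ∈ W then ramp (startTime W κ ℓ t) ℓ τ else 0 := by
  have h1 : ∀ w ∈ W, ramp (startTime W κ ℓ w) ℓ τ = (if w < t then ℓ else 0) +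
      if w = t then ramp (startTime W κ ℓ t) ℓ τ else 0 := by
    intro w hw
    rcases lt_trichotomy w t with h | h | h
    · rw [if_pos h, if_neg h.ne, add_zero,
        ramp_of_ge hℓ.le ((startTime_add_lt hκ hℓ hw h).le.trans hs)]
    · rw [if_neg h.not_lt, if_pos h, zero_add, h]
    · rw [if_neg h.not_gt, if_neg h.ne', add_zero, ramp_of_le (he w hw h)]
  rw [Finset.sum_congr rfl h1, Finset.sum_add_distrib, Finset.sum_ite_eq' W t,
    ← Finset.sum_filter, Finset.sum_const, nsmul_eq_mul, mul_comm]

theorem schedClock_eq_of_mem {w τ : ℝ} (hw : w ∈ W)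
    (hτ : τ ∈ Icc (startTime W κ ℓ w) (startTime W κ ℓ w + ℓ)) : schedClock W κ ℓ τ = w := by
  rw [schedClock, sum_ramp_eq hκ hℓ hτ.1 fun w' hw' h =>
    hτ.2.trans (startTime_add_lt hκ hℓ hw h).le, if_pos hw, ramp_of_mem hτ, startTime]
  field_simp
  ring

theorem schedClock_startTime (t : ℝ) : schedClock W κ ℓ (startTime W κ ℓ t) = t := by
  by_cases ht : t ∈ W
  · exact schedClock_eq_of_mem hκ hℓ ht ⟨le_rfl, by linarith⟩
  · rw [schedClock, sum_ramp_eq hκ hℓ le_rfl fun w' _ h => startTime_le hκ hℓ h.le, if_neg ht,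
      startTime]
    field_simp
    ring

theorem startTime_nonneg {t : ℝ} (ht : 0 ≤ t) : 0 ≤ startTime W κ ℓ t := by
  rw [startTime]; positivity

theorem startTime_add_le_end {T w : ℝ} (hw : w ∈ W) (hwT : w ≤ T) :
    startTime W κ ℓ w + ℓ ≤ T / κ + ℓ * W.card := by
  have h2 : (W.filter (· < w)).card + 1 ≤ W.card :=
    Finset.card_lt_card (Finset.filter_ssubset.2 ⟨w, hw, lt_irrefl w⟩)
  have h3 : ((W.filter (· < w)).card : ℝ) + 1 ≤ W.card := by exact_mod_cast h2
  have h4 := mul_le_mul_of_nonneg_left h3 hℓ.le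
  have h5 : w / κ ≤ T / κ := div_le_div_of_nonneg_right hwT hκ.le
  rw [startTime]; linarith

theorem schedClock_end {T : ℝ} (hW : ∀ w ∈ W, w ≤ T) :
    schedClock W κ ℓ (T / κ + ℓ * W.card) = T := by
  rw [schedClock, Finset.sum_congr rfl fun w hw =>
    ramp_of_ge hℓ.le (startTime_add_le_end hκ hℓ hw (hW w hw)), Finset.sum_const, nsmul_eq_mul]
  field_simp
  ring

omit hκ hℓ in
/-- Whether the clock rests. -/
def IsResting (W : Finset ℝ) (κ ℓ τ : ℝ) : Prop :=
  ∃ w ∈ W, τ ∈ Ico (startTime W κ ℓ w) (startTime W κ ℓ w + ℓ)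

theorem IsResting.eq_clock {w τ : ℝ} (hw : w ∈ W)
    (hτ : τ ∈ Ico (startTime W κ ℓ w) (startTime W κ ℓ w + ℓ)) : schedClock W κ ℓ τ = w :=
  schedClock_eq_of_mem hκ hℓ hw (Ico_subset_Icc_self hτ)

theorem isResting_iff {τ : ℝ} : IsResting W κ ℓ τ ↔ schedClock W κ ℓ τ ∈ W ∧
    τ ∈ Ico (startTime W κ ℓ (schedClock W κ ℓ τ))
      (startTime W κ ℓ (schedClock W κ ℓ τ) + ℓ) := by
  constructor
  · rintro ⟨w, hw, hτ⟩
    rw [IsResting.eq_clock hκ hℓ hw hτ]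
    exact ⟨hw, hτ⟩
  · rintro ⟨hw, hτ⟩
    exact ⟨_, hw, hτ⟩

theorem schedSpeed_of_isResting {τ : ℝ} (h : IsResting W κ ℓ τ) : schedSpeed W κ ℓ τ = 0 := by
  obtain ⟨w, hw, hτ⟩ := h
  rw [schedSpeed, Finset.sum_eq_single_of_mem w hw, indicator_of_mem hτ]
  · simp
  · intro w' hw' hne
    refine indicator_of_notMem (fun hτ' => hne ?_) _
    rw [← IsResting.eq_clock hκ hℓ hw hτ, ← IsResting.eq_clock hκ hℓ hw' hτ']

omit hκ hℓ in
theorem sum_indicator_of_not_isResting {τ : ℝ} (h : ¬ IsResting W κ ℓ τ) (f : ℝ → ℝ) :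
    ∑ w ∈ W, f w * (Ico (startTime W κ ℓ w) (startTime W κ ℓ w + ℓ)).indicator (1 : ℝ → ℝ) τ
      = 0 := by
  refine Finset.sum_eq_zero fun w hw => ?_
  rw [indicator_of_notMem (fun hτ => h ⟨w, hw, hτ⟩), mul_zero]

omit hκ hℓ in
theorem schedSpeed_of_not_isResting {τ : ℝ} (h : ¬ IsResting W κ ℓ τ) :
    schedSpeed W κ ℓ τ = κ := by
  have h1 := sum_indicator_of_not_isResting h (fun _ => 1)
  simp only [one_mul] at h1
  rw [schedSpeed, h1, sub_zero, mul_one]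

theorem schedSpeed_pos_iff {τ : ℝ} : 0 < schedSpeed W κ ℓ τ ↔ ¬ IsResting W κ ℓ τ := by
  by_cases h : IsResting W κ ℓ τ
  · simp [schedSpeed_of_isResting hκ hℓ h, h]
  · simp [schedSpeed_of_not_isResting h, h, hκ]

theorem schedSpeed_nonneg (τ : ℝ) : 0 ≤ schedSpeed W κ ℓ τ := by
  by_cases h : IsResting W κ ℓ τ
  · rw [schedSpeed_of_isResting hκ hℓ h]
  · rw [schedSpeed_of_not_isResting h]; exact hκ.le

omit hκ hℓ in
theorem measurable_schedSpeed : Measurable (schedSpeed W κ ℓ) :=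
  measurable_const.mul (measurable_const.sub (Finset.measurable_sum _ fun _ _ =>
    measurable_one.indicator measurableSet_Ico))

theorem isClock_sched (hW : ∀ w ∈ W, 0 ≤ w) {L : ℝ} (hL : 0 ≤ L) :
    IsClock (schedSpeed W κ ℓ) (schedClock W κ ℓ) L where
  length_nonneg := hL
  integrable := by
    refine Integrable.const_mul (Integrable.sub (integrable_const 1) ?_) κ
    exact integrable_finsetSum _ fun w _ => integrableOn_indicator_one measurableSet_Ico L
  nonneg := Eventually.of_forall (schedSpeed_nonneg hκ hℓ)
  eq_integral := by
    intro τ hτ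
    have h0 : ∀ w ∈ W, IntervalIntegrable ((Ico (startTime W κ ℓ w)
        (startTime W κ ℓ w + ℓ)).indicator (1 : ℝ → ℝ)) volume 0 τ := fun w _ =>
      intervalIntegrable_of_integrableOn_Icc (integrableOn_indicator_one measurableSet_Ico L)
        ⟨le_rfl, hL⟩ hτ
    simp only [schedSpeed, schedClock]
    rw [intervalIntegral.integral_const_mul, intervalIntegral.integral_sub,
      intervalIntegral.integral_finsetSum h0]
    · rw [intervalIntegral.integral_const, smul_eq_mul, mul_one, sub_zero]
      congr 2
      exact Finset.sum_congr rfl fun w hw =>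
        (integral_indicator_Ico (startTime_nonneg hκ hℓ (hW w hw)) hτ.1).symm
    · exact intervalIntegrable_const
    · exact intervalIntegrable_of_integrableOn_Icc (integrable_finsetSum _ fun w _ =>
        integrableOn_indicator_one measurableSet_Ico L) ⟨le_rfl, hL⟩ hτ

/-- Take `x ≥ τ` below the start of the rest at `w` and so close to it that all earlier rests are
over. The clock value at `x` is then explicit and below `w`; monotonicity brings this back to `τ`.
-/
theorem clock_lt_of_lt_startTime (hW : ∀ w ∈ W, 0 ≤ w) {w τ : ℝ} (hτ : 0 ≤ τ)
    (h : τ < startTime W κ ℓ w) : schedClock W κ ℓ τ < w := by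
  have h1 : ∀ᶠ x in 𝓝[<] (startTime W κ ℓ w), τ < x ∧ x < startTime W κ ℓ w ∧
      ∀ w' ∈ W.filter (· < w), startTime W κ ℓ w' + ℓ < x := by
    refine (eventually_nhdsWithin_of_eventually_nhds (lt_mem_nhds h)).and
      (eventually_mem_nhdsWithin.and ?_)
    rw [Filter.eventually_all_finset]
    intro w' hw'
    exact eventually_nhdsWithin_of_eventually_nhds (lt_mem_nhds
      (startTime_add_lt hκ hℓ (Finset.mem_filter.1 hw').1 (Finset.mem_filter.1 hw').2))
  obtain ⟨x, hx1, hx2, hx3⟩ := h1.exists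
  have h2 : schedClock W κ ℓ x < w := by
    have h3 : ∀ w' ∈ W, ramp (startTime W κ ℓ w') ℓ x = if w' < w then ℓ else 0 := by
      intro w' hw'
      by_cases hlt : w' < w
      · rw [if_pos hlt, ramp_of_ge hℓ.le (hx3 w' (Finset.mem_filter.2 ⟨hw', hlt⟩)).le]
      · rw [if_neg hlt, ramp_of_le (hx2.le.trans (startTime_le hκ hℓ (not_lt.1 hlt)))]
    rw [schedClock, Finset.sum_congr rfl h3, ← Finset.sum_filter, Finset.sum_const, nsmul_eq_mul]
    rw [startTime, ← sub_lt_iff_lt_add] at hx2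
    have := mul_lt_mul_of_pos_left hx2 hκ
    rw [mul_div_cancel₀ _ hκ.ne'] at this
    linarith
  exact ((isClock_sched hκ hℓ hW (hτ.trans hx1.le)).monotoneOn ⟨hτ, hx1.le⟩
    ⟨hτ.trans hx1.le, le_rfl⟩ hx1.le).trans_lt h2

/-- When the clock runs, the rests at the earlier `w ∈ W` are completed. -/
theorem rest_completed (hW : ∀ w ∈ W, 0 ≤ w) {w τ : ℝ} (hw : w ∈ W) (hτ : 0 ≤ τ)
    (hr : ¬ IsResting W κ ℓ τ) (h : w ≤ schedClock W κ ℓ τ) : startTime W κ ℓ w + ℓ ≤ τ := by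
  by_contra hcon
  refine hr ⟨w, hw, ?_, not_le.1 hcon⟩
  by_contra h1
  exact absurd h (not_le.2 (clock_lt_of_lt_startTime hκ hℓ hW hτ (not_le.1 h1)))

/-- The rest intervals are half-open on the right; so even an impact at time `T`, whose rest ends
exactly at the horizon, is completed there. -/
theorem not_isResting_end {T : ℝ} (hW : ∀ w ∈ W, w ≤ T) :
    ¬ IsResting W κ ℓ (T / κ + ℓ * W.card) := fun ⟨w, hw, hτ⟩ =>
  absurd hτ.2 (not_lt.2 (startTime_add_le_end hκ hℓ hw (hW w hw)))

omit hκ hℓ in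
theorem exists_schedule (W : Finset ℝ) {T L : ℝ} (hT : 0 < T) (hL : 0 < L) :
    ∃ κ ℓ : ℝ, 0 < κ ∧ 0 < ℓ ∧ T / κ + ℓ * W.card = L := by
  have hK : (0 : ℝ) ≤ W.card := Nat.cast_nonneg _
  have h1 : 0 < L - L / (2 * (W.card + 1)) * W.card := by
    have : L - L / (2 * (W.card + 1)) * W.card = L * ((W.card + 2) / (2 * (W.card + 1))) := by
      field_simp; ring
    rw [this]; positivity
  -- The rests together take less than half of `L`; the speed is chosen so that the clock covers `T`
  -- in the remaining time.
  refine ⟨T / (L - L / (2 * (W.card + 1)) * W.card), L / (2 * (W.card + 1)), div_pos hT h1,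
    by positivity, ?_⟩
  rw [div_div_cancel₀ hT.ne']; ring

end Schedule

/-! ### Multipliers that realize given contact forces -/

/-- Step functions that realize the contact forces `lN`, `lT` at switching values `c`. -/
noncomputable def contactStep (aN μ : ℝ) (c : Fin 3 → ℝ) (lN lT : ℝ) : Fin 3 → ℝ :=
  ![if 0 < c 0 then 1 else 0,
    if 0 < c 0 then (if 0 < c 1 then 1 else 0) else aN / (aN + lN),
    if 0 < c 2 then 1 else if c 2 < 0 then 0 else (1 - lT / (μ * lN)) / 2]

theorem measurable_contactStep (aN μ : ℝ) :
    Measurable fun p : (Fin 3 → ℝ) × ℝ × ℝ => contactStep aN μ p.1 p.2.1 p.2.2 := by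
  have hc : ∀ i, Measurable fun p : (Fin 3 → ℝ) × ℝ × ℝ => p.1 i := fun i =>
    (measurable_pi_apply i).comp measurable_fst
  have hN : Measurable fun p : (Fin 3 → ℝ) × ℝ × ℝ => p.2.1 := measurable_snd.fst
  have hT : Measurable fun p : (Fin 3 → ℝ) × ℝ × ℝ => p.2.2 := measurable_snd.snd
  have hp : ∀ i, MeasurableSet {p : (Fin 3 → ℝ) × ℝ × ℝ | 0 < p.1 i} := fun i =>
    measurableSet_lt measurable_const (hc i)
  have hn : ∀ i, MeasurableSet {p : (Fin 3 → ℝ) × ℝ × ℝ | p.1 i < 0} := fun i =>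
    measurableSet_lt (hc i) measurable_const
  refine measurable_pi_lambda _ fun i => ?_
  fin_cases i
  · exact Measurable.ite (hp 0) measurable_const measurable_const
  · exact Measurable.ite (hp 0) (Measurable.ite (hp 1) measurable_const measurable_const)
      (measurable_const.div (measurable_const.add hN))
  · exact Measurable.ite (hp 2) measurable_const (Measurable.ite (hn 2) measurable_const
      ((measurable_const.sub (hT.div (measurable_const.mul hN))).div_const 2))

/-- The multipliers given by the step functions. -/
noncomputable def stepTheta (α : Fin 3 → ℝ) : Fin 3 → ℝ :=
  ![α 0 + (1 - α 0) * α 1, (1 - α 0) * (1 - α 1) * α 2, (1 - α 0) * (1 - α 1) * (1 - α 2)]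

theorem gF_stepTheta (α : Fin 3 → ℝ) : gF (stepTheta α) α = 0 := by
  ext i
  fin_cases i <;> simp [gF, stepTheta]

theorem continuous_stepTheta : Continuous stepTheta := by
  refine continuous_pi fun i => ?_
  fin_cases i
  · change Continuous fun α : Fin 3 → ℝ => α 0 + (1 - α 0) * α 1
    fun_prop
  · change Continuous fun α : Fin 3 → ℝ => (1 - α 0) * (1 - α 1) * α 2
    fun_prop
  · change Continuous fun α : Fin 3 → ℝ => (1 - α 0) * (1 - α 1) * (1 - α 2)
    fun_prop

section ContactStep

variable {aN μ lN lT : ℝ} {c : Fin 3 → ℝ} (haN : 0 < aN) (hμ : 0 < μ) (hN : 0 ≤ lN)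
  (hT : |lT| ≤ μ * lN)
include haN hμ hN hT

/-- In persistent contact gap and normal velocity both vanish, so the first two step values are free
in `[0, 1]`. The choice `0` and `aN / (aN + lN)` gives `θ 0 = aN / (aN + lN)`, that is `aN * (1 - θ
0) / θ 0 = lN`. At zero slip the third value, free as well, encodes the ratio of `lT` to its bound;
for `lN = 0` the quotient is zero by convention and the value is `1 / 2`. -/
theorem isStep_contactStep (h0 : 0 ≤ c 0) (h1 : c 0 = 0 → c 1 = 0) :
    IsStep c (contactStep aN μ c lN lT) := by
  have hfrac : 0 ≤ aN / (aN + lN) ∧ aN / (aN + lN) ≤ 1 :=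
    ⟨by positivity, (div_le_one (by positivity)).2 (by linarith)⟩
  have hr : |lT / (μ * lN)| ≤ 1 := by
    rw [abs_div, abs_of_nonneg (mul_nonneg hμ.le hN)]
    exact div_le_one_of_le₀ hT (mul_nonneg hμ.le hN)
  rw [abs_le] at hr
  have hz : ¬ 0 < c 0 → c 1 = 0 := fun h => h1 (le_antisymm (not_lt.1 h) h0)
  constructor <;> intro i <;> fin_cases i <;>
    simp only [contactStep, Fin.zero_eta, Fin.mk_one, Fin.reduceFinMk, Matrix.cons_val_zero,
      Matrix.cons_val_one, Matrix.cons_val] <;> split_ifs <;> grind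

omit haN hμ hN hT in
theorem contactStep_theta_of_pos (h0 : 0 < c 0) :
    stepTheta (contactStep aN μ c lN lT) 0 = 1 ∧ stepTheta (contactStep aN μ c lN lT) 1 = 0 ∧
      stepTheta (contactStep aN μ c lN lT) 2 = 0 := by
  simp [stepTheta, contactStep, h0]

/-- The multipliers reproduce the contact forces. -/
theorem contactStep_theta_of_contact (h0 : ¬ 0 < c 0) (hp : 0 < c 2 → lT = -(μ * lN))
    (hn : c 2 < 0 → lT = μ * lN) :
    (1 + lN / aN) * stepTheta (contactStep aN μ c lN lT) 0 = 1 ∧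
      (1 + lN / aN) * (stepTheta (contactStep aN μ c lN lT) 2 -
        stepTheta (contactStep aN μ c lN lT) 1) = lT / (μ * aN) := by
  have hs : 0 < aN + lN := by linarith
  constructor
  · simp only [stepTheta, contactStep, if_neg h0, Matrix.cons_val_zero, Matrix.cons_val_one]
    field_simp
    ring
  · have h1 : (1 + lN / aN) * (1 - aN / (aN + lN)) = lN / aN := by field_simp; ring
    have h2 : ∀ β : ℝ, (1 + lN / aN) * ((1 - 0) * (1 - aN / (aN + lN)) * (1 - β) -
        (1 - 0) * (1 - aN / (aN + lN)) * β) = lN / aN * (1 - 2 * β) := fun β => by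
      linear_combination (1 - 2 * β) * h1
    simp only [stepTheta, contactStep, if_neg h0, Matrix.cons_val_zero, Matrix.cons_val_one,
      Matrix.cons_val]
    rw [h2]
    split_ifs with h3 h4
    · rw [hp h3]; field_simp; ring
    · rw [hn h4]; field_simp; ring
    · rcases hN.eq_or_lt with h5 | h5
      · rw [← h5, mul_zero] at hT
        have : lT = 0 := abs_nonpos_iff.1 hT
        rw [this, ← h5]; simp
      · field_simp; ring

end ContactStep

/-! ### Properties of solutions of the complementarity system -/

namespace OCP

variable {n m ng nr : ℕ} {O : OCP n m ng nr}

namespace IsCLSSolution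

variable {P : CLSProcess n m} (h : O.IsCLSSolution P)
include h

theorem v_int : IntegrableOn P.v (Icc 0 O.T) := by
  have h1 : ContinuousOn (fun t => O.v₀ + ∫ w in (0 : ℝ)..t, O.accel P w) (Icc 0 O.T) :=
    continuousOn_of_eq_integral (y₀ := O.v₀) h.accel_int fun _ _ => rfl
  have h2 : IntegrableOn (fun t => ∑ w ∈ P.impacts, (Ici w).indicator (fun _ => O.jump P w) t)
      (Icc 0 O.T) :=
    integrable_finsetSum _ fun w _ => Integrable.indicator (integrable_const _) measurableSet_Ici
  refine ((h1.integrableOn_compact isCompact_Icc).add h2).congr ?_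
  filter_upwards [ae_restrict_mem measurableSet_Icc] with t ht
  rw [h.v_eq t ht, Finset.sum_filter]
  rfl

/-- The position is absolutely continuous, so the gap has derivative zero at almost every time of
contact. This frees the second step function there. -/
theorem ae_normalVel_eq_zero : ∀ᵐ t ∂(volume.restrict (Icc 0 O.T)),
    O.sys.fc (P.q t) = 0 → O.sys.normalVel (P.q t) (P.v t) = 0 := by
  refine ae_hasDerivAt_eq_zero_of_eq_zero ?_
  filter_upwards [ae_hasDerivAt_of_eq_integral h.v_int h.q_eq] with t ht
  exact O.sys.hasDerivAt_fc_comp ht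

theorem impacts_nonneg : ∀ w ∈ P.impacts, 0 ≤ w := fun w hw => ((h.impact_iff w).1 hw).1.1

theorem impacts_le : ∀ w ∈ P.impacts, w ≤ O.T := fun w hw => ((h.impact_iff w).1 hw).1.2

omit h in
theorem jump_eq {w : ℝ} (hw : w ∈ P.impacts) :
    O.jump P w = O.sys.contact (P.q w) (P.impN w) (P.impT w) := if_pos hw

omit h in
theorem preVel_add_jump (w : ℝ) : O.preVel P w + O.jump P w = P.v w := sub_add_cancel _ _

theorem fc_impact {w : ℝ} (hw : w ∈ P.impacts) : O.sys.fc (P.q w) = 0 :=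
  ((h.impact_iff w).1 hw).2.1

/-- Without a normal impulse the normal velocity would stay negative instead of becoming zero.
Positivity keeps the speed of time positive during the rest. -/
theorem impN_pos {w : ℝ} (hw : w ∈ P.impacts) : 0 < P.impN w := by
  refine (h.impN_nonneg w hw).lt_of_ne fun h0 => ?_
  have h1 := ((h.impact_iff w).1 hw).2.2
  have h2 := h.impact_law w hw
  rw [← preVel_add_jump, jump_eq hw, CLS.normalVel_add,
    O.sys.normalVel_contact (h.fc_impact hw), ← h0, zero_mul, add_zero] at h2
  exact h1.ne h2

theorem not_impacting {t : ℝ} (ht : t ∈ Icc 0 O.T) : ¬ O.sys.Impacting (P.q t) (P.v t) := by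
  intro hI
  by_cases hW : t ∈ P.impacts
  · exact hI.2.ne (h.impact_law t hW)
  · refine hW ((h.impact_iff t).2 ⟨ht, ?_⟩)
    rwa [preVel, jump, if_neg hW, sub_zero]

end IsCLSSolution

variable (O) in
/-- Share of the rest at the impact `w` during which the tangential velocity is reduced. -/
noncomputable def slipRatio (P : CLSProcess n m) (w : ℝ) : ℝ :=
  |P.impT w| / (O.sys.μ * P.impN w)

/-- Direction of the tangential impulse. -/
noncomputable def slipSign (P : CLSProcess n m) (w : ℝ) : ℝ := if 0 < P.impT w then 1 else -1

namespace IsCLSSolution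

variable {P : CLSProcess n m} (h : O.IsCLSSolution P)
include h

theorem slipRatio_nonneg {w : ℝ} (hw : w ∈ P.impacts) : 0 ≤ O.slipRatio P w :=
  div_nonneg (abs_nonneg _) (mul_nonneg O.sys.μ_pos.le (h.impN_pos hw).le)

theorem slipRatio_le_one {w : ℝ} (hw : w ∈ P.impacts) : O.slipRatio P w ≤ 1 :=
  div_le_one_of_le₀ (h.impact_friction w hw).1 (mul_nonneg O.sys.μ_pos.le (h.impN_pos hw).le)

/-- Friction at the full rate during the share `slipRatio` of the rest delivers exactly the
tangential impulse. A zero impulse gets the sign `-1`, but its share is zero. -/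
theorem slip_eq {w : ℝ} (hw : w ∈ P.impacts) :
    slipSign P w * (O.sys.μ * P.impN w) * O.slipRatio P w = P.impT w := by
  have h1 := (mul_pos O.sys.μ_pos (h.impN_pos hw)).ne'
  rw [slipRatio, mul_assoc, mul_div_cancel₀ _ h1, slipSign]
  split_ifs with h2
  · rw [abs_of_pos h2, one_mul]
  · rw [abs_of_nonpos (not_lt.1 h2)]; ring

end IsCLSSolution

end OCP

/-! ### From solutions of the complementarity system to time-freezing trajectories -/

namespace OCP

variable {n m ng nr : ℕ} (O : OCP n m ng nr)

/-- Velocity in numerical time: at an impact, the impulse is applied during the rest of the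
clock, the tangential one in the first part of it. -/
noncomputable def tfVel (P : CLSProcess n m) (κ ℓ τ : ℝ) : Vec n :=
  O.v₀ + (∫ w in (0 : ℝ)..schedClock P.impacts κ ℓ τ, O.accel P w) +
    ∑ w ∈ P.impacts, O.sys.contact (P.q w)
      (P.impN w / ℓ * ramp (startTime P.impacts κ ℓ w) ℓ τ)
      (slipSign P w * (O.sys.μ * P.impN w) / ℓ *
        ramp (startTime P.impacts κ ℓ w) (O.slipRatio P w * ℓ) τ)

/-- Velocity change of `tfVel` during the rests. -/
noncomputable def restAccel (P : CLSProcess n m) (κ ℓ τ : ℝ) : Vec n :=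
  ∑ w ∈ P.impacts, O.sys.contact (P.q w)
      (P.impN w / ℓ * (Ico (startTime P.impacts κ ℓ w)
        (startTime P.impacts κ ℓ w + ℓ)).indicator (1 : ℝ → ℝ) τ)
      (slipSign P w * (O.sys.μ * P.impN w) / ℓ * (Ico (startTime P.impacts κ ℓ w)
        (startTime P.impacts κ ℓ w + O.slipRatio P w * ℓ)).indicator (1 : ℝ → ℝ) τ)

/-- Extended state in numerical time. -/
noncomputable def tfState (P : CLSProcess n m) (κ ℓ τ : ℝ) : ExtState n :=
  (P.q (schedClock P.impacts κ ℓ τ), O.tfVel P κ ℓ τ, schedClock P.impacts κ ℓ τ)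

/-- The step function of the tangential velocity during the rests. -/
noncomputable def restStep (P : CLSProcess n m) (κ ℓ τ : ℝ) : ℝ :=
  ∑ w ∈ P.impacts, ((Ico (startTime P.impacts κ ℓ w)
        (startTime P.impacts κ ℓ w + O.slipRatio P w * ℓ)).indicator
          (fun _ => if 0 < P.impT w then (0 : ℝ) else 1) τ +
      (Ico (startTime P.impacts κ ℓ w + O.slipRatio P w * ℓ)
        (startTime P.impacts κ ℓ w + ℓ)).indicator (fun _ => (1 / 2 : ℝ)) τ)

/-- Step functions in numerical time. -/
noncomputable def tfAlpha (aN : ℝ) (P : CLSProcess n m) (κ ℓ τ : ℝ) : Fin 3 → ℝ :=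
  if 0 < schedSpeed P.impacts κ ℓ τ then
    contactStep aN O.sys.μ (O.sys.switching (O.tfState P κ ℓ τ))
      (P.lamN (schedClock P.impacts κ ℓ τ)) (P.lamT (schedClock P.impacts κ ℓ τ))
  else ![0, 0, O.restStep P κ ℓ τ]

/-- The time-freezing process that follows `P`. -/
noncomputable def toTF (aN : ℝ) (P : CLSProcess n m) (κ ℓ : ℝ) (uhat : ℝ → Vec m) :
    TFProcess n m where
  y := O.tfState P κ ℓ
  θ τ := stepTheta (O.tfAlpha aN P κ ℓ τ)
  α := O.tfAlpha aN P κ ℓ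
  lamP τ i := max (O.sys.switching (O.tfState P κ ℓ τ) i) 0
  lamM τ i := max (-O.sys.switching (O.tfState P κ ℓ τ) i) 0
  u := extendControl P.u (schedClock P.impacts κ ℓ) uhat
  s τ := schedSpeed P.impacts κ ℓ τ * (1 + |P.lamN (schedClock P.impacts κ ℓ τ)| / aN) +
    ∑ w ∈ P.impacts, P.impN w / (aN * ℓ) * (Ico (startTime P.impacts κ ℓ w)
        (startTime P.impacts κ ℓ w + ℓ)).indicator (1 : ℝ → ℝ) τ

namespace IsCLSSolution

variable {O} {P : CLSProcess n m} (h : O.IsCLSSolution P) {aN κ ℓ L : ℝ} (haN : 0 < aN)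
  (hκ : 0 < κ) (hℓ : 0 < ℓ) (hL : 0 ≤ L) (hend : schedClock P.impacts κ ℓ L = O.T)
include h hκ hℓ

theorem isClock (hL : 0 ≤ L) : IsClock (schedSpeed P.impacts κ ℓ) (schedClock P.impacts κ ℓ) L :=
  isClock_sched hκ hℓ h.impacts_nonneg hL

omit hκ in
theorem ramp_completed {w τ : ℝ} (hw : w ∈ P.impacts)
    (hτ : startTime P.impacts κ ℓ w + ℓ ≤ τ) :
    O.sys.contact (P.q w)
      (P.impN w / ℓ * ramp (startTime P.impacts κ ℓ w) ℓ τ)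
      (slipSign P w * (O.sys.μ * P.impN w) / ℓ *
        ramp (startTime P.impacts κ ℓ w) (O.slipRatio P w * ℓ) τ) = O.jump P w := by
  have h1 : O.slipRatio P w * ℓ ≤ ℓ := mul_le_of_le_one_left hℓ.le (h.slipRatio_le_one hw)
  rw [ramp_of_ge hℓ.le hτ, ramp_of_ge (mul_nonneg (h.slipRatio_nonneg hw) hℓ.le) (by linarith),
    jump_eq hw, ← h.slip_eq hw]
  congr 1 <;> field_simp

omit h hκ hℓ in
theorem ramp_pending {w τ : ℝ} (hτ : τ ≤ startTime P.impacts κ ℓ w) :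
    O.sys.contact (P.q w)
      (P.impN w / ℓ * ramp (startTime P.impacts κ ℓ w) ℓ τ)
      (slipSign P w * (O.sys.μ * P.impN w) / ℓ *
        ramp (startTime P.impacts κ ℓ w) (O.slipRatio P w * ℓ) τ) = 0 := by
  rw [ramp_of_le hτ, ramp_of_le hτ, mul_zero, mul_zero, CLS.contact_zero]

include hL hend in
theorem clock_mem {τ : ℝ} (hτ : τ ∈ Icc 0 L) : schedClock P.impacts κ ℓ τ ∈ Icc 0 O.T := by
  rw [← hend]; exact (h.isClock hκ hℓ hL).mapsTo hτ

-- When the clock runs, rests at impacts up to the shown time are complete and later ones have not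
-- begun, so the ramps add up to the velocity jumps so far.
include hL hend in
theorem tfVel_running {τ : ℝ} (hτ : τ ∈ Icc 0 L) (hr : ¬ IsResting P.impacts κ ℓ τ) :
    O.tfVel P κ ℓ τ = P.v (schedClock P.impacts κ ℓ τ) := by
  rw [h.v_eq _ (h.clock_mem hκ hℓ hL hend hτ), tfVel, Finset.sum_filter]
  congr 1
  refine Finset.sum_congr rfl fun w hw => ?_
  by_cases hwc : w ≤ schedClock P.impacts κ ℓ τ
  · rw [if_pos hwc, h.ramp_completed hℓ hw
      (rest_completed hκ hℓ h.impacts_nonneg hw hτ.1 hr hwc)]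
  · rw [if_neg hwc, ramp_pending]
    by_contra h1
    have := (h.isClock hκ hℓ hτ.1).monotoneOn
      ⟨startTime_nonneg hκ hℓ (h.impacts_nonneg w hw), (not_le.1 h1).le⟩ ⟨hτ.1, le_rfl⟩
      (not_le.1 h1).le
    rw [schedClock_startTime hκ hℓ] at this
    exact hwc this

/-- The velocity is expressed from the post-impact value backwards, since the impact law and maximum
dissipation concern that value. -/
theorem tfVel_resting {w τ : ℝ} (hw : w ∈ P.impacts)
    (hτ : τ ∈ Ico (startTime P.impacts κ ℓ w) (startTime P.impacts κ ℓ w + ℓ)) :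
    O.tfVel P κ ℓ τ = P.v w + O.sys.contact (P.q w)
      (P.impN w / ℓ * (τ - startTime P.impacts κ ℓ w) - P.impN w)
      (slipSign P w * (O.sys.μ * P.impN w) / ℓ *
        ramp (startTime P.impacts κ ℓ w) (O.slipRatio P w * ℓ) τ - P.impT w) := by
  rw [CLS.contact_sub, ← jump_eq hw, h.v_eq w ((h.impact_iff w).1 hw).1, tfVel,
    IsResting.eq_clock hκ hℓ hw hτ, Finset.sum_filter]
  rw [← Finset.add_sum_erase _ _ hw, ← Finset.add_sum_erase (s := P.impacts)
    (f := fun a => if a ≤ w then O.jump P a else 0) (a := w) hw, if_pos le_rfl,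
    ramp_of_mem (Ico_subset_Icc_self hτ)]
  have h1 : ∀ x ∈ P.impacts.erase w, O.sys.contact (P.q x)
      (P.impN x / ℓ * ramp (startTime P.impacts κ ℓ x) ℓ τ)
      (slipSign P x * (O.sys.μ * P.impN x) / ℓ *
        ramp (startTime P.impacts κ ℓ x) (O.slipRatio P x * ℓ) τ) =
      if x ≤ w then O.jump P x else 0 := by
    intro x hx
    obtain ⟨hne, hx'⟩ := Finset.mem_erase.1 hx
    by_cases hxw : x ≤ w
    · rw [if_pos hxw, h.ramp_completed hℓ hx'
        ((startTime_add_lt hκ hℓ hx' (hxw.lt_of_ne hne)).le.trans hτ.1)]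
    · rw [if_neg hxw, ramp_pending
        (hτ.2.le.trans (startTime_add_lt hκ hℓ hw (not_le.1 hxw)).le)]
  rw [Finset.sum_congr rfl h1]
  abel

omit h hκ hℓ in
theorem restAccel_int : IntegrableOn (O.restAccel P κ ℓ) (Icc 0 L) := by
  unfold restAccel
  refine integrable_finsetSum _ fun w _ => ?_
  simp only [CLS.contact_eq]
  exact ((((integrableOn_indicator_one measurableSet_Ico L).const_mul _)).smul_const _).add
    ((((integrableOn_indicator_one measurableSet_Ico L).const_mul _)).smul_const _)

theorem integral_restAccel {τ : ℝ} (hτ : 0 ≤ τ) :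
    ∫ σ in (0 : ℝ)..τ, O.restAccel P κ ℓ σ =
    ∑ w ∈ P.impacts, O.sys.contact (P.q w)
      (P.impN w / ℓ * ramp (startTime P.impacts κ ℓ w) ℓ τ)
      (slipSign P w * (O.sys.μ * P.impN w) / ℓ *
        ramp (startTime P.impacts κ ℓ w) (O.slipRatio P w * ℓ) τ) := by
  have hi : ∀ (a b : ℝ) (k : ℝ) (x : Vec n), IntervalIntegrable
      (fun σ => (k * (Ico a b).indicator (1 : ℝ → ℝ) σ) • x) volume 0 τ := fun a b k x =>
    intervalIntegrable_of_integrableOn_Icc (L := τ) (Integrable.smul_const (Integrable.const_mul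
      (integrableOn_indicator_one measurableSet_Ico τ) k) x) ⟨le_rfl, hτ⟩ ⟨hτ, le_rfl⟩
  simp only [restAccel, CLS.contact_eq]
  rw [intervalIntegral.integral_finsetSum fun w _ => (hi _ _ _ _).add (hi _ _ _ _)]
  refine Finset.sum_congr rfl fun w hw => ?_
  have h0 := startTime_nonneg (W := P.impacts) hκ hℓ (h.impacts_nonneg w hw)
  rw [intervalIntegral.integral_add (hi _ _ _ _) (hi _ _ _ _),
    intervalIntegral.integral_smul_const, intervalIntegral.integral_smul_const,
    intervalIntegral.integral_const_mul, intervalIntegral.integral_const_mul,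
    integral_indicator_Ico h0 hτ, integral_indicator_Ico h0 hτ]

omit h hκ in
theorem restAccel_running {τ : ℝ} (hr : ¬ IsResting P.impacts κ ℓ τ)
    (hρ : ∀ w ∈ P.impacts, O.slipRatio P w ≤ 1) : O.restAccel P κ ℓ τ = 0 := by
  refine Finset.sum_eq_zero fun w hw => ?_
  have h1 : O.slipRatio P w * ℓ ≤ ℓ := mul_le_of_le_one_left hℓ.le (hρ w hw)
  rw [indicator_of_notMem fun hτ => hr ⟨w, hw, hτ⟩, indicator_of_notMem fun hτ =>
    hr ⟨w, hw, hτ.1, hτ.2.trans_le (by linarith)⟩, mul_zero, mul_zero, CLS.contact_zero]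

theorem notMem_of_ne {w x τ : ℝ} (hw : w ∈ P.impacts)
    (hτ : τ ∈ Ico (startTime P.impacts κ ℓ w) (startTime P.impacts κ ℓ w + ℓ))
    (hx : x ∈ P.impacts) (hne : x ≠ w) :
    τ ∉ Ico (startTime P.impacts κ ℓ x) (startTime P.impacts κ ℓ x + ℓ) ∧
    τ ∉ Ico (startTime P.impacts κ ℓ x) (startTime P.impacts κ ℓ x + O.slipRatio P x * ℓ) ∧
    τ ∉ Ico (startTime P.impacts κ ℓ x + O.slipRatio P x * ℓ) (startTime P.impacts κ ℓ x + ℓ) := by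
  have h0 : τ ∉ Ico (startTime P.impacts κ ℓ x) (startTime P.impacts κ ℓ x + ℓ) := fun h1 =>
    hne (by rw [← IsResting.eq_clock hκ hℓ hx h1, IsResting.eq_clock hκ hℓ hw hτ])
  have h1 : O.slipRatio P x * ℓ ≤ ℓ := mul_le_of_le_one_left hℓ.le (h.slipRatio_le_one hx)
  have h2 : 0 ≤ O.slipRatio P x * ℓ := mul_nonneg (h.slipRatio_nonneg hx) hℓ.le
  exact ⟨h0, fun h3 => h0 ⟨h3.1, h3.2.trans_le (by linarith)⟩,
    fun h3 => h0 ⟨le_trans (by linarith) h3.1, h3.2⟩⟩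

theorem restAccel_resting {w τ : ℝ} (hw : w ∈ P.impacts)
    (hτ : τ ∈ Ico (startTime P.impacts κ ℓ w) (startTime P.impacts κ ℓ w + ℓ)) :
    O.restAccel P κ ℓ τ = O.sys.contact (P.q w) (P.impN w / ℓ)
      (if τ < startTime P.impacts κ ℓ w + O.slipRatio P w * ℓ then
        slipSign P w * (O.sys.μ * P.impN w) / ℓ else 0) := by
  rw [restAccel, Finset.sum_eq_single_of_mem w hw, indicator_of_mem hτ, indicator_apply]
  · simp only [mem_Ico, hτ.1, true_and, Pi.one_apply, mul_one, mul_ite, mul_zero]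
  · intro x hx hne
    obtain ⟨h1, h2, -⟩ := h.notMem_of_ne hκ hℓ hw hτ hx hne
    rw [indicator_of_notMem h1, indicator_of_notMem h2, mul_zero, mul_zero, CLS.contact_zero]

theorem restStep_resting {w τ : ℝ} (hw : w ∈ P.impacts)
    (hτ : τ ∈ Ico (startTime P.impacts κ ℓ w) (startTime P.impacts κ ℓ w + ℓ)) :
    O.restStep P κ ℓ τ = if τ < startTime P.impacts κ ℓ w + O.slipRatio P w * ℓ then
        (if 0 < P.impT w then 0 else 1) else 1 / 2 := by
  rw [restStep, Finset.sum_eq_single_of_mem w hw, indicator_apply, indicator_apply]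
  · simp only [mem_Ico, hτ.1, hτ.2, true_and, and_true]
    by_cases h1 : τ < startTime P.impacts κ ℓ w + O.slipRatio P w * ℓ
    · rw [if_pos h1, if_pos h1, if_neg (not_le.2 h1), add_zero]
    · rw [if_neg h1, if_neg h1, if_pos (not_lt.1 h1), zero_add]
  · intro x hx hne
    obtain ⟨-, h2, h3⟩ := h.notMem_of_ne hκ hℓ hw hτ hx hne
    rw [indicator_of_notMem h2, indicator_of_notMem h3, add_zero]

/-- The switching values during a rest. -/
theorem isStep_resting {w τ : ℝ} (hw : w ∈ P.impacts)
    (hτ : τ ∈ Ico (startTime P.impacts κ ℓ w) (startTime P.impacts κ ℓ w + ℓ)) :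
    IsStep (O.sys.switching (O.tfState P κ ℓ τ)) ![0, 0, O.restStep P κ ℓ τ] := by
  have hfc := h.fc_impact hw
  have hN := h.impN_pos hw
  have hμN := mul_pos O.sys.μ_pos hN
  have hD := O.sys.normalInertia_pos hfc
  have hB := O.sys.tangentInertia_nonneg (P.q w)
  have hfr := h.impact_friction w hw
  have hslip := h.slip_eq hw
  have hq : (O.tfState P κ ℓ τ).1 = P.q w := by
    rw [tfState, IsResting.eq_clock hκ hℓ hw hτ]
  have hv : (O.tfState P κ ℓ τ).2.1 = _ := h.tfVel_resting hκ hℓ hw hτ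
  have hc0 : O.sys.switching (O.tfState P κ ℓ τ) 0 = 0 := by
    change O.sys.fc (O.tfState P κ ℓ τ).1 = 0
    rw [hq, hfc]
  have hc1 : O.sys.switching (O.tfState P κ ℓ τ) 1 ≤ 0 := by
    change O.sys.normalVel (O.tfState P κ ℓ τ).1 (O.tfState P κ ℓ τ).2.1 ≤ 0
    rw [hq, hv, CLS.normalVel_add, O.sys.normalVel_contact hfc, h.impact_law w hw, zero_add]
    refine mul_nonpos_of_nonpos_of_nonneg ?_ hD.le
    rw [sub_nonpos, div_mul_eq_mul_div, div_le_iff₀ hℓ]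
    have := hτ.2
    exact mul_le_mul_of_nonneg_left (by linarith) hN.le
  have hc2 : O.sys.switching (O.tfState P κ ℓ τ) 2 = O.sys.tangentVel (P.q w) (P.v w) +
      (slipSign P w * (O.sys.μ * P.impN w) / ℓ *
        ramp (startTime P.impacts κ ℓ w) (O.slipRatio P w * ℓ) τ - P.impT w) *
          O.sys.tangentInertia (P.q w) := by
    change O.sys.tangentVel (O.tfState P κ ℓ τ).1 (O.tfState P κ ℓ τ).2.1 = _
    rw [hq, hv, CLS.tangentVel_add, O.sys.tangentVel_contact hfc]
  have hβ := h.restStep_resting hκ hℓ hw hτ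
  have key : 0 ≤ O.restStep P κ ℓ τ ∧ O.restStep P κ ℓ τ ≤ 1 ∧
      (0 < O.sys.switching (O.tfState P κ ℓ τ) 2 → O.restStep P κ ℓ τ = 1) ∧
      (O.sys.switching (O.tfState P κ ℓ τ) 2 < 0 → O.restStep P κ ℓ τ = 0) := by
    have hρ := h.slipRatio_nonneg hw
    -- Slip phase: the missing part of the impulse has the sign of `impT`, and maximum dissipation
    -- prevents the final slip velocity from having that sign. Hence the slip velocity during this
    -- phase never points along the impulse, as the chosen step value requires.
    by_cases h1 : τ < startTime P.impacts κ ℓ w + O.slipRatio P w * ℓ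
    · rw [if_pos h1] at hβ
      rw [ramp_of_mem ⟨hτ.1, h1.le⟩] at hc2
      have hx : (τ - startTime P.impacts κ ℓ w) / ℓ ≤ O.slipRatio P w := by
        rw [div_le_iff₀ hℓ]; linarith
      have h2 : slipSign P w * (O.sys.μ * P.impN w) / ℓ * (τ - startTime P.impacts κ ℓ w) -
          P.impT w = slipSign P w * (O.sys.μ * P.impN w *
            ((τ - startTime P.impacts κ ℓ w) / ℓ - O.slipRatio P w)) := by
        rw [← hslip]; ring
      have h3 : O.sys.μ * P.impN w * ((τ - startTime P.impacts κ ℓ w) / ℓ - O.slipRatio P w) ≤ 0 :=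
        mul_nonpos_of_nonneg_of_nonpos hμN.le (sub_nonpos.2 hx)
      have hρ0 : P.impT w ≠ 0 := by
        intro h0
        rw [slipRatio, h0, abs_zero, zero_div, zero_mul, add_zero] at h1
        exact absurd hτ.1 (not_le.2 h1)
      rw [h2] at hc2
      by_cases hpos : 0 < P.impT w
      · rw [if_pos hpos] at hβ
        rw [slipSign, if_pos hpos, one_mul] at hc2
        have h4 : O.sys.tangentVel (P.q w) (P.v w) ≤ 0 := by
          by_contra h5
          have := hfr.eq_neg (not_le.1 h5)
          linarith
        have h5 := mul_nonpos_of_nonpos_of_nonneg h3 hB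
        rw [hβ]
        exact ⟨le_rfl, zero_le_one, fun h6 => absurd h6 (by linarith), fun _ => rfl⟩
      · rw [if_neg hpos] at hβ
        rw [slipSign, if_neg hpos] at hc2
        have hneg := lt_of_le_of_ne (not_lt.1 hpos) hρ0
        have h4 : 0 ≤ O.sys.tangentVel (P.q w) (P.v w) := by
          by_contra h5
          have := hfr.eq_pos (not_le.1 h5)
          linarith
        have h5 := mul_nonpos_of_nonpos_of_nonneg h3 hB
        rw [hβ]
        exact ⟨zero_le_one, le_rfl, fun _ => rfl, fun h6 => absurd h6 (by linarith)⟩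
    -- Stick phase: it occurs only if the tangential impulse lies strictly inside its bound, and
    -- then maximum dissipation forces the final slip velocity to be zero. Since the tangential
    -- impulse is already delivered, the slip velocity is zero now and the value `1 / 2`, which
    -- cancels friction, is admissible.
    · rw [if_neg h1] at hβ
      rw [ramp_of_ge (mul_nonneg hρ hℓ.le) (not_lt.1 h1)] at hc2
      have h2 : slipSign P w * (O.sys.μ * P.impN w) / ℓ * (O.slipRatio P w * ℓ) -
          P.impT w = 0 := by
        rw [← hslip]; field_simp; ring
      have h3 : O.slipRatio P w < 1 := by
        by_contra h4
        have := mul_le_mul_of_nonneg_right (not_lt.1 h4) hℓ.le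
        have := hτ.2
        linarith
      have h4 : |P.impT w| < O.sys.μ * P.impN w := (div_lt_one hμN).1 h3
      have h5 : O.sys.tangentVel (P.q w) (P.v w) = 0 := by
        rcases lt_trichotomy (O.sys.tangentVel (P.q w) (P.v w)) 0 with h6 | h6 | h6
        · rw [hfr.eq_pos h6, abs_of_pos hμN] at h4; exact absurd h4 (lt_irrefl _)
        · exact h6
        · rw [hfr.eq_neg h6, abs_neg, abs_of_pos hμN] at h4; exact absurd h4 (lt_irrefl _)
      rw [h2, h5, zero_mul, add_zero] at hc2
      rw [hβ, hc2]
      norm_num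
  obtain ⟨k1, k2, k3, k4⟩ := key
  constructor <;> intro i <;> fin_cases i
  · exact le_rfl
  · exact le_rfl
  · exact k1
  · exact zero_le_one
  · exact zero_le_one
  · exact k2
  · exact fun h1 => absurd h1 (by rw [Fin.zero_eta, hc0]; exact lt_irrefl _)
  · exact fun h1 => absurd h1 (not_lt.2 hc1)
  · exact k3
  · exact fun _ => rfl
  · exact fun _ => rfl
  · exact k4

end IsCLSSolution

end OCP

namespace OCP

variable {n m ng nr : ℕ} {O : OCP n m ng nr}

namespace IsCLSSolution

variable {P : CLSProcess n m} (h : O.IsCLSSolution P) {aN κ ℓ L : ℝ} (haN : 0 < aN)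
  (hκ : 0 < κ) (hℓ : 0 < ℓ) (hL : 0 ≤ L) (hend : schedClock P.impacts κ ℓ L = O.T)
include h hκ hℓ hL hend

/-- Right-hand side in numerical time. -/
theorem tfState_rhs_int : IntegrableOn (fun τ =>
    ((schedSpeed P.impacts κ ℓ τ • P.v (schedClock P.impacts κ ℓ τ),
      schedSpeed P.impacts κ ℓ τ • O.accel P (schedClock P.impacts κ ℓ τ) + O.restAccel P κ ℓ τ,
      schedSpeed P.impacts κ ℓ τ) : ExtState n)) (Icc 0 L) := by
  have hC := h.isClock hκ hℓ hL
  have h1 := hC.integrableOn_comp (f := P.v) (by rw [hend]; exact h.v_int)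
  have h2 := hC.integrableOn_comp (f := O.accel P) (by rw [hend]; exact h.accel_int)
  exact Integrable.prodMk h1 (Integrable.prodMk (Integrable.add h2 restAccel_int) hC.integrable)

theorem tfState_eq : ∀ τ ∈ Icc 0 L, O.tfState P κ ℓ τ = (O.q₀, O.v₀, 0) + ∫ w in (0 : ℝ)..τ,
    ((schedSpeed P.impacts κ ℓ w • P.v (schedClock P.impacts κ ℓ w),
      schedSpeed P.impacts κ ℓ w • O.accel P (schedClock P.impacts κ ℓ w) + O.restAccel P κ ℓ w,
      schedSpeed P.impacts κ ℓ w) : ExtState n) := by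
  intro τ hτ
  have hC := h.isClock hκ hℓ hL
  have h0 : (0 : ℝ) ∈ Icc 0 L := ⟨le_rfl, hL⟩
  have hint := intervalIntegrable_of_integrableOn_Icc
    (h.tfState_rhs_int hκ hℓ hL hend) h0 hτ
  have h1 := hC.integral_comp (f := P.v) (by rw [hend]; exact h.v_int) hτ
  have h2 := hC.integral_comp (f := O.accel P) (by rw [hend]; exact h.accel_int) hτ
  have h3 := intervalIntegrable_of_integrableOn_Icc
    (hC.integrableOn_comp (f := O.accel P) (by rw [hend]; exact h.accel_int)) h0 hτ
  ext1
  · rw [Prod.fst_add, fst_intervalIntegral hint]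
    change P.q _ = _ + ∫ w in (0 : ℝ)..τ, schedSpeed P.impacts κ ℓ w •
      P.v (schedClock P.impacts κ ℓ w)
    rw [h1, h.q_eq _ (h.clock_mem hκ hℓ hL hend hτ)]
  · rw [Prod.snd_add, snd_intervalIntegral hint]
    ext1
    · rw [Prod.fst_add, fst_intervalIntegral ⟨hint.1.snd, hint.2.snd⟩]
      change O.tfVel P κ ℓ τ = _ + ∫ w in (0 : ℝ)..τ, (schedSpeed P.impacts κ ℓ w •
        O.accel P (schedClock P.impacts κ ℓ w) + O.restAccel P κ ℓ w)
      rw [intervalIntegral.integral_add h3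
        (intervalIntegrable_of_integrableOn_Icc restAccel_int h0 hτ), h2,
        h.integral_restAccel hκ hℓ hτ.1, tfVel, add_assoc]
    · rw [Prod.snd_add, snd_intervalIntegral ⟨hint.1.snd, hint.2.snd⟩, zero_add]
      exact hC.eq_integral τ hτ

theorem continuousOn_tfState : ContinuousOn (O.tfState P κ ℓ) (Icc 0 L) :=
  continuousOn_of_eq_integral (h.tfState_rhs_int hκ hℓ hL hend) (h.tfState_eq hκ hℓ hL hend)

/-- Measurability of forces read through the clock needs the case distinction: nothing is known of
`f` at the single times where the clock rests. -/
theorem aemeasurable_running {β : Type*} [MeasurableSpace β] {f k : ℝ → β}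
    (hf : AEMeasurable f (volume.restrict (Icc 0 O.T)))
    (hk : AEMeasurable k (volume.restrict (Icc 0 L))) :
    AEMeasurable (fun τ => if 0 < schedSpeed P.impacts κ ℓ τ then
      f (schedClock P.impacts κ ℓ τ) else k τ) (volume.restrict (Icc 0 L)) := by
  classical
  rw [← hend] at hf
  have h1 := (h.isClock hκ hℓ hL).aemeasurable_ite (A := {τ | 0 < schedSpeed P.impacts κ ℓ τ}) hf hk
    (measurableSet_lt measurable_const measurable_schedSpeed) (Eventually.of_forall fun _ hτ => hτ)
  refine h1.congr (Eventually.of_forall fun τ => ?_)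
  by_cases hτ : 0 < schedSpeed P.impacts κ ℓ τ
  · exact (if_pos hτ).trans (if_pos hτ).symm
  · exact (if_neg hτ).trans (if_neg hτ).symm

theorem aemeasurable_tfAlpha :
    AEMeasurable (O.tfAlpha aN P κ ℓ) (volume.restrict (Icc 0 L)) := by
  have hN := h.aemeasurable_running hκ hℓ hL hend (k := fun _ => (0 : ℝ))
    h.lamN_int.aestronglyMeasurable.aemeasurable aemeasurable_const
  have hT := h.aemeasurable_running hκ hℓ hL hend (k := fun _ => (0 : ℝ))
    h.lamT_int.aestronglyMeasurable.aemeasurable aemeasurable_const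
  have hc : AEMeasurable (fun τ => O.sys.switching (O.tfState P κ ℓ τ))
      (volume.restrict (Icc 0 L)) :=
    (O.sys.continuousOn_switching (h.continuousOn_tfState hκ hℓ hL hend)).aemeasurable
      measurableSet_Icc
  have h1 := (measurable_contactStep aN O.sys.μ).comp_aemeasurable (hc.prodMk (hN.prodMk hT))
  have hr : Measurable (O.restStep P κ ℓ) := Finset.measurable_sum _ fun _ _ =>
    (measurable_const.indicator measurableSet_Ico).add
      (measurable_const.indicator measurableSet_Ico)
  have h2 : Measurable fun τ => (![0, 0, O.restStep P κ ℓ τ] : Fin 3 → ℝ) := by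
    refine measurable_pi_lambda _ fun i => ?_
    fin_cases i
    · exact measurable_const
    · exact measurable_const
    · exact hr
  obtain ⟨g, hg, hge⟩ := h1
  refine ⟨fun τ => if 0 < schedSpeed P.impacts κ ℓ τ then g τ else ![0, 0, O.restStep P κ ℓ τ],
    Measurable.ite (measurableSet_lt measurable_const measurable_schedSpeed) hg h2, ?_⟩
  filter_upwards [hge] with τ h3
  by_cases hτ : 0 < schedSpeed P.impacts κ ℓ τ
  · simp only [tfAlpha, if_pos hτ] at h3 ⊢
    rw [← h3]
    simp only [Function.comp, if_pos hτ]
  · simp only [tfAlpha, if_neg hτ]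

/-- Facts on the contact forces and switching values at almost every time when the clock runs. -/
theorem ae_running_forces : ∀ᵐ τ ∂(volume.restrict (Icc 0 L)), ¬ IsResting P.impacts κ ℓ τ →
    0 ≤ P.lamN (schedClock P.impacts κ ℓ τ) ∧
    P.lamN (schedClock P.impacts κ ℓ τ) * O.sys.switching (O.tfState P κ ℓ τ) 0 = 0 ∧
    O.sys.MaxDissipation (O.tfState P κ ℓ τ).1 (O.tfState P κ ℓ τ).2.1
      (P.lamN (schedClock P.impacts κ ℓ τ)) (P.lamT (schedClock P.impacts κ ℓ τ)) ∧
    0 ≤ O.sys.switching (O.tfState P κ ℓ τ) 0 ∧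
    (O.sys.switching (O.tfState P κ ℓ τ) 0 = 0 → O.sys.switching (O.tfState P κ ℓ τ) 1 = 0) := by
  have h1 := (h.complementarity.and h.friction).and h.ae_normalVel_eq_zero
  rw [← hend] at h1
  filter_upwards [(h.isClock hκ hℓ hL).ae_comp h1, ae_restrict_mem measurableSet_Icc]
    with τ h2 h3 h4
  obtain ⟨⟨h5, h6⟩, h7⟩ := h2 ((schedSpeed_pos_iff hκ hℓ).2 h4)
  have hv := h.tfVel_running hκ hℓ hL hend h3 h4
  refine ⟨h5.1, h5.2, ?_, h.gap_nonneg _ (h.clock_mem hκ hℓ hL hend h3), ?_⟩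
  · change O.sys.MaxDissipation _ (O.tfVel P κ ℓ τ) _ _
    rw [hv]; exact h6
  · change _ → O.sys.normalVel _ (O.tfVel P κ ℓ τ) = 0
    rw [hv]; exact h7

include haN

theorem ae_isStep_tfAlpha : ∀ᵐ τ ∂(volume.restrict (Icc 0 L)),
    IsStep (O.sys.switching (O.tfState P κ ℓ τ)) (O.tfAlpha aN P κ ℓ τ) := by
  filter_upwards [h.ae_running_forces hκ hℓ hL hend] with τ h1
  by_cases hr : IsResting P.impacts κ ℓ τ
  · rw [tfAlpha, if_neg (mt (schedSpeed_pos_iff hκ hℓ).1 (not_not.2 hr))]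
    obtain ⟨w, hw, hτ⟩ := hr
    exact h.isStep_resting hκ hℓ hw hτ
  · rw [tfAlpha, if_pos ((schedSpeed_pos_iff hκ hℓ).2 hr)]
    obtain ⟨hN, -, hT, h0, h00⟩ := h1 hr
    exact isStep_contactStep haN O.sys.μ_pos hN hT.1 h0 h00

/-- The speed of time is fitted to the multipliers. While the clock runs, `s = κ * (1 + lamN / aN)`
makes `s * θ 0 = κ` and the auxiliary modes contribute `κ` times the contact forces. During a rest,
`s = impN / (aN * ℓ)` delivers the normal impulse in time `ℓ`, and the step values `0`, `1`, `1 / 2`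
give full friction in either direction or none. -/
theorem ae_tfRhs_toTF (uhat : ℝ → Vec m) : ∀ᵐ τ ∂(volume.restrict (Icc 0 L)),
    O.tfRhs aN (O.toTF aN P κ ℓ uhat) τ =
    ((schedSpeed P.impacts κ ℓ τ • P.v (schedClock P.impacts κ ℓ τ),
      schedSpeed P.impacts κ ℓ τ • O.accel P (schedClock P.impacts κ ℓ τ) + O.restAccel P κ ℓ τ,
      schedSpeed P.impacts κ ℓ τ) : ExtState n) := by
  have hC := h.isClock hκ hℓ hL
  have hμ := O.sys.μ_pos
  filter_upwards [h.ae_running_forces hκ hℓ hL hend, ae_restrict_mem measurableSet_Icc,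
    ae_hasDerivAt_of_eq_integral hC.integrable hC.eq_integral'] with τ h1 hτL hder
  rw [tfRhs_eq]
  by_cases hr : IsResting P.impacts κ ℓ τ
  · have hsp := schedSpeed_of_isResting hκ hℓ hr
    have hα : O.tfAlpha aN P κ ℓ τ = ![0, 0, O.restStep P κ ℓ τ] := by
      rw [tfAlpha, if_neg (by rw [hsp]; exact lt_irrefl _)]
    obtain ⟨w, hw, hτ⟩ := hr
    have hs : (O.toTF aN P κ ℓ uhat).s τ = P.impN w / (aN * ℓ) := by
      change schedSpeed P.impacts κ ℓ τ * _ + _ = _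
      rw [hsp, zero_mul, zero_add, Finset.sum_eq_single_of_mem w hw, indicator_of_mem hτ,
        Pi.one_apply, mul_one]
      intro x hx hne
      rw [indicator_of_notMem (h.notMem_of_ne hκ hℓ hw hτ hx hne).1, mul_zero]
    have hθ0 : (O.toTF aN P κ ℓ uhat).θ τ 0 = 0 := by
      change stepTheta (O.tfAlpha aN P κ ℓ τ) 0 = 0
      rw [hα]; simp [stepTheta]
    have hθ1 : (O.toTF aN P κ ℓ uhat).θ τ 1 = O.restStep P κ ℓ τ := by
      change stepTheta (O.tfAlpha aN P κ ℓ τ) 1 = _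
      rw [hα]; simp [stepTheta]
    have hθ2 : (O.toTF aN P κ ℓ uhat).θ τ 2 = 1 - O.restStep P κ ℓ τ := by
      change stepTheta (O.tfAlpha aN P κ ℓ τ) 2 = _
      rw [hα]; simp [stepTheta]
    have hcs : (O.toTF aN P κ ℓ uhat).clockSpeed τ = 0 := by
      rw [TFProcess.clockSpeed, hθ0, mul_zero]
    have hq : (O.toTF aN P κ ℓ uhat).q τ = P.q w := by
      change P.q (schedClock P.impacts κ ℓ τ) = _
      rw [IsResting.eq_clock hκ hℓ hw hτ]
    rw [hcs, hsp, hq, hs, hθ1, hθ2, h.restAccel_resting hκ hℓ hw hτ,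
      h.restStep_resting hκ hℓ hw hτ]
    simp only [zero_smul, zero_add]
    congr 3
    · field_simp; ring
    · rw [slipSign]
      split_ifs
      · field_simp; ring
      · field_simp; ring
      · ring
  · have hsp := schedSpeed_of_not_isResting hr
    obtain ⟨hN, hcompl, hT, h0, -⟩ := h1 hr
    have hv := h.tfVel_running hκ hℓ hL hend hτL hr
    have hα : O.tfAlpha aN P κ ℓ τ = contactStep aN O.sys.μ
        (O.sys.switching (O.tfState P κ ℓ τ)) (P.lamN (schedClock P.impacts κ ℓ τ))
          (P.lamT (schedClock P.impacts κ ℓ τ)) := by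
      rw [tfAlpha, if_pos ((schedSpeed_pos_iff hκ hℓ).2 hr)]
    have hs : (O.toTF aN P κ ℓ uhat).s τ =
        κ * (1 + P.lamN (schedClock P.impacts κ ℓ τ) / aN) := by
      change schedSpeed P.impacts κ ℓ τ * _ + _ = _
      rw [hsp, sum_indicator_of_not_isResting hr, add_zero, abs_of_nonneg hN]
    have hu : (O.toTF aN P κ ℓ uhat).u τ = P.u (schedClock P.impacts κ ℓ τ) := by
      change extendControl P.u (schedClock P.impacts κ ℓ) uhat τ = _
      rw [extendControl, if_pos (by rw [hder.deriv, hsp]; exact hκ)]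
    have hθ : ∀ i, (O.toTF aN P κ ℓ uhat).θ τ i = stepTheta (contactStep aN O.sys.μ
        (O.sys.switching (O.tfState P κ ℓ τ)) (P.lamN (schedClock P.impacts κ ℓ τ))
          (P.lamT (schedClock P.impacts κ ℓ τ))) i := fun i => by
      change stepTheta (O.tfAlpha aN P κ ℓ τ) i = _
      rw [hα]
    have hsum : (O.toTF aN P κ ℓ uhat).θ τ 1 + (O.toTF aN P κ ℓ uhat).θ τ 2 =
        1 - (O.toTF aN P κ ℓ uhat).θ τ 0 :=
      IsStep.theta_sum (gF_stepTheta (O.tfAlpha aN P κ ℓ τ))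
    have hf : (1 + P.lamN (schedClock P.impacts κ ℓ τ) / aN) *
          (O.toTF aN P κ ℓ uhat).θ τ 0 = 1 ∧
        (1 + P.lamN (schedClock P.impacts κ ℓ τ) / aN) *
          ((O.toTF aN P κ ℓ uhat).θ τ 2 - (O.toTF aN P κ ℓ uhat).θ τ 1) =
            P.lamT (schedClock P.impacts κ ℓ τ) / (O.sys.μ * aN) := by
      rw [hθ, hθ, hθ]
      rcases h0.eq_or_lt with h2 | h2
      · exact contactStep_theta_of_contact haN hμ hN hT.1 (by rw [← h2]; exact lt_irrefl _)
          (fun h3 => hT.eq_neg h3) fun h3 => hT.eq_pos h3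
      · obtain ⟨e0, e1, e2⟩ := contactStep_theta_of_pos (aN := aN) (μ := O.sys.μ)
          (lN := P.lamN (schedClock P.impacts κ ℓ τ)) (lT := P.lamT (schedClock P.impacts κ ℓ τ)) h2
        have e3 : P.lamN (schedClock P.impacts κ ℓ τ) = 0 :=
          (mul_eq_zero.1 hcompl).resolve_right h2.ne'
        have e4 : P.lamT (schedClock P.impacts κ ℓ τ) = 0 := by
          have := hT.1
          rw [e3, mul_zero] at this
          exact abs_nonpos_iff.1 this
        rw [e0, e1, e2, e3, e4]
        simp
    have hcs : (O.toTF aN P κ ℓ uhat).clockSpeed τ = κ := by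
      rw [TFProcess.clockSpeed, hs, mul_assoc, hf.1, mul_one]
    have hvel : (O.toTF aN P κ ℓ uhat).v τ = P.v (schedClock P.impacts κ ℓ τ) := hv
    have hq : (O.toTF aN P κ ℓ uhat).q τ = P.q (schedClock P.impacts κ ℓ τ) := rfl
    rw [hcs, hsp, hu, hvel, hq, hsum, hs, restAccel_running hℓ hr fun w hw => h.slipRatio_le_one hw,
      add_zero, accel, smul_add, CLS.smul_contact]
    congr 4
    · have e : aN * (κ * (1 + P.lamN (schedClock P.impacts κ ℓ τ) / aN) *
          (1 - (O.toTF aN P κ ℓ uhat).θ τ 0)) = aN * κ * ((1 +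
            P.lamN (schedClock P.impacts κ ℓ τ) / aN) - (1 +
            P.lamN (schedClock P.impacts κ ℓ τ) / aN) * (O.toTF aN P κ ℓ uhat).θ τ 0) := by ring
      rw [e, hf.1]
      field_simp
      ring
    · rw [mul_assoc κ, hf.2]
      field_simp

theorem isTFTrajectory_toTF {uhat : ℝ → Vec m}
    (hu : AEMeasurable uhat (volume.restrict (Icc 0 L)))
    (hlast : ¬ IsResting P.impacts κ ℓ L) :
    O.IsTFTrajectory aN L (O.toTF aN P κ ℓ uhat) := by
  have hC := h.isClock hκ hℓ hL
  have hrhs := h.ae_tfRhs_toTF haN hκ hℓ hL hend uhat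
  have hstep := h.ae_isStep_tfAlpha haN hκ hℓ hL hend
  refine
    { u_meas := ?_, θ_meas := ?_, α_meas := ?_, s_int := ?_, s_pos := ?_, rhs_int := ?_,
      y_eq := ?_, multipliers := ?_, switching_eq := ?_, compl_lower := ?_, compl_upper := ?_,
      clock_end := ?_, finite_impacts := ?_, impact_completed := ?_ }
  · classical
    have hum := h.u_meas
    rw [← hend] at hum
    -- The control is switched by the derivative of the clock, which equals `schedSpeed` only almost
    -- everywhere.
    have h1 := hC.aemeasurable_ite (A := {τ | 0 < deriv (schedClock P.impacts κ ℓ) τ}) hum hu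
      (measurableSet_lt measurable_const (measurable_deriv _)) (by
        filter_upwards [ae_hasDerivAt_of_eq_integral hC.integrable hC.eq_integral'] with τ h2 h3
        change 0 < deriv _ _ at h3
        rwa [h2.deriv] at h3)
    refine h1.congr (Eventually.of_forall fun τ => ?_)
    change _ = extendControl P.u (schedClock P.impacts κ ℓ) uhat τ
    rw [extendControl]
    by_cases hτ : 0 < deriv (schedClock P.impacts κ ℓ) τ
    · exact (if_pos hτ).trans (if_pos hτ).symm
    · exact (if_neg hτ).trans (if_neg hτ).symm
  · exact continuous_stepTheta.measurable.comp_aemeasurable (h.aemeasurable_tfAlpha hκ hℓ hL hend)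
  · exact h.aemeasurable_tfAlpha hκ hℓ hL hend
  · have h1 : IntegrableOn (fun t => 1 + |P.lamN t| / aN)
        (Icc 0 (schedClock P.impacts κ ℓ L)) := by
      rw [hend]
      exact Integrable.add (integrable_const 1) (Integrable.div_const h.lamN_int.abs aN)
    exact Integrable.add (hC.integrableOn_comp h1) (integrable_finsetSum _ fun w _ =>
      Integrable.const_mul (integrableOn_indicator_one measurableSet_Ico L) _)
  · intro τ _
    change 0 < schedSpeed P.impacts κ ℓ τ * _ + _
    -- The absolute value secures positivity at every time, as `lamN` is nonnegative only almost
    -- everywhere.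
    have h1 : 0 < 1 + |P.lamN (schedClock P.impacts κ ℓ τ)| / aN := by positivity
    have h2 : ∀ w ∈ P.impacts, 0 ≤ P.impN w / (aN * ℓ) * (Ico (startTime P.impacts κ ℓ w)
        (startTime P.impacts κ ℓ w + ℓ)).indicator (1 : ℝ → ℝ) τ := fun w hw =>
      mul_nonneg (div_nonneg (h.impN_pos hw).le (mul_pos haN hℓ).le)
        (indicator_nonneg (fun _ _ => zero_le_one) _)
    by_cases hr : IsResting P.impacts κ ℓ τ
    · obtain ⟨w, hw, hτ⟩ := hr
      refine add_pos_of_nonneg_of_pos (mul_nonneg (schedSpeed_nonneg hκ hℓ τ) h1.le)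
        (Finset.sum_pos' h2 ⟨w, hw, ?_⟩)
      rw [indicator_of_mem hτ, Pi.one_apply, mul_one]
      exact div_pos (h.impN_pos hw) (mul_pos haN hℓ)
    · exact add_pos_of_pos_of_nonneg (mul_pos ((schedSpeed_pos_iff hκ hℓ).2 hr) h1)
        (Finset.sum_nonneg h2)
  · exact (h.tfState_rhs_int hκ hℓ hL hend).congr (hrhs.mono fun _ h1 => h1.symm)
  · intro τ hτ
    change O.tfState P κ ℓ τ = _
    rw [h.tfState_eq hκ hℓ hL hend τ hτ]
    congr 1
    refine intervalIntegral.integral_congr_ae_restrict ?_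
    rw [uIoc_of_le hτ.1]
    exact ae_restrict_of_ae_restrict_of_subset
      (Ioc_subset_Icc_self.trans (Icc_subset_Icc_right hτ.2)) (hrhs.mono fun _ h1 => h1.symm)
  · exact Eventually.of_forall fun τ => gF_stepTheta _
  · refine Eventually.of_forall fun τ => ?_
    ext i
    change O.sys.switching (O.tfState P κ ℓ τ) i - max (O.sys.switching (O.tfState P κ ℓ τ) i) 0 +
      max (-O.sys.switching (O.tfState P κ ℓ τ) i) 0 = 0
    rcases le_total 0 (O.sys.switching (O.tfState P κ ℓ τ) i) with h1 | h1
    · rw [max_eq_left h1, max_eq_right (neg_nonpos.2 h1)]; ring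
    · rw [max_eq_right h1, max_eq_left (neg_nonneg.2 h1)]; ring
  · exact hstep.mono fun _ h1 => h1.compl_lower
  · exact hstep.mono fun _ h1 => h1.compl_upper
  · exact hend
  · refine P.impacts.finite_toSet.subset ?_
    rintro _ ⟨τ, ⟨hτ, hI⟩, rfl⟩
    change schedClock P.impacts κ ℓ τ ∈ P.impacts
    -- A resting clock shows an impact time; a running one goes with a post-impact velocity, for
    -- which the state is never impacting.
    by_cases hr : IsResting P.impacts κ ℓ τ
    · exact ((isResting_iff hκ hℓ).1 hr).1
    · change O.sys.Impacting (P.q (schedClock P.impacts κ ℓ τ)) (O.tfVel P κ ℓ τ) at hI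
      rw [h.tfVel_running hκ hℓ hL hend hτ hr] at hI
      exact absurd hI (h.not_impacting (h.clock_mem hκ hℓ hL hend hτ))
  · intro hI
    change O.sys.Impacting (P.q (schedClock P.impacts κ ℓ L)) (O.tfVel P κ ℓ L) at hI
    have hLm : L ∈ Icc 0 L := ⟨hL, le_rfl⟩
    rw [h.tfVel_running hκ hℓ hL hend hLm hlast] at hI
    exact h.not_impacting (h.clock_mem hκ hℓ hL hend hLm) hI

omit haN in
theorem sameMotion_toTF (uhat : ℝ → Vec m) : SameMotion L P (O.toTF aN P κ ℓ uhat) := by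
  intro τ hτ hW
  refine ⟨rfl, ?_⟩
  exact (h.tfVel_running hκ hℓ hL hend hτ fun hr => hW ((isResting_iff hκ hℓ).1 hr).1).symm

end IsCLSSolution

end OCP

/-! ### Terminal states and transfer of feasibility -/

namespace OCP

variable {n m ng nr : ℕ} {O : OCP n m ng nr}

namespace IsCLSSolution

variable {P : CLSProcess n m} (h : O.IsCLSSolution P)
include h

theorem tendsto_q : Tendsto P.q (𝓝[<] O.T) (𝓝 (P.q O.T)) := by
  have h1 := continuousOn_of_eq_integral h.v_int h.q_eq O.T ⟨O.T_pos.le, le_rfl⟩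
  refine h1.mono_left ?_
  rw [← nhdsWithin_Ioo_eq_nhdsLT O.T_pos]
  exact nhdsWithin_mono _ Ioo_subset_Icc_self

/-- Shortly before `T` all earlier jumps have occurred, so only the jump at `T` itself is missing
from the limit. -/
theorem tendsto_v : Tendsto P.v (𝓝[<] O.T) (𝓝 (O.preVel P O.T)) := by
  have hT : O.T ∈ Icc 0 O.T := ⟨O.T_pos.le, le_rfl⟩
  have h1 : ContinuousOn (fun t => O.v₀ + ∫ w in (0 : ℝ)..t, O.accel P w) (Icc 0 O.T) :=
    continuousOn_of_eq_integral (y₀ := O.v₀) h.accel_int fun _ _ => rfl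
  have h2 : Tendsto (fun t => O.v₀ + ∫ w in (0 : ℝ)..t, O.accel P w) (𝓝[<] O.T)
      (𝓝 (O.v₀ + ∫ w in (0 : ℝ)..O.T, O.accel P w)) := by
    refine (h1 O.T hT).mono_left ?_
    rw [← nhdsWithin_Ioo_eq_nhdsLT O.T_pos]
    exact nhdsWithin_mono _ Ioo_subset_Icc_self
  have h3 : O.preVel P O.T = O.v₀ + (∫ w in (0 : ℝ)..O.T, O.accel P w) +
      ∑ w ∈ P.impacts with w < O.T, O.jump P w := by
    have h4 : ∑ w ∈ P.impacts with w ≤ O.T, O.jump P w =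
        (∑ w ∈ P.impacts with w < O.T, O.jump P w) + O.jump P O.T := by
      rw [Finset.sum_filter, Finset.sum_filter]
      have h5 : ∀ w ∈ P.impacts, (if w ≤ O.T then O.jump P w else 0) =
          (if w < O.T then O.jump P w else 0) + if w = O.T then O.jump P O.T else 0 := by
        intro w _
        rcases lt_trichotomy w O.T with h6 | h6 | h6
        · rw [if_pos h6.le, if_pos h6, if_neg h6.ne, add_zero]
        · rw [if_pos h6.le, if_neg h6.not_lt, if_pos h6, zero_add, h6]
        · rw [if_neg h6.not_ge, if_neg h6.not_gt, if_neg h6.ne', add_zero]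
      rw [Finset.sum_congr rfl h5, Finset.sum_add_distrib, Finset.sum_ite_eq' P.impacts O.T]
      congr 1
      by_cases h6 : O.T ∈ P.impacts
      · rw [if_pos h6]
      · rw [if_neg h6, jump, if_neg h6]
    rw [preVel, h.v_eq _ hT, h4]
    abel
  rw [h3]
  refine (h2.add_const (∑ w ∈ P.impacts with w < O.T, O.jump P w)).congr' ?_
  have h4 : ∀ᶠ t in 𝓝[<] O.T, ∀ w ∈ P.impacts.filter (· < O.T), w < t := by
    rw [Filter.eventually_all_finset]
    exact fun w hw => eventually_nhdsWithin_of_eventually_nhds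
      (lt_mem_nhds (Finset.mem_filter.1 hw).2)
  filter_upwards [h4, Ioo_mem_nhdsLT O.T_pos] with t h5 h6
  rw [h.v_eq t (Ioo_subset_Icc_self h6)]
  congr 1
  refine Finset.sum_congr (Finset.filter_congr fun w hw => ?_) fun _ _ => rfl
  exact ⟨fun h7 => (h5 w (Finset.mem_filter.2 ⟨hw, h7⟩)).le, fun h7 => h7.trans_lt h6.2⟩

/-- Solutions that agree up to finitely many times agree at the final time. -/
theorem terminal_eq {P' : CLSProcess n m} (h' : O.IsCLSSolution P') (s : Finset ℝ)
    (hs : ∀ t ∈ Icc 0 O.T, t ∉ s → P.q t = P'.q t ∧ P.v t = P'.v t) :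
    P.q O.T = P'.q O.T ∧ P.v O.T = P'.v O.T := by
  have hT : O.T ∈ Icc 0 O.T := ⟨O.T_pos.le, le_rfl⟩
  have hev : ∀ᶠ t in 𝓝[<] O.T, P.q t = P'.q t ∧ P.v t = P'.v t := by
    have h1 : ∀ᶠ t in 𝓝[<] O.T, ∀ w ∈ s, t ≠ w := by
      rw [Filter.eventually_all_finset]
      intro w _
      by_cases hw : w = O.T
      · filter_upwards [self_mem_nhdsWithin] with t ht
        rw [hw]; exact ne_of_lt ht
      · exact eventually_nhdsWithin_of_eventually_nhds (isOpen_ne.mem_nhds (Ne.symm hw))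
    filter_upwards [h1, Ioo_mem_nhdsLT O.T_pos] with t h2 h3
    exact hs t (Ioo_subset_Icc_self h3) fun h4 => h2 t h4 rfl
  have hq : P.q O.T = P'.q O.T := tendsto_nhds_unique
    (h.tendsto_q.congr' (hev.mono fun _ h1 => h1.1)) h'.tendsto_q
  have hv : O.preVel P O.T = O.preVel P' O.T := tendsto_nhds_unique
    (h.tendsto_v.congr' (hev.mono fun _ h1 => h1.2)) h'.tendsto_v
  refine ⟨hq, ?_⟩
  -- Whether `T` is an impact depends only on position and pre-impact velocity, which agree as left
  -- limits.
  have hiff : O.T ∈ P.impacts ↔ O.T ∈ P'.impacts := by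
    rw [h.impact_iff, h'.impact_iff, hq, hv]
  rw [← preVel_add_jump (O := O) (P := P), ← preVel_add_jump (O := O) (P := P'), hv]
  congr 1
  by_cases hW : O.T ∈ P.impacts
  · have hW' := hiff.1 hW
    rw [jump_eq hW, jump_eq hW', hq]
    have e1 : P.v O.T = O.preVel P' O.T +
        O.sys.contact (P'.q O.T) (P.impN O.T) (P.impT O.T) := by
      rw [← hv, ← hq, ← jump_eq hW, preVel_add_jump]
    have e2 : P'.v O.T = O.preVel P' O.T +
        O.sys.contact (P'.q O.T) (P'.impN O.T) (P'.impT O.T) := by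
      rw [← jump_eq hW', preVel_add_jump]
    have l1 := h.impact_law _ hW
    have l2 := h'.impact_law _ hW'
    have f1 := h.impact_friction _ hW
    have f2 := h'.impact_friction _ hW'
    rw [hq, e1] at l1 f1
    rw [e2] at l2 f2
    exact O.sys.contact_unique (h'.fc_impact hW') l1 l2 f1 f2
  · rw [jump, jump, if_neg hW, if_neg (mt hiff.2 hW)]

end IsCLSSolution

variable {aN Tt : ℝ} {Y : TFProcess n m}

theorem IsTFTrajectory.exists_isNumericalTime (h : O.IsTFTrajectory aN Tt Y) (hTt : 0 ≤ Tt) :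
    ∃ ψ : ℝ → ℝ, O.IsNumericalTime Tt Y ψ := by
  have h1 : ∀ t ∈ Icc 0 O.T, ∃ τ, τ ∈ Icc 0 Tt ∧ Y.clock τ = t := fun t ht => by
    rw [← h.clock_end] at ht
    exact (h.isClock hTt).surjOn ht
  choose! ψ hψ using h1
  exact ⟨ψ, hψ⟩

theorem IsTFFeasible.exists_isCLSFeasible (h : O.IsTFFeasible aN Tt Y) (haN : 0 < aN)
    (hTt : 0 ≤ Tt) {ψ : ℝ → ℝ} (hψ : O.IsNumericalTime Tt Y ψ) :
    ∃ P : CLSProcess n m, O.IsCLSFeasible P ∧ SameMotion Tt P Y ∧ (P.u = fun t => Y.u (ψ t)) ∧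
      (P.q O.T, P.v O.T) = (Y.q Tt, Y.v Tt) := by
  obtain ⟨P, hP, hsame, hu, hq, hv, hg⟩ := h.trajectory.exists_isCLSSolution haN hTt hψ
  refine ⟨P, ⟨hP, hg h.path, ?_⟩, hsame, hu, ?_⟩
  · rw [hq, hv]; exact h.terminal
  · rw [hq, hv]

/-- Here `Y` is any trajectory with the same motion. It is translated back to a solution `P'` with
terminal state that of `Y`; `P` and `P'` agree off their impact times, hence also at the end by
`terminal_eq`. The path constraint comes from `P` while the clock runs and from `uhat` while it
rests. -/
theorem IsCLSFeasible.isTFFeasible {P : CLSProcess n m} (h : O.IsCLSFeasible P) (haN : 0 < aN)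
    (hTt : 0 ≤ Tt) {uhat : ℝ → Vec m} (hY : O.IsTFTrajectory aN Tt Y) (hs : SameMotion Tt P Y)
    (hf : O.IsFrozenControl Tt Y uhat) (hu : Y.u = extendControl P.u Y.clock uhat) :
    O.IsTFFeasible aN Tt Y ∧ (P.q O.T, P.v O.T) = (Y.q Tt, Y.v Tt) := by
  have hC := hY.isClock hTt
  obtain ⟨ψ, hψ⟩ := hY.exists_isNumericalTime hTt
  obtain ⟨P', hP', hs', -, hq, hv, -⟩ := hY.exists_isCLSSolution haN hTt hψ
  have hterm := h.solution.terminal_eq hP' (P.impacts ∪ P'.impacts) (by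
    intro t ht hts
    rw [Finset.mem_union, not_or] at hts
    obtain ⟨h1, h2⟩ := hψ t ht
    have h3 := hs (ψ t) h1 (by rw [h2]; exact hts.1)
    have h4 := hs' (ψ t) h1 (by rw [h2]; exact hts.2)
    rw [h2] at h3 h4
    exact ⟨h3.1.trans h4.1.symm, h3.2.trans h4.2.symm⟩)
  have hend : (P.q O.T, P.v O.T) = (Y.q Tt, Y.v Tt) := by rw [hterm.1, hterm.2, hq, hv]
  refine ⟨⟨hY, ?_, hend ▸ h.terminal⟩, hend⟩
  have hp : ∀ᵐ t ∂(volume.restrict (Icc 0 (Y.clock Tt))),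
      t ∉ P.impacts ∧ 0 ≤ O.g (P.q t, P.v t) (P.u t) := by
    rw [hY.clock_end]
    exact (ae_restrict_of_ae (P.impacts.countable_toSet.ae_notMem _)).and h.path
  filter_upwards [hC.ae_comp hp, hf.2, ae_restrict_mem measurableSet_Icc, hC.nonneg,
    ae_hasDerivAt_of_eq_integral hC.integrable hC.eq_integral'] with τ h1 h2 h3 h4 h5
  rw [hu, extendControl]
  split_ifs with h6
  · rw [h5.deriv] at h6
    obtain ⟨h7, h8⟩ := h1 h6
    obtain ⟨h9, h10⟩ := hs τ h3 h7
    rw [← h9, ← h10]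
    exact h8
  · rw [h5.deriv] at h6 h2
    exact h2 (le_antisymm (not_lt.1 h6) h4)

/-- A solution of the complementarity system is followed by time-freezing trajectories. -/
theorem IsCLSFeasible.exists_isTFTrajectory {P : CLSProcess n m} (h : O.IsCLSFeasible P)
    (haN : 0 < aN) (hTt : 0 < Tt)
    (hfrozen : ∀ Y : TFProcess n m, O.IsTFTrajectory aN Tt Y → SameMotion Tt P Y →
      ∃ uhat : ℝ → Vec m, O.IsFrozenControl Tt Y uhat) :
    ∃ (Y : TFProcess n m) (uhat : ℝ → Vec m),
      O.IsTFTrajectory aN Tt Y ∧ SameMotion Tt P Y ∧ O.IsFrozenControl Tt Y uhat ∧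
        Y.u = extendControl P.u Y.clock uhat := by
  have hS := h.solution
  obtain ⟨κ, ℓ, hκ, hℓ, hL⟩ := exists_schedule P.impacts O.T_pos hTt
  have hend : schedClock P.impacts κ ℓ Tt = O.T := by
    rw [← hL]; exact schedClock_end hκ hℓ hS.impacts_le
  have hlast : ¬ IsResting P.impacts κ ℓ Tt := by
    rw [← hL]; exact not_isResting_end hκ hℓ hS.impacts_le
  -- The states of the constructed process do not depend on `uhat`: the zero control yields a
  -- trajectory along which an admissible control exists, and that control is then inserted.
  obtain ⟨uhat, hu⟩ := hfrozen _
    (hS.isTFTrajectory_toTF haN hκ hℓ hTt.le hend (uhat := 0) aemeasurable_const hlast)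
    (hS.sameMotion_toTF hκ hℓ hTt.le hend 0)
  exact ⟨O.toTF aN P κ ℓ uhat, uhat,
    hS.isTFTrajectory_toTF haN hκ hℓ hTt.le hend hu.1 hlast,
    hS.sameMotion_toTF hκ hℓ hTt.le hend uhat, hu, rfl⟩

end OCP

end TimeFreezing

/-! ### Transfer of optimality -/

theorem mainTheorem6 {n m ng nr : ℕ} (O : TimeFreezing.OCP n m ng nr)
    (aN Tt : ℝ) (haN : 0 < aN) (hTt : 0 < Tt)
    (hfrozen : ∀ (P : TimeFreezing.CLSProcess n m) (Y : TimeFreezing.TFProcess n m),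
      O.IsCLSFeasible P → O.IsTFTrajectory aN Tt Y → TimeFreezing.SameMotion Tt P Y →
        ∃ uhat : ℝ → TimeFreezing.Vec m, O.IsFrozenControl Tt Y uhat) :
    (∀ Y : TimeFreezing.TFProcess n m, O.IsTFOptimal aN Tt Y →
      (∃ ψ : ℝ → ℝ, O.IsNumericalTime Tt Y ψ) ∧
      ∀ ψ : ℝ → ℝ, O.IsNumericalTime Tt Y ψ →
        ∃ P : TimeFreezing.CLSProcess n m,
          O.IsCLSOptimal P ∧ TimeFreezing.SameMotion Tt P Y ∧ P.u = fun t => Y.u (ψ t)) ∧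
    (∀ P : TimeFreezing.CLSProcess n m, O.IsCLSOptimal P →
      (∃ (Y : TimeFreezing.TFProcess n m) (uhat : ℝ → TimeFreezing.Vec m),
        O.IsTFTrajectory aN Tt Y ∧ TimeFreezing.SameMotion Tt P Y ∧ O.IsFrozenControl Tt Y uhat ∧
          Y.u = TimeFreezing.extendControl P.u Y.clock uhat) ∧
      ∀ (Y : TimeFreezing.TFProcess n m) (uhat : ℝ → TimeFreezing.Vec m),
        O.IsTFTrajectory aN Tt Y → TimeFreezing.SameMotion Tt P Y → O.IsFrozenControl Tt Y uhat →
          Y.u = TimeFreezing.extendControl P.u Y.clock uhat →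
            O.IsTFOptimal aN Tt Y) := by
  refine ⟨fun Y hY => ⟨hY.1.trajectory.exists_isNumericalTime hTt.le, fun ψ hψ => ?_⟩,
    fun P hP => ⟨hP.1.exists_isTFTrajectory haN hTt fun Y hY hs => hfrozen P Y hP.1 hY hs,
      fun Y uhat hY hs hf hu => ?_⟩⟩
  · obtain ⟨P, hP, hs, hu, hend⟩ := hY.1.exists_isCLSFeasible haN hTt.le hψ
    refine ⟨P, ⟨hP, fun P' hP' => ?_⟩, hs, hu⟩
    -- A competitor is carried over to the time-freezing problem with the same terminal state, where
    -- `Y` is optimal; the second half of the proof carries competitors the other way.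
    obtain ⟨Y', uhat, hY', hs', hf', hu'⟩ := hP'.exists_isTFTrajectory haN hTt
      fun Y hY hs => hfrozen P' Y hP' hY hs
    obtain ⟨hfeas, hend'⟩ := hP'.isTFFeasible haN hTt.le hY' hs' hf' hu'
    rw [hend, hend']
    exact hY.2 Y' hfeas
  · obtain ⟨hfeas, hend⟩ := hP.1.isTFFeasible haN hTt.le hY hs hf hu
    refine ⟨hfeas, fun Y' hY' => ?_⟩
    obtain ⟨ψ, hψ⟩ := hY'.trajectory.exists_isNumericalTime hTt.le
    obtain ⟨P', hP', -, -, hend'⟩ := hY'.exists_isCLSFeasible haN hTt.le hψ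
    rw [← hend, ← hend']
    exact hP.2 P' hP'
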